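/- Let $\Bbbk$ be an algebraically closed field of characteristic $0$, let $n,w\ge 1$ be integers and let $\gamma\in\Bbbk$ be a primitive $n$-th root of unity. Let $H=B(n,w,\gamma)$ be the generalized Liu algebra: the Hopf algebra generated by $x^{\pm1},g,y$ with relations $$xx^{-1}=x^{-1}x=1,\quad xg=gx,\quad xy=yx,\quad yg=\gamma gy,\quad y^n=1-x^w=1-g^n,$$ with $\Delta(x)=x\otimes x$, $\Delta(g)=g\otimes g$, $\Delta(y)=y\otimes g+1\otimes y$, $\varepsilon(x)=\varepsilon(g)=1$, $\varepsilon(y)=0$, $S(x)=x^{-1}$, $S(g)=g^{-1}$, $S(y)=-yg^{-1}$. A Yetter–Drinfeld module over $H$ is a left $H$-module and left $H$-comodule $(V,\cdot,\delta)$ with $\delta(h\cdot v)=h_{(1)}v_{(-1)}S(h_{(3)})\otimes h_{(2)}\cdot v_{(0)}$ for all $h\in H$, $v\in V$; isomorphisms are linear bijections preserving action and coaction, and $V$ is simple if it is nonzero and has no Yetter–Drinfeld submodule other than $0$ and $V$. For $a\in\mathbb Z$ let $\phi(a)$ be the unique element of $\{1,\dots,n\}$ with $\phi(a)\equiv a \pmod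 n$. For $\beta\in\Bbbk^*$ and $r,i\in\mathbb Z$ define $c(k,l)=c_\beta^{r,i}(k,l)\in H$ for $0\le l\le k$ by $c(0,0)=x^rg^i$ and $$c(k+1,l)=\begin{cases} c(k,0)S(y)+\beta\, y\,c(k,0)S(g), & l=0,\\ c(k,l)S(y)+\beta\gamma^{-l}\,y\,c(k,l)S(g)+c(k,l-1)S(g), & 0<l<k+1,\\ c(k,k)S(g), & l=k+1.\end{cases}$$ For $\alpha,\beta\in\Bbbk^*$ and $r,i\in\mathbb Z$ with $\alpha^w=\beta^n$, let $V(\alpha,\beta,x^rg^i)$ be the vector space with basis $v_0,\dots,v_m$, where $m=n-\phi(-i-j)$ if $\beta=\gamma^j$ for some $j\in\mathbb Z$, and $m=n-1$ if $\beta^n\neq1$, with, for $0\le k\le m$, $$x\cdot v_k=\alpha v_k,\qquad g\cdot v_k=\beta\gamma^{-k}v_k,\qquad y\cdot v_k=\begin{cases}v_{k+1},&k<m,\\(1-\beta^n)v_0,&k=m,\end{cases}\qquad \delta(v_k)=\sum_{l=0}^k c_\beta^{r,i}(k,l)\otimes v_l .$$ Then: (0) For all $\alpha,\beta\in\Bbbk^*$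 and $r,i\in\mathbb Z$ with $\alpha^w=\beta^n$, $V(\alpha,\beta,x^rg^i)$ is a simple Yetter–Drinfeld module over $H$, of dimension $n+1-\phi(-i-j)$ if $\beta=\gamma^j$ for an integer $j$, and of dimension $n$ if $\beta^n\ne1$. (1) Every simple Yetter–Drinfeld module over $H$ (of arbitrary dimension) is isomorphic to $V(\alpha,\beta,x^rg^i)$ for some $\alpha,\beta\in\Bbbk^*$ and $r,i\in\mathbb Z$ with $\alpha^w=\beta^n$. (2) Two such modules $V(\alpha,\beta,x^rg^i)$ and $V(\alpha',\beta',x^{r'}g^{i'})$ are isomorphic if and only if $\alpha=\alpha'$, $\beta=\beta'$ and $x^rg^i=x^{r'}g^{i'}$ in $H$. -/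

import Mathlib

open scoped TensorProduct

set_option linter.unusedSectionVars false

/-! ## Yetter–Drinfeld modules over a Hopf algebra -/

section YetterDrinfeld

universe u v v' x

/-- The data of a left action and a left coaction of `H` on the `k`-vector space `V`:
a `k`-linear left `H`-module structure `H → End(V)` and a linear map `V → H ⊗ V`. -/
structure ActionCoaction (k : Type u) (H : Type x) (V : Type v) [Field k] [Ring H] [Algebra k H]
    [AddCommGroup V] [Module k V] where
  /-- the action `h ↦ (v ↦ h · v)` -/
  act : H →ₐ[k] Module.End k V
  /-- the coaction `δ` -/
  coact : V →ₗ[k] H ⊗[k] V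

/-- For a left action of `H` on `V`, the linear map
`a ⊗ (b ⊗ c) ↦ (u ⊗ v ↦ a u S(c) ⊗ b · v)`. -/
noncomputable def ydTwist (k : Type u) {H : Type x} {V : Type v} [Field k] [Ring H]
    [HopfAlgebra k H] [AddCommGroup V] [Module k V] (act : H →ₐ[k] Module.End k V) :
    H ⊗[k] (H ⊗[k] H) →ₗ[k] (H ⊗[k] V →ₗ[k] H ⊗[k] V) :=
  TensorProduct.lift <| LinearMap.mk₂ k
    (fun (a : H) (t : H ⊗[k] H) =>
      LinearMap.rTensor V (LinearMap.mul k H a) ∘ₗ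
        TensorProduct.lift (LinearMap.mk₂ k
          (fun (b c : H) => TensorProduct.map
            (LinearMap.mulRight k (HopfAlgebra.antipode k c)) (act b))
          (fun b b' c => by simp [TensorProduct.map_add_right])
          (fun s b c => by simp [TensorProduct.map_smul_right])
          (fun b c c' => by
            ext; simp [mul_add, TensorProduct.add_tmul])
          (fun s b c => by
            ext; simp [TensorProduct.smul_tmul'])) t)
    (fun a a' t => by simp [LinearMap.rTensor_add, LinearMap.add_comp])
    (fun s a t => by simp [LinearMap.rTensor_smul, LinearMap.smul_comp])
    (fun a t t' => by simp [LinearMap.comp_add])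
    (fun s a t => by simp [LinearMap.comp_smul])

theorem ydTwist_tmul (k : Type u) {H : Type x} {V : Type v} [Field k] [Ring H]
    [HopfAlgebra k H] [AddCommGroup V] [Module k V] (act : H →ₐ[k] Module.End k V)
    (a b c u : H) (v : V) :
    ydTwist k act (a ⊗ₜ[k] (b ⊗ₜ[k] c)) (u ⊗ₜ[k] v) =
      (a * u * HopfAlgebra.antipode k c) ⊗ₜ[k] act b v := by
  simp [ydTwist, mul_assoc]

namespace ActionCoaction

variable {k : Type u} {H : Type x} {V : Type v} {W : Type v'} [Field k] [Ring H] [HopfAlgebra k H]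
  [AddCommGroup V] [Module k V] [AddCommGroup W] [Module k W]

/-- `(V, ·, δ)` is a (left-left) Yetter–Drinfeld module over `H`. -/
structure IsYetterDrinfeld (M : ActionCoaction k H V) : Prop where
  /-- `(Δ ⊗ id) δ = (id ⊗ δ) δ` -/
  coassoc : ∀ v : V,
    TensorProduct.assoc k H H V
        (LinearMap.rTensor V (Coalgebra.comul : H →ₗ[k] H ⊗[k] H) (M.coact v)) =
      LinearMap.lTensor H M.coact (M.coact v)
  /-- `(ε ⊗ id) δ = id` -/
  counit_coact : ∀ v : V,
    TensorProduct.lid k V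
      (LinearMap.rTensor V (Coalgebra.counit : H →ₗ[k] k) (M.coact v)) = v
  /-- `δ(h · v) = h₍₁₎ v₍₋₁₎ S(h₍₃₎) ⊗ h₍₂₎ · v₍₀₎` -/
  compat : ∀ (h : H) (v : V),
    M.coact (M.act h v) =
      ydTwist k M.act
        (LinearMap.lTensor H (Coalgebra.comul : H →ₗ[k] H ⊗[k] H) (Coalgebra.comul h))
        (M.coact v)

/-- The subspace `W` is a submodule and a subcomodule, `δ(W) ⊆ H ⊗ W`. -/
def IsSubobject (M : ActionCoaction k H V) (W : Submodule k V) : Prop :=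
  (∀ (h : H), ∀ v ∈ W, M.act h v ∈ W) ∧
    ∀ v ∈ W, M.coact v ∈ LinearMap.range (LinearMap.lTensor H W.subtype)

/-- `V` is a simple Yetter–Drinfeld module: it is a nonzero Yetter–Drinfeld module without proper
nonzero Yetter–Drinfeld submodules. -/
structure IsSimpleYetterDrinfeld (M : ActionCoaction k H V) : Prop where
  isYetterDrinfeld : M.IsYetterDrinfeld
  nontrivial : Nontrivial V
  eq_bot_or_eq_top : ∀ W : Submodule k V, M.IsSubobject W → W = ⊥ ∨ W = ⊤

/-- An isomorphism: a linear bijection preserving the action and the coaction. -/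
def Isomorphic (M : ActionCoaction k H V) (N : ActionCoaction k H W) : Prop :=
  ∃ e : V ≃ₗ[k] W, (∀ (h : H) (v : V), e (M.act h v) = N.act h (e v)) ∧
    ∀ v : V, N.coact (e v) = LinearMap.lTensor H e.toLinearMap (M.coact v)

end ActionCoaction

end YetterDrinfeld

/-! ## Powers of sums of `q`-commuting elements -/

section QBinomial

/-- The Gaussian binomial coefficient `[i + j choose j]` at `q`. -/
def qBinomAux {k : Type*} [Field k] (q : k) : ℕ → ℕ → k
  | _, 0 => 1
  | 0, _ + 1 => 1
  | i + 1, j + 1 => qBinomAux q i (j + 1) + q ^ (i + 1) * qBinomAux q (i + 1) j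

theorem qBinomAux_zero_right {k : Type*} [Field k] (q : k) (i : ℕ) : qBinomAux q i 0 = 1 := by
  cases i <;> simp [qBinomAux]

theorem qBinomAux_zero_left {k : Type*} [Field k] (q : k) (j : ℕ) : qBinomAux q 0 j = 1 := by
  cases j <;> simp [qBinomAux]

theorem qBinomAux_succ_succ {k : Type*} [Field k] (q : k) (i j : ℕ) :
    qBinomAux q (i + 1) (j + 1) = qBinomAux q i (j + 1) + q ^ (i + 1) * qBinomAux q (i + 1) j := by
  rw [qBinomAux]

theorem qBinomAux_identity {k : Type*} [Field k] (q : k) (i j : ℕ) :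
    (1 - q ^ (j + 1)) * qBinomAux q i (j + 1) = (1 - q ^ (i + 1)) * qBinomAux q (i + 1) j := by
  induction i generalizing j with
  | zero =>
    induction j with
    | zero => simp [qBinomAux]
    | succ j ih =>
      simp only [qBinomAux, zero_add, pow_one, mul_one] at ih ⊢
      rw [mul_add, mul_one, mul_left_comm, ← ih]; ring
  | succ i ih =>
    induction j with
    | zero =>
      have h := ih 0
      simp only [qBinomAux, qBinomAux_zero_right, zero_add, pow_one, mul_one] at h ⊢
      rw [mul_add, h]; ring
    | succ j ih' =>
      rw [qBinomAux_succ_succ q i (j + 1), qBinomAux_succ_succ q (i + 1) j,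
        mul_add, mul_add, ih (j + 1), mul_left_comm (1 - q ^ (i + 1 + 1)), ← ih']
      ring

theorem qBinomAux_eq_zero {k : Type*} [Field k] {q : k} {n : ℕ} (hq : IsPrimitiveRoot q n)
    (j i : ℕ) (hi : 0 < i) (hn : i + (j + 1) = n) : qBinomAux q i (j + 1) = 0 := by
  have hne : 1 - q ^ (j + 1) ≠ 0 := fun h =>
    hq.pow_ne_one_of_pos_of_lt (by omega) (by omega) (sub_eq_zero.mp h).symm
  have h := qBinomAux_identity q i j
  induction j generalizing i with
  | zero =>
    have h1 : 1 - q ^ (i + 1) = 0 := by rw [show i + 1 = n by omega, hq.pow_eq_one, sub_self]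
    rw [h1, zero_mul] at h
    exact (mul_eq_zero.mp h).resolve_left hne
  | succ j ih =>
    have h0 : qBinomAux q (i + 1) (j + 1) = 0 :=
      ih (i + 1) (by omega) (by omega)
        (fun h => hq.pow_ne_one_of_pos_of_lt (by omega) (by omega) (sub_eq_zero.mp h).symm)
        (qBinomAux_identity q (i + 1) j)
    rw [h0, mul_zero] at h
    exact (mul_eq_zero.mp h).resolve_left hne

theorem qcomm_mul_pow {k R : Type*} [Field k] [Ring R] [Algebra k R] (q : k) (a b : R)
    (h : b * a = q • (a * b)) (i : ℕ) : b * a ^ i = q ^ i • (a ^ i * b) := by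
  induction i with
  | zero => simp
  | succ i ih =>
    rw [pow_succ, ← mul_assoc, ih, smul_mul_assoc, mul_assoc, h, mul_smul_comm, smul_smul,
      mul_assoc, pow_succ]

theorem qcomm_pow_mul {k R : Type*} [Field k] [Ring R] [Algebra k R] (q : k) (a b : R)
    (h : b * a = q • (a * b)) (i : ℕ) : b ^ i * a = q ^ i • (a * b ^ i) := by
  induction i with
  | zero => simp
  | succ i ih =>
    rw [pow_succ, mul_assoc, h, mul_smul_comm, ← mul_assoc, ih, smul_mul_assoc, smul_smul,
      mul_assoc, pow_succ']

theorem qBinom_add_pow {k R : Type*} [Field k] [Ring R] [Algebra k R] (q : k) (a b : R)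
    (h : b * a = q • (a * b)) (N : ℕ) :
    (a + b) ^ N =
      ∑ p ∈ Finset.HasAntidiagonal.antidiagonal N, qBinomAux q p.1 p.2 • (a ^ p.1 * b ^ p.2) := by
  induction N with
  | zero => simp [qBinomAux]
  | succ N ih =>
    have hA : ∀ N : ℕ, ∑ p ∈ Finset.HasAntidiagonal.antidiagonal (N + 1), qBinomAux q p.1 p.2 • (a ^ p.1 * b ^ p.2)
        = ∑ p ∈ Finset.HasAntidiagonal.antidiagonal N, qBinomAux q p.1 p.2 • (a ^ (p.1 + 1) * b ^ p.2)
          + ∑ p ∈ Finset.HasAntidiagonal.antidiagonal N,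
              (q ^ p.1 * qBinomAux q p.1 p.2) • (a ^ p.1 * b ^ (p.2 + 1)) := by
      intro N
      cases N with
      | zero => simp [qBinomAux, Finset.Nat.antidiagonal_succ, add_comm]
      | succ N =>
        rw [Finset.Nat.sum_antidiagonal_succ (n := N + 1),
          Finset.Nat.sum_antidiagonal_succ' (n := N)]
        rw [Finset.Nat.sum_antidiagonal_succ' (n := N)
          (f := fun p => qBinomAux q p.1 p.2 • (a ^ (p.1 + 1) * b ^ p.2))]
        rw [Finset.Nat.sum_antidiagonal_succ (n := N)
          (f := fun p => (q ^ p.1 * qBinomAux q p.1 p.2) • (a ^ p.1 * b ^ (p.2 + 1)))]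
        simp only [qBinomAux, add_smul, Finset.sum_add_distrib, qBinomAux_zero_right,
          qBinomAux_zero_left, pow_zero, one_mul, mul_one, one_smul]
        abel
    rw [pow_succ', ih, hA, add_mul, Finset.mul_sum, Finset.mul_sum]
    congr 1
    · refine Finset.sum_congr rfl fun p _ => ?_
      rw [mul_smul_comm, ← mul_assoc, pow_succ']
    · refine Finset.sum_congr rfl fun p _ => ?_
      rw [mul_smul_comm, ← mul_assoc, qcomm_mul_pow q a b h, smul_mul_assoc, smul_smul,
        mul_assoc, ← pow_succ', mul_comm]

theorem qcomm_add_pow_eq {k R : Type*} [Field k] [Ring R] [Algebra k R] {q : k} {n : ℕ}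
    (hn : n ≠ 0) (hq : IsPrimitiveRoot q n) (a b : R) (h : b * a = q • (a * b)) :
    (a + b) ^ n = a ^ n + b ^ n := by
  rw [qBinom_add_pow q a b h]
  obtain ⟨m, rfl⟩ := Nat.exists_eq_succ_of_ne_zero hn
  cases m with
  | zero => simp [qBinomAux, Finset.Nat.antidiagonal_succ, add_comm]
  | succ m =>
    rw [Nat.succ_eq_add_one, Finset.Nat.sum_antidiagonal_succ (n := m + 1),
      Finset.Nat.sum_antidiagonal_succ' (n := m)]
    rw [Finset.sum_eq_zero]
    · simp [qBinomAux_zero_right, qBinomAux_zero_left, add_comm]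
    · intro p hp
      rw [Finset.HasAntidiagonal.mem_antidiagonal] at hp
      rw [qBinomAux_eq_zero hq p.2 (p.1 + 1) (by omega) (by omega), zero_smul]

theorem neg_qcomm_mul_pow {k R : Type*} [Field k] [Ring R] [Algebra k R] {q : k} {n : ℕ}
    (hn : n ≠ 0) (hq : IsPrimitiveRoot q n) (a b : R) (h : b * a = q • (a * b)) :
    (-(a * b)) ^ n = -(a ^ n * b ^ n) := by
  have key : ∀ N : ℕ, (a * b) ^ N = q ^ (∑ i ∈ Finset.range N, i) • (a ^ N * b ^ N) := by
    intro N
    induction N with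
    | zero => simp
    | succ N ih =>
      rw [pow_succ, ih, Finset.sum_range_succ, smul_mul_assoc, mul_assoc, ← mul_assoc (b ^ N),
        qcomm_pow_mul q a b h, smul_mul_assoc, mul_smul_comm, smul_smul, ← pow_add, mul_assoc,
        ← pow_succ, ← mul_assoc, ← pow_succ]
  have hsum := Finset.sum_range_id_mul_two n
  rw [neg_pow, key]
  rcases Nat.even_or_odd n with he | ho
  · obtain ⟨m, rfl⟩ := he
    have hm : q ^ m = -1 := by
      have h1 : q ^ m * q ^ m = 1 := by rw [← pow_add, hq.pow_eq_one]
      rcases mul_self_eq_one_iff.mp h1 with h2 | h2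
      · exact absurd h2 (hq.pow_ne_one_of_pos_of_lt (by omega) (by omega))
      · exact h2
    have hS : ∑ i ∈ Finset.range (m + m), i = m * (m + m - 1) := by
      have : (m + m) * (m + m - 1) = (m * (m + m - 1)) * 2 := by ring
      omega
    have hodd : Odd (m + m - 1) := ⟨m - 1, by omega⟩
    rw [hS, pow_mul, hm, hodd.neg_one_pow, (Even.neg_one_pow ⟨m, rfl⟩), one_mul, neg_smul,
      one_smul]
  · obtain ⟨m, rfl⟩ := ho
    have hS : ∑ i ∈ Finset.range (2 * m + 1), i = (2 * m + 1) * m := by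
      have : (2 * m + 1) * (2 * m + 1 - 1) = ((2 * m + 1) * m) * 2 := by
        rw [Nat.add_sub_cancel]; ring
      omega
    rw [hS, pow_mul, hq.pow_eq_one, one_pow, one_smul, (Odd.neg_one_pow ⟨m, rfl⟩), neg_one_mul]

end QBinomial

/-! ## Generalized Liu algebras -/

section LiuAlgebra

universe u

/-- The generators `x`, `x⁻¹`, `g`, `y`. -/
inductive LiuGen : Type
  | x | xinv | g | y

/-- The defining relations of the generalized Liu algebra `B(n, w, γ)`. -/
inductive LiuRel {k : Type u} [Field k] (n w : ℕ) (γ : k) :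
    FreeAlgebra k LiuGen → FreeAlgebra k LiuGen → Prop
  | x_xinv : LiuRel n w γ (FreeAlgebra.ι k LiuGen.x * FreeAlgebra.ι k LiuGen.xinv) 1
  | xinv_x : LiuRel n w γ (FreeAlgebra.ι k LiuGen.xinv * FreeAlgebra.ι k LiuGen.x) 1
  | x_g : LiuRel n w γ (FreeAlgebra.ι k LiuGen.x * FreeAlgebra.ι k LiuGen.g)
      (FreeAlgebra.ι k LiuGen.g * FreeAlgebra.ι k LiuGen.x)
  | x_y : LiuRel n w γ (FreeAlgebra.ι k LiuGen.x * FreeAlgebra.ι k LiuGen.y)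
      (FreeAlgebra.ι k LiuGen.y * FreeAlgebra.ι k LiuGen.x)
  | y_g : LiuRel n w γ (FreeAlgebra.ι k LiuGen.y * FreeAlgebra.ι k LiuGen.g)
      (γ • (FreeAlgebra.ι k LiuGen.g * FreeAlgebra.ι k LiuGen.y))
  | y_pow : LiuRel n w γ (FreeAlgebra.ι k LiuGen.y ^ n) (1 - FreeAlgebra.ι k LiuGen.x ^ w)
  | x_pow : LiuRel n w γ (1 - FreeAlgebra.ι k LiuGen.x ^ w) (1 - FreeAlgebra.ι k LiuGen.g ^ n)

/-- The algebra `B(n, w, γ)` generated by `x^{±1}, g, y` subject to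
`x x⁻¹ = x⁻¹ x = 1`, `xg = gx`, `xy = yx`, `yg = γ gy`, `yⁿ = 1 - x^w = 1 - gⁿ`. -/
def LiuAlgebra {k : Type u} [Field k] (n w : ℕ) (γ : k) : Type u := RingQuot (LiuRel n w γ)

namespace LiuAlgebra

variable {k : Type u} [Field k] (n w : ℕ) (γ : k)

noncomputable instance : Ring (LiuAlgebra n w γ) := inferInstanceAs (Ring (RingQuot _))

noncomputable instance : Algebra k (LiuAlgebra n w γ) :=
  inferInstanceAs (Algebra k (RingQuot (LiuRel n w γ)))

/-- The quotient map from the free algebra. -/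
noncomputable def mk : FreeAlgebra k LiuGen →ₐ[k] LiuAlgebra n w γ :=
  RingQuot.mkAlgHom k (LiuRel n w γ)

/-- The generator `x`. -/
noncomputable def x : LiuAlgebra n w γ := mk n w γ (FreeAlgebra.ι k LiuGen.x)
/-- The generator `x⁻¹`. -/
noncomputable def xinv : LiuAlgebra n w γ := mk n w γ (FreeAlgebra.ι k LiuGen.xinv)
/-- The generator `g`. -/
noncomputable def g : LiuAlgebra n w γ := mk n w γ (FreeAlgebra.ι k LiuGen.g)
/-- The generator `y`. -/
noncomputable def y : LiuAlgebra n w γ := mk n w γ (FreeAlgebra.ι k LiuGen.y)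

theorem mk_rel {a b : FreeAlgebra k LiuGen} (h : LiuRel n w γ a b) :
    mk n w γ a = mk n w γ b := RingQuot.mkAlgHom_rel k h

theorem x_mul_xinv : x n w γ * xinv n w γ = 1 := by
  simpa [x, xinv] using mk_rel n w γ .x_xinv
theorem xinv_mul_x : xinv n w γ * x n w γ = 1 := by
  simpa [x, xinv] using mk_rel n w γ .xinv_x
theorem x_mul_g : x n w γ * g n w γ = g n w γ * x n w γ := by
  simpa [x, g] using mk_rel n w γ .x_g
theorem x_mul_y : x n w γ * y n w γ = y n w γ * x n w γ := by
  simpa [x, y] using mk_rel n w γ .x_y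
theorem y_mul_g : y n w γ * g n w γ = γ • (g n w γ * y n w γ) := by
  simpa [y, g] using mk_rel n w γ .y_g
theorem y_pow : y n w γ ^ n = 1 - x n w γ ^ w := by
  simpa [x, y] using mk_rel n w γ .y_pow
theorem g_pow : g n w γ ^ n = x n w γ ^ w := by
  simpa [x, g] using (mk_rel n w γ .x_pow).symm

variable {n w γ}

/-- The universal property of `B(n, w, γ)`. -/
noncomputable def lift {B : Type*} [Ring B] [Algebra k B] (X X' G Y : B)
    (h1 : X * X' = 1) (h2 : X' * X = 1) (h3 : X * G = G * X) (h4 : X * Y = Y * X)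
    (h5 : Y * G = γ • (G * Y)) (h6 : Y ^ n = 1 - X ^ w) (h7 : X ^ w = G ^ n) :
    LiuAlgebra n w γ →ₐ[k] B :=
  RingQuot.liftAlgHom k
    ⟨FreeAlgebra.lift k (fun | .x => X | .xinv => X' | .g => G | .y => Y), by
      intro a b hab
      cases hab <;> simp [h1, h2, h3, h4, h5, h6, h7]⟩

section lift

variable {B : Type*} [Ring B] [Algebra k B] (X X' G Y : B)
    (h1 : X * X' = 1) (h2 : X' * X = 1) (h3 : X * G = G * X) (h4 : X * Y = Y * X)
    (h5 : Y * G = γ • (G * Y)) (h6 : Y ^ n = 1 - X ^ w) (h7 : X ^ w = G ^ n)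

theorem lift_x : lift X X' G Y h1 h2 h3 h4 h5 h6 h7 (x n w γ) = X :=
  (RingQuot.liftAlgHom_mkAlgHom_apply k _ _ _).trans (by simp)
theorem lift_xinv : lift X X' G Y h1 h2 h3 h4 h5 h6 h7 (xinv n w γ) = X' :=
  (RingQuot.liftAlgHom_mkAlgHom_apply k _ _ _).trans (by simp)
theorem lift_g : lift X X' G Y h1 h2 h3 h4 h5 h6 h7 (g n w γ) = G :=
  (RingQuot.liftAlgHom_mkAlgHom_apply k _ _ _).trans (by simp)
theorem lift_y : lift X X' G Y h1 h2 h3 h4 h5 h6 h7 (y n w γ) = Y :=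
  (RingQuot.liftAlgHom_mkAlgHom_apply k _ _ _).trans (by simp)

end lift

theorem induction {P : LiuAlgebra n w γ → Prop} (hc : ∀ c : k, P (algebraMap k _ c))
    (hx : P (x n w γ)) (hx' : P (xinv n w γ)) (hg : P (g n w γ)) (hy : P (y n w γ))
    (hadd : ∀ a b, P a → P b → P (a + b)) (hmul : ∀ a b, P a → P b → P (a * b))
    (a : LiuAlgebra n w γ) : P a := by
  obtain ⟨a, rfl⟩ := RingQuot.mkAlgHom_surjective k (LiuRel n w γ) a
  change P (mk n w γ a)
  induction a using FreeAlgebra.induction with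
  | grade0 r => rw [AlgHom.commutes]; exact hc r
  | grade1 s => cases s <;> assumption
  | mul a b ha hb => rw [map_mul]; exact hmul _ _ ha hb
  | add a b ha hb => rw [map_add]; exact hadd _ _ ha hb

theorem algHom_ext {B : Type*} [Ring B] [Algebra k B] {f f' : LiuAlgebra n w γ →ₐ[k] B}
    (hx : f (x n w γ) = f' (x n w γ)) (hx' : f (xinv n w γ) = f' (xinv n w γ))
    (hg : f (g n w γ) = f' (g n w γ)) (hy : f (y n w γ) = f' (y n w γ)) : f = f' := by
  refine AlgHom.ext fun a => ?_
  induction a using induction with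
  | hc c => rw [AlgHom.commutes, AlgHom.commutes]
  | hx => exact hx
  | hx' => exact hx'
  | hg => exact hg
  | hy => exact hy
  | hadd a b ha hb => rw [map_add, map_add, ha, hb]
  | hmul a b ha hb => rw [map_mul, map_mul, ha, hb]

variable (n w γ)

/-- `x` as a unit. -/
noncomputable def xUnit : (LiuAlgebra n w γ)ˣ :=
  ⟨x n w γ, xinv n w γ, x_mul_xinv n w γ, xinv_mul_x n w γ⟩

theorem commute_x_g : Commute (x n w γ) (g n w γ) := x_mul_g n w γ
theorem commute_xinv_g : Commute (xinv n w γ) (g n w γ) :=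
  Commute.units_inv_left (u := xUnit n w γ) (commute_x_g n w γ)
theorem commute_xinv_y : Commute (xinv n w γ) (y n w γ) :=
  Commute.units_inv_left (u := xUnit n w γ) (x_mul_y n w γ)

theorem x_pow_mul_xinv_pow : x n w γ ^ w * xinv n w γ ^ w = 1 :=
  ((show Commute (x n w γ) (xinv n w γ) from
    (x_mul_xinv n w γ).trans (xinv_mul_x n w γ).symm).mul_pow w).symm.trans
      (by rw [x_mul_xinv, one_pow])

variable [NeZero n]

/-- `g` as a unit: `g⁻¹ = g^{n-1} x^{-w}`. -/
noncomputable def gUnit : (LiuAlgebra n w γ)ˣ where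
  val := g n w γ
  inv := g n w γ ^ (n - 1) * xinv n w γ ^ w
  val_inv := by
    rw [← mul_assoc, ← pow_succ', Nat.sub_add_cancel (NeZero.one_le), g_pow, x_pow_mul_xinv_pow]
  inv_val := by
    rw [mul_assoc, ((commute_xinv_g n w γ).pow_left w).eq, ← mul_assoc, ← pow_succ,
      Nat.sub_add_cancel (NeZero.one_le), g_pow, x_pow_mul_xinv_pow]

/-- The group-like element `x^r g^i`, for integers `r` and `i`. -/
noncomputable def xg (r i : ℤ) : LiuAlgebra n w γ :=
  ((xUnit n w γ ^ r * gUnit n w γ ^ i : (LiuAlgebra n w γ)ˣ) : LiuAlgebra n w γ)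

/-- The element `g⁻¹`. -/
noncomputable def ginv : LiuAlgebra n w γ := ((gUnit n w γ)⁻¹ : (LiuAlgebra n w γ)ˣ)

theorem g_mul_ginv : g n w γ * ginv n w γ = 1 := (gUnit n w γ).mul_inv
theorem ginv_mul_g : ginv n w γ * g n w γ = 1 := (gUnit n w γ).inv_mul

theorem commute_xinv_ginv : Commute (xinv n w γ) (ginv n w γ) :=
  Commute.units_inv_right (u := gUnit n w γ) (commute_xinv_g n w γ)

theorem ginv_mul_y : ginv n w γ * y n w γ = γ • (y n w γ * ginv n w γ) := by
  calc ginv n w γ * y n w γ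
      = ginv n w γ * (y n w γ * g n w γ) * ginv n w γ := by
        rw [mul_assoc, mul_assoc, g_mul_ginv, mul_one]
    _ = γ • (y n w γ * ginv n w γ) := by
        rw [y_mul_g, mul_smul_comm, smul_mul_assoc, ← mul_assoc, ginv_mul_g, one_mul]

theorem ginv_pow : ginv n w γ ^ n = xinv n w γ ^ w := by
  have h : g n w γ ^ n * ginv n w γ ^ n = 1 :=
    ((show Commute (g n w γ) (ginv n w γ) from
      (g_mul_ginv n w γ).trans (ginv_mul_g n w γ).symm).mul_pow n).symm.trans
        (by rw [g_mul_ginv, one_pow])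
  have h' : xinv n w γ ^ w * x n w γ ^ w = 1 :=
    ((show Commute (xinv n w γ) (x n w γ) from
    (xinv_mul_x n w γ).trans (x_mul_xinv n w γ).symm).mul_pow w).symm.trans
      (by rw [xinv_mul_x, one_pow])
  rw [g_pow] at h
  exact (left_inv_eq_right_inv h' h).symm

variable [hγ : Fact (IsPrimitiveRoot γ n)]

theorem comul_rel_one : (x n w γ ⊗ₜ[k] x n w γ) * (xinv n w γ ⊗ₜ[k] xinv n w γ) = 1 := by
  simp [x_mul_xinv, Algebra.TensorProduct.one_def]

theorem comul_rel_two : (xinv n w γ ⊗ₜ[k] xinv n w γ) * (x n w γ ⊗ₜ[k] x n w γ) = 1 := by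
  simp [xinv_mul_x, Algebra.TensorProduct.one_def]

theorem comul_rel_three : (x n w γ ⊗ₜ[k] x n w γ) * (g n w γ ⊗ₜ[k] g n w γ) =
    (g n w γ ⊗ₜ[k] g n w γ) * (x n w γ ⊗ₜ[k] x n w γ) := by
  simp [x_mul_g]

theorem comul_rel_four :
    (x n w γ ⊗ₜ[k] x n w γ) * (y n w γ ⊗ₜ[k] g n w γ + 1 ⊗ₜ[k] y n w γ) =
    (y n w γ ⊗ₜ[k] g n w γ + 1 ⊗ₜ[k] y n w γ) * (x n w γ ⊗ₜ[k] x n w γ) := by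
  simp [mul_add, add_mul, x_mul_g, x_mul_y]

theorem comul_rel_five :
    (y n w γ ⊗ₜ[k] g n w γ + 1 ⊗ₜ[k] y n w γ) * (g n w γ ⊗ₜ[k] g n w γ) =
    γ • ((g n w γ ⊗ₜ[k] g n w γ) * (y n w γ ⊗ₜ[k] g n w γ + 1 ⊗ₜ[k] y n w γ)) := by
  simp [mul_add, add_mul, y_mul_g, TensorProduct.smul_tmul']

theorem comul_rel_six :
    (y n w γ ⊗ₜ[k] g n w γ + 1 ⊗ₜ[k] y n w γ) ^ n = 1 - (x n w γ ⊗ₜ[k] x n w γ) ^ w := by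
  rw [qcomm_add_pow_eq (NeZero.ne n) hγ.out]
  · simp only [Algebra.TensorProduct.tmul_pow, one_pow, y_pow, g_pow,
      TensorProduct.sub_tmul, TensorProduct.tmul_sub, Algebra.TensorProduct.one_def]
    abel
  · simp [y_mul_g]

theorem comul_rel_seven : (x n w γ ⊗ₜ[k] x n w γ) ^ w = (g n w γ ⊗ₜ[k] g n w γ) ^ n := by
  simp [Algebra.TensorProduct.tmul_pow, g_pow]

/-- `Δ(x) = x ⊗ x`, `Δ(g) = g ⊗ g`, `Δ(y) = y ⊗ g + 1 ⊗ y`. -/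
noncomputable def comulHom :
    LiuAlgebra n w γ →ₐ[k] LiuAlgebra n w γ ⊗[k] LiuAlgebra n w γ :=
  lift (x n w γ ⊗ₜ x n w γ) (xinv n w γ ⊗ₜ xinv n w γ) (g n w γ ⊗ₜ g n w γ)
    (y n w γ ⊗ₜ g n w γ + 1 ⊗ₜ y n w γ)
    (comul_rel_one n w γ) (comul_rel_two n w γ) (comul_rel_three n w γ) (comul_rel_four n w γ)
    (comul_rel_five n w γ) (comul_rel_six n w γ) (comul_rel_seven n w γ)

/-- `ε(x) = 1`, `ε(g) = 1`, `ε(y) = 0`. -/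
noncomputable def counitHom : LiuAlgebra n w γ →ₐ[k] k :=
  lift 1 1 1 0 (by simp) (by simp) (by simp) (by simp) (by simp) (by simp [NeZero.ne n]) (by simp)

/-- `S(x) = x⁻¹`, `S(g) = g⁻¹`, `S(y) = -y g⁻¹`, extended as an algebra anti-homomorphism. -/
noncomputable def antipodeHom : LiuAlgebra n w γ →ₐ[k] (LiuAlgebra n w γ)ᵐᵒᵖ :=
  lift (.op (xinv n w γ)) (.op (x n w γ)) (.op (ginv n w γ)) (.op (-(y n w γ * ginv n w γ)))
    (by rw [← MulOpposite.op_mul, x_mul_xinv, MulOpposite.op_one])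
    (by rw [← MulOpposite.op_mul, xinv_mul_x, MulOpposite.op_one])
    (by rw [← MulOpposite.op_mul, ← MulOpposite.op_mul, (commute_xinv_ginv n w γ).eq])
    (by
      rw [← MulOpposite.op_mul, ← MulOpposite.op_mul,
        (((commute_xinv_y n w γ).mul_right (commute_xinv_ginv n w γ)).neg_right).eq])
    (by
      rw [← MulOpposite.op_mul, ← MulOpposite.op_mul, ← MulOpposite.op_smul, mul_neg, neg_mul,
        ← mul_assoc, ginv_mul_y, smul_neg, smul_mul_assoc])
    (by
      rw [← MulOpposite.op_pow, ← MulOpposite.op_pow, ← MulOpposite.op_one, ← MulOpposite.op_sub,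
        neg_qcomm_mul_pow (NeZero.ne n) hγ.out _ _ (ginv_mul_y n w γ), ginv_pow, y_pow, sub_mul,
        one_mul, x_pow_mul_xinv_pow, neg_sub])
    (by rw [← MulOpposite.op_pow, ← MulOpposite.op_pow, ginv_pow])

theorem comulHom_x : comulHom n w γ (x n w γ) = x n w γ ⊗ₜ x n w γ := by
  rw [comulHom, lift_x]
theorem comulHom_xinv : comulHom n w γ (xinv n w γ) = xinv n w γ ⊗ₜ xinv n w γ := by
  rw [comulHom, lift_xinv]
theorem comulHom_g : comulHom n w γ (g n w γ) = g n w γ ⊗ₜ g n w γ := by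
  rw [comulHom, lift_g]
theorem comulHom_y : comulHom n w γ (y n w γ) = y n w γ ⊗ₜ g n w γ + 1 ⊗ₜ y n w γ := by
  rw [comulHom, lift_y]
theorem counitHom_x : counitHom n w γ (x n w γ) = 1 := by
  rw [counitHom, lift_x]
theorem counitHom_xinv : counitHom n w γ (xinv n w γ) = 1 := by
  rw [counitHom, lift_xinv]
theorem counitHom_g : counitHom n w γ (g n w γ) = 1 := by
  rw [counitHom, lift_g]
theorem counitHom_y : counitHom n w γ (y n w γ) = 0 := by
  rw [counitHom, lift_y]
theorem antipodeHom_x : antipodeHom n w γ (x n w γ) = .op (xinv n w γ) := by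
  rw [antipodeHom, lift_x]
theorem antipodeHom_xinv : antipodeHom n w γ (xinv n w γ) = .op (x n w γ) := by
  rw [antipodeHom, lift_xinv]
theorem antipodeHom_g : antipodeHom n w γ (g n w γ) = .op (ginv n w γ) := by
  rw [antipodeHom, lift_g]
theorem antipodeHom_y : antipodeHom n w γ (y n w γ) = .op (-(y n w γ * ginv n w γ)) := by
  rw [antipodeHom, lift_y]

noncomputable instance : Bialgebra k (LiuAlgebra n w γ) :=
  Bialgebra.ofAlgHom (comulHom n w γ) (counitHom n w γ)
    (algHom_ext (by simp [comulHom_x]) (by simp [comulHom_xinv]) (by simp [comulHom_g])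
      (by simp [comulHom_y, comulHom_g, TensorProduct.tmul_add, TensorProduct.add_tmul,
            Algebra.TensorProduct.one_def, add_assoc]))
    (algHom_ext (by simp [comulHom_x, counitHom_x]) (by simp [comulHom_xinv, counitHom_xinv])
      (by simp [comulHom_g, counitHom_g]) (by simp [comulHom_y, counitHom_y]))
    (algHom_ext (by simp [comulHom_x, counitHom_x]) (by simp [comulHom_xinv, counitHom_xinv])
      (by simp [comulHom_g, counitHom_g]) (by simp [comulHom_y, counitHom_y, counitHom_g]))

theorem comul_eq (a : LiuAlgebra n w γ) : Coalgebra.comul (R := k) a = comulHom n w γ a := rfl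
theorem counit_eq (a : LiuAlgebra n w γ) : Coalgebra.counit (R := k) a = counitHom n w γ a := rfl

/-- The antipode as a linear map. -/
noncomputable def antipodeLin : LiuAlgebra n w γ →ₗ[k] LiuAlgebra n w γ :=
  (MulOpposite.opLinearEquiv k).symm.toLinearMap ∘ₗ (antipodeHom n w γ).toLinearMap

theorem antipodeLin_apply (a : LiuAlgebra n w γ) :
    antipodeLin n w γ a = (antipodeHom n w γ a).unop := rfl

theorem antipodeLin_mul (a b : LiuAlgebra n w γ) :
    antipodeLin n w γ (a * b) = antipodeLin n w γ b * antipodeLin n w γ a := by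
  simp [antipodeLin_apply]

theorem mul_rTensor_mul (s t : LiuAlgebra n w γ ⊗[k] LiuAlgebra n w γ) (r : k)
    (hs : LinearMap.mul' k _ ((antipodeLin n w γ).rTensor _ s) = algebraMap k _ r) :
    LinearMap.mul' k _ ((antipodeLin n w γ).rTensor _ (s * t)) =
      r • LinearMap.mul' k _ ((antipodeLin n w γ).rTensor _ t) := by
  induction t with
  | zero => simp
  | add t t' ht ht' => rw [mul_add, map_add, map_add, ht, ht', map_add, map_add, smul_add]
  | tmul c d =>
    have key : LinearMap.mul' k _ ((antipodeLin n w γ).rTensor _ (s * (c ⊗ₜ[k] d))) =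
        antipodeLin n w γ c * LinearMap.mul' k _ ((antipodeLin n w γ).rTensor _ s) * d := by
      clear hs
      induction s with
      | zero => simp
      | add s s' h h' => rw [add_mul, map_add, map_add, h, h', map_add, map_add, mul_add, add_mul]
      | tmul p q => simp [antipodeLin_mul, mul_assoc]
    rw [key, hs, ← Algebra.commutes, ← Algebra.smul_def, smul_mul_assoc]
    simp

theorem mul_lTensor_mul (s t : LiuAlgebra n w γ ⊗[k] LiuAlgebra n w γ) (r : k)
    (ht : LinearMap.mul' k _ ((antipodeLin n w γ).lTensor _ t) = algebraMap k _ r) :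
    LinearMap.mul' k _ ((antipodeLin n w γ).lTensor _ (s * t)) =
      r • LinearMap.mul' k _ ((antipodeLin n w γ).lTensor _ s) := by
  induction s with
  | zero => simp
  | add t t' h h' => rw [add_mul, map_add, map_add, h, h', map_add, map_add, smul_add]
  | tmul c d =>
    have key : LinearMap.mul' k _ ((antipodeLin n w γ).lTensor _ ((c ⊗ₜ[k] d) * t)) =
        c * LinearMap.mul' k _ ((antipodeLin n w γ).lTensor _ t) * antipodeLin n w γ d := by
      clear ht
      induction t with
      | zero => simp
      | add s s' h h' => rw [mul_add, map_add, map_add, h, h', map_add, map_add, mul_add, add_mul]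
      | tmul p q => simp [antipodeLin_mul, mul_assoc]
    rw [key, ht, ← Algebra.commutes, ← Algebra.smul_def, smul_mul_assoc]
    simp

noncomputable instance : HopfAlgebra k (LiuAlgebra n w γ) where
  antipode := antipodeLin n w γ
  mul_antipode_rTensor_comul := by
    refine LinearMap.ext fun a => ?_
    simp only [LinearMap.comp_apply, Algebra.linearMap_apply, comul_eq, counit_eq]
    induction a using induction with
    | hc c => simp [Algebra.TensorProduct.algebraMap_apply, antipodeLin_apply]
    | hx => simp [comulHom_x, counitHom_x, antipodeLin_apply, antipodeHom_x, xinv_mul_x]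
    | hx' => simp [comulHom_xinv, counitHom_xinv, antipodeLin_apply, antipodeHom_xinv, x_mul_xinv]
    | hg => simp [comulHom_g, counitHom_g, antipodeLin_apply, antipodeHom_g, ginv_mul_g]
    | hy => simp [comulHom_y, counitHom_y, antipodeLin_apply, antipodeHom_y, mul_assoc, ginv_mul_g]
    | hadd a b ha hb => simp only [map_add, ha, hb]
    | hmul a b ha hb =>
      rw [map_mul, mul_rTensor_mul n w γ _ _ _ ha, hb, map_mul, map_mul, Algebra.smul_def]
  mul_antipode_lTensor_comul := by
    refine LinearMap.ext fun a => ?_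
    simp only [LinearMap.comp_apply, Algebra.linearMap_apply, comul_eq, counit_eq]
    induction a using induction with
    | hc c => simp [Algebra.TensorProduct.algebraMap_apply, antipodeLin_apply]
    | hx => simp [comulHom_x, counitHom_x, antipodeLin_apply, antipodeHom_x, x_mul_xinv]
    | hx' => simp [comulHom_xinv, counitHom_xinv, antipodeLin_apply, antipodeHom_xinv, xinv_mul_x]
    | hg => simp [comulHom_g, counitHom_g, antipodeLin_apply, antipodeHom_g, g_mul_ginv]
    | hy => simp [comulHom_y, counitHom_y, antipodeLin_apply, antipodeHom_y, antipodeHom_g]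
    | hadd a b ha hb => simp only [map_add, ha, hb]
    | hmul a b ha hb =>
      rw [map_mul, mul_lTensor_mul n w γ _ _ _ hb, ha, map_mul, map_mul, Algebra.smul_def]
      exact Algebra.commutes _ _

/-! ### The modules `V(α, β, x^r g^i)` -/

/-- The elements `c_β^{r,i}(k, l)` of `B(n, w, γ)`, defined recursively by
`c(0, 0) = x^r g^i`, `c(k+1, 0) = c(k, 0) S(y) + β y c(k, 0) S(g)`,
`c(k+1, l) = c(k, l) S(y) + β γ^{-l} y c(k, l) S(g) + c(k, l-1) S(g)` for `0 < l < k + 1`, and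
`c(k+1, k+1) = c(k, k) S(g)`; moreover `c(k, l) = 0` for `l > k`. -/
noncomputable def coactionCoeff (β : kˣ) (r i : ℤ) : ℕ → ℕ → LiuAlgebra n w γ
  | 0, 0 => xg n w γ r i
  | 0, _ + 1 => 0
  | j + 1, 0 =>
      coactionCoeff β r i j 0 * HopfAlgebra.antipode k (y n w γ) +
        (β : k) • (y n w γ * coactionCoeff β r i j 0 * HopfAlgebra.antipode k (g n w γ))
  | j + 1, l + 1 =>
      if l + 1 < j + 1 then
        coactionCoeff β r i j (l + 1) * HopfAlgebra.antipode k (y n w γ) +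
          ((β : k) * γ ^ (-((l + 1 : ℕ) : ℤ))) •
            (y n w γ * coactionCoeff β r i j (l + 1) * HopfAlgebra.antipode k (g n w γ)) +
          coactionCoeff β r i j l * HopfAlgebra.antipode k (g n w γ)
      else if l + 1 = j + 1 then
        coactionCoeff β r i j j * HopfAlgebra.antipode k (g n w γ)
      else 0

end LiuAlgebra

/-- The integer `φ(a)`: the unique element of `{1, …, n}` congruent to `a` modulo `n`. -/
def liuPhi (n : ℕ) (a : ℤ) : ℕ := ((a - 1) % (n : ℤ)).toNat + 1

theorem liuPhi_unique (n : ℕ) [NeZero n] (a : ℤ) (t : ℕ) :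
    t = liuPhi n a ↔ 1 ≤ t ∧ t ≤ n ∧ a ≡ t [ZMOD n] := by
  have hn : (0 : ℤ) < n := by exact_mod_cast NeZero.pos n
  have h0 := Int.emod_nonneg (a - 1) hn.ne'
  have h1 := Int.emod_lt_of_pos (a - 1) hn
  have h2 : (a - 1) % (n : ℤ) ≡ a - 1 [ZMOD n] := Int.mod_modEq _ _
  constructor
  · rintro rfl
    unfold liuPhi
    refine ⟨by omega, by omega, ?_⟩
    rw [Nat.cast_add, Int.toNat_of_nonneg h0]
    simpa using (h2.add_right 1).symm
  · rintro ⟨ht1, ht2, ht⟩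
    have h3 : ((t : ℤ) - 1) % n = (a - 1) % n := (ht.sub_right 1).symm
    rw [Int.emod_eq_of_lt (by omega) (by omega)] at h3
    unfold liuPhi
    omega

/-- The largest index `m` of the basis `v₀, …, v_m` of `V(α, β, x^r g^i)`:
`m = n - φ(-i-j)` if `β = γ^j` for some integer `j`, and `m = n - 1` otherwise. -/
noncomputable def liuTop {k : Type u} [Field k] (n : ℕ) (γ : k) (β : kˣ) (i : ℤ) : ℕ :=
  open Classical in
  if h : ∃ j : ℤ, (β : k) = γ ^ j then n - liuPhi n (-i - h.choose) else n - 1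

namespace LiuAlgebra

variable {k : Type u} [Field k] (n w : ℕ) (γ : k)

section action

variable (m : ℕ)

/-- The operator `v_j ↦ β γ^{-j} v_j` on the space with basis `v₀, …, v_m`. -/
noncomputable def gAct (β : kˣ) : Module.End k (Fin (m + 1) → k) :=
  (Pi.basisFun k (Fin (m + 1))).constr k fun j =>
    ((β : k) * γ ^ (-((j : ℕ) : ℤ))) • Pi.single j 1

/-- The operator `v_j ↦ v_{j+1}` for `j < m`, `v_m ↦ (1 - βⁿ) v₀`. -/
noncomputable def yAct (β : kˣ) : Module.End k (Fin (m + 1) → k) :=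
  (Pi.basisFun k (Fin (m + 1))).constr k fun j =>
    if h : (j : ℕ) < m then Pi.single ⟨j + 1, by omega⟩ 1
    else (1 - (β : k) ^ n) • Pi.single 0 1

theorem gAct_single (β : kˣ) (j : Fin (m + 1)) :
    gAct γ m β (Pi.single j 1) = ((β : k) * γ ^ (-((j : ℕ) : ℤ))) • Pi.single j 1 := by
  have h := (Pi.basisFun k (Fin (m + 1))).constr_basis k (fun j =>
    ((β : k) * γ ^ (-((j : ℕ) : ℤ))) • (Pi.single j 1 : Fin (m + 1) → k)) j
  rwa [Pi.basisFun_apply] at h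

theorem yAct_single (β : kˣ) (j : Fin (m + 1)) :
    yAct n m β (Pi.single j 1) = if h : (j : ℕ) < m then Pi.single ⟨j + 1, by omega⟩ 1
      else (1 - (β : k) ^ n) • Pi.single 0 1 := by
  have h := (Pi.basisFun k (Fin (m + 1))).constr_basis k (fun j =>
    if h : (j : ℕ) < m then (Pi.single ⟨j + 1, by omega⟩ 1 : Fin (m + 1) → k)
    else (1 - (β : k) ^ n) • Pi.single 0 1) j
  rwa [Pi.basisFun_apply] at h

theorem end_ext {f f' : Module.End k (Fin (m + 1) → k)}
    (h : ∀ j, f (Pi.single j 1) = f' (Pi.single j 1)) : f = f' :=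
  (Pi.basisFun k (Fin (m + 1))).ext fun j => by simpa using h j

theorem gAct_pow (hγ : γ ^ n = 1) (β : kˣ) : gAct γ m β ^ n = ((β : k) ^ n) • 1 := by
  refine end_ext m fun j => ?_
  have : ∀ N : ℕ, (gAct γ m β ^ N) (Pi.single j 1) =
      ((β : k) * γ ^ (-((j : ℕ) : ℤ))) ^ N • Pi.single j 1 := by
    intro N
    induction N with
    | zero => simp
    | succ N ih =>
      rw [pow_succ', Module.End.mul_apply, ih, map_smul, gAct_single, smul_smul, ← pow_succ]
  rw [this, mul_pow, ← zpow_natCast (γ ^ _), ← zpow_mul, mul_comm (-((j : ℕ) : ℤ)), zpow_mul,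
    zpow_natCast, hγ, one_zpow, mul_one]
  rfl

theorem yAct_pow_single (β : kˣ) (N : ℕ) (j : Fin (m + 1)) (h : j + N ≤ m) :
    (yAct n m β ^ N) (Pi.single j 1) = Pi.single ⟨j + N, by omega⟩ 1 := by
  induction N with
  | zero => simp
  | succ N ih =>
    rw [pow_succ', Module.End.mul_apply, ih (by omega), yAct_single, dif_pos (by simp; omega)]
    rfl

theorem yAct_pow_top (β : kˣ) : yAct n m β ^ (m + 1) = (1 - (β : k) ^ n) • 1 := by
  refine end_ext m fun j => ?_
  have e : yAct n m β ^ (m + 1) = yAct n m β ^ ((j : ℕ) + (1 + (m - j))) :=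
    congrArg (fun t => yAct n m β ^ t) (by omega)
  rw [e, pow_add, pow_add, Module.End.mul_apply, Module.End.mul_apply,
    yAct_pow_single n m β (m - j) j (by omega), pow_one, yAct_single, dif_neg (by simp; omega),
    map_smul, yAct_pow_single n m β j 0 (by simp; omega)]
  simp

theorem yAct_mul_gAct (hγ : γ ≠ 0) (β : kˣ) (hm : γ ^ (m + 1) = 1 ∨ (β : k) ^ n = 1) :
    yAct n m β * gAct γ m β = γ • (gAct γ m β * yAct n m β) := by
  refine end_ext m fun j => ?_
  rw [LinearMap.smul_apply, Module.End.mul_apply, Module.End.mul_apply, gAct_single, map_smul,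
    yAct_single]
  split_ifs with h
  · rw [gAct_single, smul_smul]
    congr 1
    rw [mul_left_comm]
    congr 1
    push_cast
    rw [neg_add, zpow_add₀ hγ, zpow_neg_one, mul_comm, mul_assoc, inv_mul_cancel₀ hγ, mul_one]
  · rcases hm with hm | hm
    · rw [map_smul, gAct_single, smul_smul, smul_smul, smul_smul]
      congr 1
      have hj : (j : ℕ) = m := by omega
      have h1 : γ ^ (-((m : ℕ) : ℤ)) = γ := by
        rw [zpow_neg, zpow_natCast]
        refine inv_eq_of_mul_eq_one_right ?_
        rw [← pow_succ, hm]
      rw [hj, h1]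
      simp
      ring
    · simp [hm]

end action

theorem yAct_pow (m : ℕ) (β : kˣ) (hm : m + 1 = n ∨ (m + 1 ≤ n ∧ (β : k) ^ n = 1)) :
    yAct n m β ^ n = 1 - ((β : k) ^ n) • 1 := by
  have h1 : yAct n m β ^ (m + 1) = 1 - ((β : k) ^ n) • 1 := by
    rw [yAct_pow_top]
    exact LinearMap.ext fun v => by simp [sub_smul]
  rcases hm with hm | ⟨hm, hβ⟩
  · have e : yAct n m β ^ n = yAct n m β ^ (m + 1) := congrArg (fun t => yAct n m β ^ t) hm.symm
    rw [e, h1]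
  · have e : yAct n m β ^ n = yAct n m β ^ (m + 1) * yAct n m β ^ (n - (m + 1)) := by
      rw [← pow_add]
      exact congrArg (fun t => yAct n m β ^ t) (by omega)
    rw [e, h1, hβ, one_smul, sub_self, zero_mul]

theorem liuTop_cases [NeZero n] [hγ : Fact (IsPrimitiveRoot γ n)] (β : kˣ) (i : ℤ) :
    liuTop n γ β i + 1 = n ∨ (liuTop n γ β i + 1 ≤ n ∧ (β : k) ^ n = 1) := by
  have hn := NeZero.pos n
  unfold liuTop
  split_ifs with h
  · right
    refine ⟨?_, ?_⟩
    · have := ((liuPhi_unique n (-i - h.choose) _).mp rfl).1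
      omega
    · rw [h.choose_spec, ← zpow_natCast, ← zpow_mul, mul_comm, zpow_mul, zpow_natCast,
        hγ.out.pow_eq_one, one_zpow]
  · left; omega

/-- The data of action and coaction of the module `V(α, β, x^r g^i)` with basis `v₀, …, v_m`:
`x · v_j = α v_j`, `g · v_j = β γ^{-j} v_j`, `y · v_j = v_{j+1}` for `j < m`,
`y · v_m = (1 - βⁿ) v₀` and `δ(v_j) = ∑_{l ≤ j} c_β^{r,i}(j, l) ⊗ v_l`. -/
noncomputable def V [NeZero n] [hγ : Fact (IsPrimitiveRoot γ n)] (α β : kˣ) (r i : ℤ)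
    (hαβ : α ^ w = β ^ n) :
    ActionCoaction k (LiuAlgebra n w γ) (Fin (liuTop n γ β i + 1) → k) where
  act := lift ((α : k) • 1) (((α⁻¹ : kˣ) : k) • 1) (gAct γ (liuTop n γ β i) β)
    (yAct n (liuTop n γ β i) β)
    (by simp [smul_smul])
    (by simp [smul_smul])
    (by simp)
    (by simp)
    (by
      refine yAct_mul_gAct n γ _ (hγ.out.ne_zero (NeZero.ne n)) β ?_
      rcases liuTop_cases n γ β i with h | h
      · left; rw [h, hγ.out.pow_eq_one]
      · right; exact h.2)
    (by
      have hαβ' : (α : k) ^ w = (β : k) ^ n := by exact_mod_cast congrArg Units.val hαβ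
      rw [smul_pow, one_pow, hαβ']
      exact yAct_pow n _ β (liuTop_cases n γ β i))
    (by
      have hαβ' : (α : k) ^ w = (β : k) ^ n := by exact_mod_cast congrArg Units.val hαβ
      rw [smul_pow, one_pow, hαβ', gAct_pow n γ _ hγ.out.pow_eq_one])
  coact := (Pi.basisFun k (Fin (liuTop n γ β i + 1))).constr k fun j =>
    ∑ l ∈ Finset.univ.filter (fun l => l ≤ j),
      coactionCoeff n w γ β r i (j : ℕ) (l : ℕ) ⊗ₜ[k] (Pi.single l 1 : Fin _ → k)

section V

variable [NeZero n] [hγ : Fact (IsPrimitiveRoot γ n)] (α β : kˣ) (r i : ℤ) (hαβ : α ^ w = β ^ n)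

theorem V_act_x : (V n w γ α β r i hαβ).act (x n w γ) = (α : k) • 1 := by
  simp only [V]
  exact lift_x (n := n) (w := w) (γ := γ) _ _ _ _ _ _ _ _ _ _ _

theorem V_act_g (j : Fin (liuTop n γ β i + 1)) :
    (V n w γ α β r i hαβ).act (g n w γ) (Pi.single j 1) =
      ((β : k) * γ ^ (-((j : ℕ) : ℤ))) • Pi.single j 1 := by
  have h : (V n w γ α β r i hαβ).act (g n w γ) = gAct γ (liuTop n γ β i) β := by
    simp only [V]
    exact lift_g (n := n) (w := w) (γ := γ) _ _ _ _ _ _ _ _ _ _ _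
  rw [h, gAct_single]

theorem V_act_y (j : Fin (liuTop n γ β i + 1)) :
    (V n w γ α β r i hαβ).act (y n w γ) (Pi.single j 1) =
      if h : (j : ℕ) < liuTop n γ β i then Pi.single ⟨j + 1, by omega⟩ 1
      else (1 - (β : k) ^ n) • Pi.single 0 1 := by
  have h : (V n w γ α β r i hαβ).act (y n w γ) = yAct n (liuTop n γ β i) β := by
    simp only [V]
    exact lift_y (n := n) (w := w) (γ := γ) _ _ _ _ _ _ _ _ _ _ _
  rw [h, yAct_single]

theorem V_coact (j : Fin (liuTop n γ β i + 1)) :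
    (V n w γ α β r i hαβ).coact (Pi.single j 1) =
      ∑ l ∈ Finset.univ.filter (fun l => l ≤ j),
        coactionCoeff n w γ β r i (j : ℕ) (l : ℕ) ⊗ₜ[k] (Pi.single l 1 : Fin _ → k) := by
  have h := (Pi.basisFun k (Fin (liuTop n γ β i + 1))).constr_basis k (fun j =>
    ∑ l ∈ Finset.univ.filter (fun l => l ≤ j),
      coactionCoeff n w γ β r i (j : ℕ) (l : ℕ) ⊗ₜ[k] (Pi.single l 1 : Fin _ → k)) j
  rwa [Pi.basisFun_apply] at h

end V

end LiuAlgebra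

end LiuAlgebra

/-! Everything rests on two computations. The first is a basis of `H`: the elements `y^a h`, with `a
< n` and `h` in the group of the `x^r g^i`, form one (`pbwBasis`). Conjugation by `g` separates the
powers of `y`, and `1 - x^w` kills no nonzero combination of group elements because `x` has infinite
order. The second is a closed form for the coaction coefficients (`coactionCoeff_eq`): `c(d+l, l)`
is the Gaussian binomial `[d+l choose l]` at `γ⁻¹`, times `∏_{s<d} (β - γ^{l+s-i})`, times `y^d x^r
g^{i-d-l}`.

The closed form explains the top index `m`. If `βⁿ = 1`, then `m` is the index below `n` with `β =
γ^{m-i}`, and a factor of the product vanishes exactly when the string crosses `m`. If `βⁿ ≠ 1`,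
then `m + 1 = n`; the binomials kill `c(n, l)` for `0 < l < n`, and `c(n, 0)` collapses through `yⁿ
= 1 - x^w`. This closes the string at `y · v_m` and gives the Yetter–Drinfeld condition. Conversely
`c(a, 0) ≠ 0` for `a ≤ m`.

Simplicity: `g` has distinct eigenvalues on the `v_j`, so a nonzero submodule contains some `v_j`.
Conjugation by `g` on the first leg of `δ(v_j)` isolates `c(j,0) ⊗ v_0`, hence `v_0` lies in the
submodule and generates. By the same nonvanishing, `v_0` spans the only line of group-like
`g`-eigenvectors, and `α`, `β`, `x^r g^i` are read off from it; this is the isomorphism criterion.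

Exhaustion: let `M` be simple. The part of `δ(v)` of highest degree in `y` yields a vector with
`δ(u) = x^r g^i ⊗ u` (`exists_coact_eq_xg_tmul`), and `H · u = M`. No finiteness of `M` is assumed,
but `M` is finitely generated over `k[x + x⁻¹]`. The operator `x + x⁻¹` is a morphism, hence zero or
surjective, and Nakayama's lemma makes it algebraic; Schur's lemma then makes it, and next `x`, a
scalar (`exists_act_x_eq_smul`). Since `gⁿ = x^w` is a scalar too, `u` can be replaced by a
`g`-eigenvector `v`. The vectors `y^l · v` satisfy the formulas for `V(α, β, x^r g^i)`, so there is
a nonzero morphism between simple objects. -/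

namespace LiuAlgebra

variable {k : Type*} [Field k] (n w : ℕ) (γ : k)

/-! ### Calculus of the group-like elements `x^r g^i` -/

section xg

variable [NeZero n]

theorem commute_xUnit_gUnit : Commute (xUnit n w γ) (gUnit n w γ) :=
  Units.ext (x_mul_g n w γ)

theorem xg_mul (r i r' i' : ℤ) :
    xg n w γ r i * xg n w γ r' i' = xg n w γ (r + r') (i + i') := by
  simp only [xg, ← Units.val_mul]
  congr 1
  rw [zpow_add, zpow_add, mul_assoc, ← mul_assoc (gUnit n w γ ^ i),
    ((commute_xUnit_gUnit n w γ).zpow_zpow r' i).symm.eq, mul_assoc, mul_assoc]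

theorem xg_zero : xg n w γ 0 0 = 1 := by simp [xg]

theorem x_eq_xg : x n w γ = xg n w γ 1 0 := by simp [xg, xUnit]

theorem xinv_eq_xg : xinv n w γ = xg n w γ (-1) 0 := by simp [xg, xUnit]

theorem g_eq_xg : g n w γ = xg n w γ 0 1 := by simp [xg, gUnit]

theorem ginv_eq_xg : ginv n w γ = xg n w γ 0 (-1) := by simp [xg, ginv]

theorem x_pow_eq_xg (N : ℕ) : x n w γ ^ N = xg n w γ N 0 := by simp [xg, xUnit]

theorem g_pow_eq_xg (N : ℕ) : g n w γ ^ N = xg n w γ 0 N := by simp [xg, gUnit]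

/-- Because of this coincidence the pairs `(r, i)` label the group-like elements redundantly, so the
basis of `H` is indexed by the set of elements and not by pairs of integers. -/
theorem xg_w_zero : xg n w γ w 0 = xg n w γ 0 n := by
  rw [← x_pow_eq_xg, ← g_pow_eq_xg, g_pow]

theorem y_pow_n : y n w γ ^ n = 1 - xg n w γ w 0 := by rw [y_pow, x_pow_eq_xg]

theorem isUnit_xg (r i : ℤ) : IsUnit (xg n w γ r i) := Units.isUnit _

variable {γ} in
theorem xg_mul_y (hγ : γ ≠ 0) (r i : ℤ) :
    xg n w γ r i * y n w γ = γ ^ (-i) • (y n w γ * xg n w γ r i) := by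
  have hx (r : ℤ) : Commute ((xUnit n w γ ^ r : (LiuAlgebra n w γ)ˣ) : LiuAlgebra n w γ)
      (y n w γ) := Commute.units_zpow_left (u := xUnit n w γ) (x_mul_y n w γ) r
  have hg (i : ℤ) : ((gUnit n w γ ^ i : (LiuAlgebra n w γ)ˣ) : LiuAlgebra n w γ) * y n w γ =
      γ ^ (-i) • (y n w γ * ((gUnit n w γ ^ i : (LiuAlgebra n w γ)ˣ) : LiuAlgebra n w γ)) := by
    induction i with
    | zero => simp
    | succ i ih =>
      rw [zpow_add_one, Units.val_mul, mul_assoc]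
      have : ((gUnit n w γ : (LiuAlgebra n w γ)ˣ) : LiuAlgebra n w γ) * y n w γ =
          γ⁻¹ • (y n w γ * ((gUnit n w γ : (LiuAlgebra n w γ)ˣ) : LiuAlgebra n w γ)) := by
        change g n w γ * y n w γ = γ⁻¹ • (y n w γ * g n w γ)
        rw [y_mul_g, smul_smul, inv_mul_cancel₀ hγ, one_smul]
      rw [this, mul_smul_comm, ← mul_assoc, ih, smul_mul_assoc, smul_smul, mul_assoc,
        neg_add, zpow_add₀ hγ, zpow_neg_one, mul_comm γ⁻¹]
    | pred i ih =>
      rw [zpow_sub_one, Units.val_mul, mul_assoc]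
      have : (((gUnit n w γ)⁻¹ : (LiuAlgebra n w γ)ˣ) : LiuAlgebra n w γ) * y n w γ =
          γ • (y n w γ * (((gUnit n w γ)⁻¹ : (LiuAlgebra n w γ)ˣ) : LiuAlgebra n w γ)) :=
        ginv_mul_y n w γ
      rw [this, mul_smul_comm, ← mul_assoc, ih, smul_mul_assoc, smul_smul, mul_assoc,
        neg_sub, sub_neg_eq_add, neg_neg, zpow_add₀ hγ, zpow_one, mul_comm γ]
  rw [xg, Units.val_mul, mul_assoc, hg, mul_smul_comm, ← mul_assoc, (hx r).eq, mul_assoc]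

variable {γ} in
theorem xg_mul_y_pow (hγ : γ ≠ 0) (r i : ℤ) (a : ℕ) :
    xg n w γ r i * y n w γ ^ a = γ ^ (-i * a) • (y n w γ ^ a * xg n w γ r i) := by
  rw [qcomm_mul_pow (γ ^ (-i)) _ _ (xg_mul_y n w hγ r i), zpow_mul, zpow_natCast]

variable {γ} in
/-- Conjugation by `g`. -/
theorem g_mul_y_pow_mul_xg_mul_ginv (hγ : γ ≠ 0) (a : ℕ) (r i : ℤ) :
    g n w γ * (y n w γ ^ a * xg n w γ r i) * ginv n w γ =
      γ ^ (-(a : ℤ)) • (y n w γ ^ a * xg n w γ r i) := by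
  rw [g_eq_xg, ginv_eq_xg, ← mul_assoc, xg_mul_y_pow n w hγ, smul_mul_assoc, smul_mul_assoc,
    mul_assoc, mul_assoc, xg_mul, xg_mul]
  simp

end xg

/-! ### Spanning by the monomials `y^a x^r g^i` -/

section spanning

variable [NeZero n] {γ}

/-- `B(n, w, γ)` is spanned by the `y^a x^r g^i` with `a < n`. -/
theorem span_y_pow_mul_xg (hγ : γ ≠ 0) :
    Submodule.span k {b | ∃ a < n, ∃ r i : ℤ, b = y n w γ ^ a * xg n w γ r i} = ⊤ := by
  set S := Submodule.span k {b | ∃ a < n, ∃ r i : ℤ, b = y n w γ ^ a * xg n w γ r i}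
  have mem (a : ℕ) (ha : a < n) (r i : ℤ) : y n w γ ^ a * xg n w γ r i ∈ S :=
    Submodule.subset_span ⟨a, ha, r, i, rfl⟩
  have hxg (r i : ℤ) (s) (hs : s ∈ S) : xg n w γ r i * s ∈ S := by
    induction hs using Submodule.span_induction with
    | mem s hs =>
      obtain ⟨a, ha, r', i', rfl⟩ := hs
      rw [← mul_assoc, xg_mul_y_pow n w hγ, smul_mul_assoc, mul_assoc, xg_mul]
      exact S.smul_mem _ (mem a ha _ _)
    | zero => simp
    | add s t _ _ hs ht => rw [mul_add]; exact S.add_mem hs ht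
    | smul c s _ hs => rw [mul_smul_comm]; exact S.smul_mem _ hs
  have hy (s) (hs : s ∈ S) : y n w γ * s ∈ S := by
    induction hs using Submodule.span_induction with
    | mem s hs =>
      obtain ⟨a, ha, r', i', rfl⟩ := hs
      rw [← mul_assoc, ← pow_succ']
      rcases (Nat.succ_le_of_lt ha).lt_or_eq with h | h
      · exact mem _ h _ _
      · have h' : y n w γ ^ (a + 1) = y n w γ ^ n := congrArg (y n w γ ^ ·) h
        rw [h', y_pow_n, sub_mul, one_mul, xg_mul]
        refine S.sub_mem ?_ ?_
        · simpa using mem 0 (NeZero.pos n) r' i'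
        · simpa using mem 0 (NeZero.pos n) (w + r') (0 + i')
    | zero => simp
    | add s t _ _ hs ht => rw [mul_add]; exact S.add_mem hs ht
    | smul c s _ hs => rw [mul_smul_comm]; exact S.smul_mem _ hs
  -- The span is a left ideal, since it is stable under the generators; it contains `1`.
  have key (a : LiuAlgebra n w γ) : ∀ s ∈ S, a * s ∈ S := by
    induction a using induction with
    | hc c => intro s hs; rw [← Algebra.smul_def]; exact S.smul_mem _ hs
    | hx => rw [x_eq_xg]; exact hxg _ _
    | hx' => rw [xinv_eq_xg]; exact hxg _ _
    | hg => rw [g_eq_xg]; exact hxg _ _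
    | hy => exact hy
    | hadd a b ha hb => intro s hs; rw [add_mul]; exact S.add_mem (ha s hs) (hb s hs)
    | hmul a b ha hb => intro s hs; rw [mul_assoc]; exact ha _ (hb s hs)
  refine eq_top_iff.mpr fun a _ => ?_
  have h1 : (1 : LiuAlgebra n w γ) ∈ S := by
    simpa [xg_zero] using mem 0 (NeZero.pos n) 0 0
  simpa using key a 1 h1

end spanning

/-! ### Coproduct and antipode on the monomials -/

section hopf

variable [NeZero n] [hγ : Fact (IsPrimitiveRoot γ n)]

theorem isGroupLikeElem_xg (r i : ℤ) : IsGroupLikeElem k (xg n w γ r i) := by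
  have hx : IsGroupLikeElem k (x n w γ) := ⟨counitHom_x n w γ, comulHom_x n w γ⟩
  have hx' : IsGroupLikeElem k (xinv n w γ) := ⟨counitHom_xinv n w γ, comulHom_xinv n w γ⟩
  have hg : IsGroupLikeElem k (g n w γ) := ⟨counitHom_g n w γ, comulHom_g n w γ⟩
  have hg' : IsGroupLikeElem k (ginv n w γ) :=
    hg.of_mul_eq_one (g_mul_ginv n w γ) (ginv_mul_g n w γ)
  rw [xg, Units.val_mul]
  refine IsGroupLikeElem.mul ?_ ?_
  · cases r with
    | ofNat r => simpa using (show IsGroupLikeElem k (xUnit n w γ : LiuAlgebra n w γ) from hx).pow (n := r)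
    | negSucc r => rw [zpow_negSucc, ← inv_pow]; exact hx'.pow (n := r + 1)
  · cases i with
    | ofNat r => simpa using (show IsGroupLikeElem k (gUnit n w γ : LiuAlgebra n w γ) from hg).pow (n := r)
    | negSucc r => rw [zpow_negSucc, ← inv_pow]; exact hg'.pow (n := r + 1)

theorem comul_xg (r i : ℤ) :
    Coalgebra.comul (R := k) (xg n w γ r i) = xg n w γ r i ⊗ₜ xg n w γ r i :=
  (isGroupLikeElem_xg n w γ r i).comul_eq_tmul_self

theorem antipode_g : HopfAlgebra.antipode k (g n w γ) = ginv n w γ := by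
  change antipodeLin n w γ _ = _
  rw [antipodeLin_apply, antipodeHom_g, MulOpposite.unop_op]

theorem antipode_x : HopfAlgebra.antipode k (x n w γ) = xinv n w γ := by
  change antipodeLin n w γ _ = _
  rw [antipodeLin_apply, antipodeHom_x, MulOpposite.unop_op]

theorem antipode_xinv : HopfAlgebra.antipode k (xinv n w γ) = x n w γ := by
  change antipodeLin n w γ _ = _
  rw [antipodeLin_apply, antipodeHom_xinv, MulOpposite.unop_op]

theorem antipode_y : HopfAlgebra.antipode k (y n w γ) = -(y n w γ * ginv n w γ) := by
  change antipodeLin n w γ _ = _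
  rw [antipodeLin_apply, antipodeHom_y, MulOpposite.unop_op]

theorem comul_y_pow_mul_xg (a : ℕ) (r i : ℤ) :
    Coalgebra.comul (R := k) (y n w γ ^ a * xg n w γ r i) =
      ∑ p ∈ Finset.HasAntidiagonal.antidiagonal a, qBinomAux γ p.1 p.2 •
        ((y n w γ ^ p.1 * xg n w γ r i) ⊗ₜ[k]
          (g n w γ ^ p.1 * y n w γ ^ p.2 * xg n w γ r i)) := by
  rw [Bialgebra.comul_mul, Bialgebra.comul_pow, comul_xg, comul_eq, comulHom_y,
    qBinom_add_pow γ _ _ (by simp [y_mul_g]), Finset.sum_mul]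
  refine Finset.sum_congr rfl fun p _ => ?_
  simp [Algebra.TensorProduct.tmul_pow]

end hopf

/-! ### Separating group-like elements by representations -/

section faithful

variable [NeZero n] [NeZero w] {γ} [hγ : Fact (IsPrimitiveRoot γ n)] [IsAlgClosed k] [CharZero k]

/-- A separating family of representations: `x ↦ α`, `g v_j = β γ^{-j} v_j`. -/
theorem exists_algHom (α β : kˣ) (h : α ^ w = β ^ n) :
    ∃ f : LiuAlgebra n w γ →ₐ[k] Module.End k (Fin (n - 1 + 1) → k),
      f (x n w γ) = (α : k) • 1 ∧ f (g n w γ) = gAct γ (n - 1) β := by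
  have hn : n - 1 + 1 = n := Nat.sub_add_cancel NeZero.one_le
  have h' : (α : k) ^ w = (β : k) ^ n := by exact_mod_cast congrArg Units.val h
  refine ⟨lift ((α : k) • 1) (((α⁻¹ : kˣ) : k) • 1) (gAct γ (n - 1) β) (yAct n (n - 1) β)
    (by simp [smul_smul]) (by simp [smul_smul]) (by simp) (by simp)
    (yAct_mul_gAct n γ _ (hγ.out.ne_zero (NeZero.ne n)) β
      (Or.inl (by rw [hn, hγ.out.pow_eq_one])))
    (by rw [smul_pow, one_pow, h']; exact yAct_pow n _ β (Or.inl hn))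
    (by rw [smul_pow, one_pow, h', gAct_pow n γ _ hγ.out.pow_eq_one]), ?_, ?_⟩
  · exact lift_x (n := n) (w := w) (γ := γ) _ _ _ _ _ _ _ _ _ _ _
  · exact lift_g (n := n) (w := w) (γ := γ) _ _ _ _ _ _ _ _ _ _ _

theorem algHom_xg_apply_single {α β : kˣ}
    {f : LiuAlgebra n w γ →ₐ[k] Module.End k (Fin (n - 1 + 1) → k)}
    (hx : f (x n w γ) = (α : k) • 1) (hg : f (g n w γ) = gAct γ (n - 1) β) (r i : ℤ)
    (j : Fin (n - 1 + 1)) :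
    f (xg n w γ r i) (Pi.single j 1) =
      (((α ^ r : kˣ) : k) * ((β : k) * γ ^ (-((j : ℕ) : ℤ))) ^ i) • Pi.single j 1 := by
  have hγ0 : γ ≠ 0 := hγ.out.ne_zero (NeZero.ne n)
  have unit_zpow (u : (LiuAlgebra n w γ)ˣ) (c : k) (hc : c ≠ 0) (v : Fin (n - 1 + 1) → k)
      (hu : f u v = c • v) (r : ℤ) : f ((u ^ r : (LiuAlgebra n w γ)ˣ) : LiuAlgebra n w γ) v =
        c ^ r • v := by
    have hu' : f ((u⁻¹ : (LiuAlgebra n w γ)ˣ) : LiuAlgebra n w γ) v = c⁻¹ • v := by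
      have h1 : f ((u⁻¹ : (LiuAlgebra n w γ)ˣ) : LiuAlgebra n w γ) (f u v) = v := by
        rw [← Module.End.mul_apply, ← map_mul, Units.inv_mul, map_one, Module.End.one_apply]
      rw [hu, map_smul] at h1
      rw [← h1, smul_smul, inv_mul_cancel₀ hc, one_smul, h1]
    induction r with
    | zero => simp
    | succ r ih =>
      rw [zpow_add_one, Units.val_mul, map_mul, Module.End.mul_apply, hu, map_smul, ih, smul_smul,
        zpow_add_one₀ hc, mul_comm]
    | pred r ih =>
      rw [zpow_sub_one, Units.val_mul, map_mul, Module.End.mul_apply, hu', map_smul, ih, smul_smul,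
        zpow_sub_one₀ hc, mul_comm]
  rw [xg, Units.val_mul, map_mul, Module.End.mul_apply,
    unit_zpow (gUnit n w γ) ((β : k) * γ ^ (-((j : ℕ) : ℤ)))
      (mul_ne_zero β.ne_zero (zpow_ne_zero _ hγ0)) _ (by
        change f (g n w γ) _ = _
        rw [hg, gAct_single]),
    map_smul, unit_zpow (xUnit n w γ) α α.ne_zero _ (by
        change f (x n w γ) _ = _
        rw [hx]; rfl), smul_smul, Units.val_zpow_eq_zpow_val, mul_comm]

theorem exists_pow_eq_pow (α : kˣ) : ∃ β : kˣ, α ^ w = β ^ n := by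
  obtain ⟨b, hb⟩ := IsAlgClosed.exists_pow_nat_eq ((α : k) ^ w) (NeZero.pos n)
  have hb0 : b ≠ 0 := by
    rintro rfl
    rw [zero_pow (NeZero.ne n)] at hb
    exact pow_ne_zero w α.ne_zero hb.symm
  exact ⟨Units.mk0 b hb0, Units.ext (by simpa using hb.symm)⟩

/-- A representation in which `x` acts by `2` detects the exponent: in characteristic `0` the scalar
`2` has infinite order. -/
theorem xg_eq_one_imp {r : ℤ} (h : xg n w γ r 0 = 1) : r = 0 := by
  obtain ⟨β, hβ⟩ := exists_pow_eq_pow n w (Units.mk0 (2 : k) two_ne_zero)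
  obtain ⟨f, hx, hg⟩ := exists_algHom n w (γ := γ) _ β hβ
  have h1 := algHom_xg_apply_single n w hx hg r 0 0
  rw [h, map_one, Module.End.one_apply] at h1
  have h2 := congrFun h1 0
  simp only [Pi.single_eq_same, Pi.smul_apply, zpow_zero, mul_one, smul_eq_mul,
    Units.val_zpow_eq_zpow_val, Units.val_mk0] at h2
  have h3 : ((2 : ℚ) ^ r : ℚ) = 1 := by
    have : (((2 : ℚ) ^ r : ℚ) : k) = 1 := by push_cast; exact h2.symm
    exact_mod_cast this
  exact (zpow_eq_one_iff_right₀ (by norm_num) (by norm_num)).mp h3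

/-- In the representation with `α = β = 1`, the element `x^r g^i` acts on `v_1` by `γ^{-i}`, which
determines `i` modulo `n`. This makes `m` an invariant of the element `x^r g^i`. -/
theorem modEq_of_xg_eq {r i r' i' : ℤ} (h : xg n w γ r i = xg n w γ r' i') :
    i ≡ i' [ZMOD n] := by
  obtain ⟨f, hx, hg⟩ := exists_algHom n w (γ := γ) 1 1 (by simp)
  -- For `n = 1` there is no vector `v_1`, but then the congruence is empty.
  rcases Nat.lt_or_ge 1 n with hn | hn
  · have key (j : Fin (n - 1 + 1)) : γ ^ (-((j : ℕ) : ℤ) * i) = γ ^ (-((j : ℕ) : ℤ) * i') := by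
      have h1 := (algHom_xg_apply_single n w hx hg r i j).symm.trans
        ((congrArg (fun t => f t _) h).trans (algHom_xg_apply_single n w hx hg r' i' j))
      have h2 := congrFun h1 j
      rw [zpow_mul, zpow_mul]
      simpa using h2
    have h3 := key ⟨1, by omega⟩
    simp only [Nat.cast_one, neg_mul, one_mul] at h3
    have hγ0 : γ ≠ 0 := hγ.out.ne_zero (NeZero.ne n)
    have h4 : γ ^ (i' - i) = 1 := by
      rw [sub_eq_add_neg, zpow_add₀ hγ0, h3, ← zpow_add₀ hγ0, add_neg_cancel, zpow_zero]
    exact (Int.modEq_iff_dvd).mpr ((hγ.out.zpow_eq_one_iff_dvd _).mp h4)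
  · have : n = 1 := le_antisymm hn NeZero.one_le
    subst this
    exact Int.modEq_iff_dvd.mpr (by simp)

end faithful

end LiuAlgebra

/-- An invariant subspace containing a sum of eigenvectors with distinct eigenvalues contains
each of them. -/
theorem Module.End.mem_of_sum_eigenvectors_mem {k V ι : Type*} [Field k] [AddCommGroup V]
    [Module k V] (f : Module.End k V) (W : Submodule k V) (hW : ∀ v ∈ W, f v ∈ W)
    (s : Finset ι) (μ : ι → k) (hμ : Set.InjOn μ s) (v : ι → V)
    (hv : ∀ a ∈ s, f (v a) = μ a • v a) (hsum : ∑ a ∈ s, v a ∈ W) : ∀ a ∈ s, v a ∈ W := by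
  classical
  induction s using Finset.induction_on generalizing v with
  | empty => simp
  | insert b s hb ih =>
    rw [Finset.sum_insert hb] at hsum
    -- Applying `f - μ b` removes the `b`-term and rescales the others by nonzero factors.
    have h1 : ∑ a ∈ s, (μ a - μ b) • v a ∈ W := by
      have h2 := W.sub_mem (hW _ hsum) (W.smul_mem (μ b) hsum)
      rw [map_add, map_sum, hv b (Finset.mem_insert_self b s), smul_add, add_sub_add_left_eq_sub,
        Finset.smul_sum, ← Finset.sum_sub_distrib] at h2
      convert h2 using 1
      refine Finset.sum_congr rfl fun a ha => ?_
      rw [hv a (Finset.mem_insert_of_mem ha), sub_smul]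
    have h3 : ∀ a ∈ s, v a ∈ W := by
      intro a ha
      have h4 := ih (hμ.mono (by simp)) (fun a => (μ a - μ b) • v a)
        (fun a ha => by rw [map_smul, hv a (Finset.mem_insert_of_mem ha), smul_comm]) h1 a ha
      refine (W.smul_mem_iff (sub_ne_zero.mpr fun h => ?_)).mp h4
      have := hμ (Finset.mem_coe.mpr (Finset.mem_insert_of_mem ha))
        (Finset.mem_coe.mpr (Finset.mem_insert_self b s)) h
      exact hb (this ▸ ha)
    intro a ha
    rcases Finset.mem_insert.mp ha with rfl | ha
    · exact (W.add_mem_iff_left (W.sum_mem h3)).mp hsum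
    · exact h3 a ha

/-! ### Linear independence and the basis `y^a x^r g^i` -/

namespace LiuAlgebra

variable {k : Type*} [Field k] (n w : ℕ) (γ : k) [NeZero n]

/-- The group-like elements `x^r g^i`, as a subset of `B(n, w, γ)`. -/
def xgSet : Set (LiuAlgebra n w γ) := Set.range fun p : ℤ × ℤ => xg n w γ p.1 p.2

/-- The element `x^r g^i` of `xgSet`. -/
noncomputable def xgElem (r i : ℤ) : xgSet n w γ := ⟨xg n w γ r i, (r, i), rfl⟩

theorem xgElem_surjective (h : xgSet n w γ) : ∃ r i : ℤ, h = xgElem n w γ r i := by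
  obtain ⟨_, ⟨r, i⟩, rfl⟩ := h
  exact ⟨r, i, rfl⟩

/-- The family `y^a x^r g^i` with `0 ≤ a < n`. -/
noncomputable def pbwFamily (p : Fin n × xgSet n w γ) : LiuAlgebra n w γ :=
  y n w γ ^ (p.1 : ℕ) * (p.2 : LiuAlgebra n w γ)

/-- Multiplication by `x^w` on the group-like elements `x^r g^i`. -/
noncomputable def xgShift : xgSet n w γ ≃ xgSet n w γ where
  toFun h := ⟨xg n w γ w 0 * h, by
    obtain ⟨r, i, rfl⟩ := xgElem_surjective n w γ h
    exact ⟨(w + r, 0 + i), (xg_mul ..).symm⟩⟩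
  invFun h := ⟨xg n w γ (-w) 0 * h, by
    obtain ⟨r, i, rfl⟩ := xgElem_surjective n w γ h
    exact ⟨(-w + r, 0 + i), (xg_mul ..).symm⟩⟩
  left_inv h := Subtype.ext <| by simp [← mul_assoc, xg_mul, xg_zero]
  right_inv h := Subtype.ext <| by simp [← mul_assoc, xg_mul, xg_zero]

theorem xgShift_iterate (N : ℕ) (h : xgSet n w γ) :
    (((xgShift n w γ)^[N] h : xgSet n w γ) : LiuAlgebra n w γ) = xg n w γ (N * w) 0 * h := by
  induction N with
  | zero => simp [xg_zero]
  | succ N ih =>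
    rw [Function.iterate_succ_apply']
    change xg n w γ w 0 * _ = _
    rw [ih, ← mul_assoc, xg_mul]
    congr 2
    push_cast
    ring

variable {γ} [NeZero w] [hγ : Fact (IsPrimitiveRoot γ n)] [IsAlgClosed k] [CharZero k]

/-- Group elements cancel, and `x^w` has infinite order since `w ≠ 0`. So multiplication by `x^w`
has only infinite orbits. -/
theorem xgShift_iterate_injective (h : xgSet n w γ) :
    Function.Injective fun N : ℕ => (xgShift n w γ)^[N] h := by
  intro N N' hN
  have h1 := congrArg Subtype.val hN
  simp only [xgShift_iterate] at h1
  obtain ⟨r, i, rfl⟩ := xgElem_surjective n w γ h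
  have h2 := (isUnit_xg n w γ r i).mul_right_cancel h1
  have h3 : xg n w γ ((N : ℤ) * w - N' * w) 0 = 1 := by
    have := congrArg (· * xg n w γ (-(N' * w)) 0) h2
    simpa [xg_mul, xg_zero, sub_eq_add_neg] using this
  have h4 := xg_eq_one_imp n w h3
  have h5 : (N : ℤ) = N' := by
    rw [← sub_mul] at h4
    rcases mul_eq_zero.mp h4 with h4 | h4
    · exact sub_eq_zero.mp h4
    · exact absurd h4 (by exact_mod_cast NeZero.ne w)
  exact_mod_cast h5

theorem linearIndependent_xgSet :
    LinearIndependent k (Subtype.val : xgSet n w γ → LiuAlgebra n w γ) := by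
  have h : LinearIndepOn k id (xgSet n w γ) := by
    refine linearIndepOn_isGroupLikeElem.mono ?_
    rintro _ ⟨⟨r, i⟩, rfl⟩
    exact isGroupLikeElem_xg n w γ r i
  exact h

/-- `1 - x^w` is not a zero divisor on the span of the `x^r g^i`. -/
theorem eq_zero_of_xg_mul_eq (c : xgSet n w γ →₀ k)
    (h : xg n w γ w 0 * Finsupp.linearCombination k Subtype.val c =
      Finsupp.linearCombination k (Subtype.val : xgSet n w γ → LiuAlgebra n w γ) c) : c = 0 := by
  have h1 : c.mapDomain (xgShift n w γ) = c := by
    refine linearIndependent_xgSet n w ?_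
    rw [Finsupp.linearCombination_mapDomain, ← h, Finsupp.linearCombination_apply,
      Finsupp.linearCombination_apply, Finsupp.sum, Finsupp.sum, Finset.mul_sum]
    refine Finset.sum_congr rfl fun p _ => ?_
    rw [mul_smul_comm]
    rfl
  have h2 (p : xgSet n w γ) : c (xgShift n w γ p) = c p := by
    conv_lhs => rw [← h1]
    exact Finsupp.mapDomain_apply (xgShift n w γ).injective c p
  by_contra hc
  obtain ⟨p, hp⟩ := Finsupp.ne_iff.mp hc
  have h3 (N : ℕ) : c ((xgShift n w γ)^[N] p) = c p := by
    induction N with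
    | zero => rfl
    | succ N ih => rw [Function.iterate_succ_apply', h2, ih]
  -- A shift-invariant coefficient function is constant on an infinite orbit, which contradicts
  -- finite support.
  refine Set.infinite_of_injective_forall_mem (xgShift_iterate_injective n w p)
    (s := (c.support : Set _)) (fun N => ?_) c.support.finite_toSet
  simpa [h3 N] using hp

/-- Write a relation as `∑ y^a u_a = 0` with `u_a` in the span of the group elements. The terms are
eigenvectors of conjugation by `g` with eigenvalues `γ^{-a}`, distinct for `a < n`, so each
vanishes. Multiplying by `y^{n-a}` gives `(1 - x^w) u_a = 0`, hence `u_a = 0`. -/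
theorem linearIndependent_pbwFamily : LinearIndependent k (pbwFamily n w γ) := by
  have hγ0 : γ ≠ 0 := hγ.out.ne_zero (NeZero.ne n)
  rw [linearIndependent_iff]
  intro l hl
  let u (a : Fin n) : LiuAlgebra n w γ := Finsupp.linearCombination k Subtype.val (l.curry a)
  have h1 : ∑ a : Fin n, y n w γ ^ (a : ℕ) * u a = 0 := by
    rw [← hl, Finsupp.linearCombination_apply,
      ← Finsupp.sum_curry_index l (fun a h c => c • pbwFamily n w γ (a, h)),
      Finsupp.sum_fintype _ _ (by simp)]
    refine Finset.sum_congr rfl fun a _ => ?_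
    simp only [u, Finsupp.linearCombination_apply, Finsupp.sum, Finset.mul_sum, mul_smul_comm]
    rfl
  let f : Module.End k (LiuAlgebra n w γ) :=
    LinearMap.mulLeft k (g n w γ) ∘ₗ LinearMap.mulRight k (ginv n w γ)
  have hf (a : Fin n) : f (y n w γ ^ (a : ℕ) * u a) =
      γ ^ (-((a : ℕ) : ℤ)) • (y n w γ ^ (a : ℕ) * u a) := by
    simp only [u, Finsupp.linearCombination_apply, Finsupp.sum, Finset.mul_sum, Finset.smul_sum,
      map_sum]
    refine Finset.sum_congr rfl fun h _ => ?_
    obtain ⟨r, i, rfl⟩ := xgElem_surjective n w γ h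
    rw [mul_smul_comm, map_smul, smul_comm]
    congr 1
    change g n w γ * (y n w γ ^ (a : ℕ) * xg n w γ r i * ginv n w γ) = _
    rw [← mul_assoc, g_mul_y_pow_mul_xg_mul_ginv n w hγ0]
    rfl
  have h2 (a : Fin n) : y n w γ ^ (a : ℕ) * u a = 0 := by
    have := Module.End.mem_of_sum_eigenvectors_mem f ⊥ (by simp) Finset.univ
      (fun a : Fin n => γ ^ (-((a : ℕ) : ℤ))) (fun a _ b _ hab => ?_) _ (fun a _ => hf a)
      (by simpa using h1) a (Finset.mem_univ a)
    · simpa using this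
    · have h3 : γ ^ (a : ℕ) = γ ^ (b : ℕ) := by
        simpa [zpow_neg] using hab
      exact Fin.ext (hγ.out.pow_inj a.2 b.2 h3)
  have h3 (a : Fin n) : l.curry a = 0 := by
    refine eq_zero_of_xg_mul_eq n w _ ?_
    have h4 : y n w γ ^ n * u a = 0 := by
      have : y n w γ ^ n = y n w γ ^ (n - a) * y n w γ ^ (a : ℕ) := by
        rw [← pow_add, Nat.sub_add_cancel a.2.le]
      rw [this, mul_assoc, h2, mul_zero]
    rw [y_pow_n, sub_mul, one_mul, sub_eq_zero] at h4
    exact h4.symm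
  refine Finsupp.ext fun p => ?_
  have := DFunLike.congr_fun (h3 p.1) p.2
  simpa [Finsupp.curry_apply] using this

/-- The basis `y^a x^r g^i`, `0 ≤ a < n`, of `B(n, w, γ)`. -/
noncomputable def pbwBasis : Module.Basis (Fin n × xgSet n w γ) k (LiuAlgebra n w γ) :=
  .mk (linearIndependent_pbwFamily n w) (by
    rw [← span_y_pow_mul_xg n w (hγ.out.ne_zero (NeZero.ne n)), Submodule.span_le]
    rintro _ ⟨a, ha, r, i, rfl⟩
    exact Submodule.subset_span ⟨(⟨a, ha⟩, xgElem n w γ r i), rfl⟩)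

theorem pbwBasis_apply (a : ℕ) (ha : a < n) (r i : ℤ) :
    pbwBasis n w (⟨a, ha⟩, xgElem n w γ r i) = y n w γ ^ a * xg n w γ r i := by
  rw [pbwBasis, Module.Basis.mk_apply]
  rfl

theorem y_pow_mul_xg_ne_zero (a : ℕ) (ha : a < n) (r i : ℤ) :
    y n w γ ^ a * xg n w γ r i ≠ 0 := by
  rw [← pbwBasis_apply n w a ha]
  exact (pbwBasis n w).ne_zero _

open Classical in
/-- If `b ≤ a < n`, the coefficient of `y^a h` in the first leg of `Δ(y^b h')` is `g^a h`
when `y^b h' = y^a h`, and `0` otherwise. -/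
theorem coord_rTensor_comul (a b : Fin n) (hba : b ≤ a) (h h' : xgSet n w γ) :
    TensorProduct.lid k _ (((pbwBasis n w).coord (a, h)).rTensor _
      (Coalgebra.comul (R := k) (pbwBasis n w (b, h')))) =
    if (b, h') = (a, h) then g n w γ ^ (a : ℕ) * (h : LiuAlgebra n w γ) else 0 := by
  obtain ⟨r, i, rfl⟩ := xgElem_surjective n w γ h'
  have h0 := pbwBasis_apply n w (γ := γ) b b.2 r i
  rw [show ((b, xgElem n w γ r i) : Fin n × xgSet n w γ) = (⟨(b : ℕ), b.2⟩, xgElem n w γ r i)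
    from rfl, h0, comul_y_pow_mul_xg]
  simp only [map_sum, map_smul, LinearMap.rTensor_tmul, TensorProduct.lid_tmul]
  have key : ∀ p ∈ Finset.HasAntidiagonal.antidiagonal (b : ℕ),
      (pbwBasis n w).coord (a, h) (y n w γ ^ p.1 * xg n w γ r i) =
        if p = ((a : ℕ), 0) ∧ xgElem n w γ r i = h then 1 else 0 := by
    intro p hp
    rw [Finset.HasAntidiagonal.mem_antidiagonal] at hp
    have hp1 : p.1 < n := by have := b.2; omega
    rw [← pbwBasis_apply n w _ hp1, Module.Basis.coord_apply, Module.Basis.repr_self,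
      Finsupp.single_apply]
    congr 1
    have : b.1 ≤ a.1 := hba
    simp only [Prod.ext_iff, Fin.ext_iff, eq_iff_iff]
    -- Since the two exponents add up to `b ≤ a`, a first exponent equal to `a` leaves `0` for the
    -- second.
    refine and_congr_left fun _ => ⟨fun h => ⟨h, by omega⟩, fun h => h.1⟩
  rw [Finset.sum_congr rfl fun p hp => by rw [key p hp]]
  by_cases hb : (b, xgElem n w γ r i) = (a, h)
  · obtain ⟨rfl, rfl⟩ := Prod.ext_iff.mp hb
    rw [if_pos hb, Finset.sum_eq_single ((b : ℕ), 0)]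
    · simp [qBinomAux_zero_right, xgElem]
    · intro p _ hp
      simp [hp]
    · simp
  · rw [if_neg hb]
    refine Finset.sum_eq_zero fun p hp => ?_
    rw [if_neg, zero_smul, smul_zero]
    rintro ⟨rfl, rfl⟩
    rw [Finset.HasAntidiagonal.mem_antidiagonal] at hp
    exact hb (Prod.ext (Fin.ext hp.symm) rfl)

end LiuAlgebra

/-- The second `q`-Pascal rule. The closed form of `c(k, l)` needs both rules: one for the terms
carrying an extra factor `β`, one for the terms without it. -/
theorem qBinomAux_succ_succ_left {k : Type*} [Field k] (q : k) (i j : ℕ) :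
    qBinomAux q (i + 1) (j + 1) = q ^ (j + 1) * qBinomAux q i (j + 1) + qBinomAux q (i + 1) j := by
  have h := qBinomAux_identity q i j
  rw [qBinomAux_succ_succ]
  linear_combination h

/-! ### Closed form of the coaction coefficients -/

namespace LiuAlgebra

variable {k : Type*} [Field k] (n w : ℕ) (γ : k) [NeZero n] [hγ : Fact (IsPrimitiveRoot γ n)]

theorem coactionCoeff_of_lt (β : kˣ) (r i : ℤ) {a l : ℕ} (h : a < l) :
    coactionCoeff n w γ β r i a l = 0 := by
  cases a with
  | zero =>
    cases l with
    | zero => omega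
    | succ l => rw [coactionCoeff]
  | succ a =>
    cases l with
    | zero => omega
    | succ l => rw [coactionCoeff, if_neg (by omega), if_neg (by omega)]

theorem coactionCoeff_succ_zero (β : kˣ) (r i : ℤ) (a : ℕ) :
    coactionCoeff n w γ β r i (a + 1) 0 =
      coactionCoeff n w γ β r i a 0 * HopfAlgebra.antipode k (y n w γ) +
        (β : k) • (y n w γ * coactionCoeff n w γ β r i a 0 * ginv n w γ) := by
  rw [coactionCoeff, antipode_g]

/-- With the convention `c(a, l) = 0` for `l > a`, one recursion covers all the cases with positive
second index. -/
theorem coactionCoeff_succ_succ (β : kˣ) (r i : ℤ) (a l : ℕ) :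
    coactionCoeff n w γ β r i (a + 1) (l + 1) =
      coactionCoeff n w γ β r i a (l + 1) * HopfAlgebra.antipode k (y n w γ) +
        ((β : k) * γ ^ (-((l + 1 : ℕ) : ℤ))) •
          (y n w γ * coactionCoeff n w γ β r i a (l + 1) * ginv n w γ) +
        coactionCoeff n w γ β r i a l * ginv n w γ := by
  rw [coactionCoeff]
  split_ifs with h1 h2
  · rw [antipode_g]
  · obtain rfl : l = a := by omega
    rw [coactionCoeff_of_lt n w γ β r i (Nat.lt_succ_self l), antipode_g]
    simp
  · rw [coactionCoeff_of_lt n w γ β r i (show a < l + 1 by omega),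
      coactionCoeff_of_lt n w γ β r i (show a < l by omega)]
    simp

theorem coactionCoeff_self (β : kˣ) (r i : ℤ) (a : ℕ) :
    coactionCoeff n w γ β r i a a = xg n w γ r (i - a) := by
  induction a with
  | zero => simp [coactionCoeff]
  | succ a ih =>
    rw [coactionCoeff, if_neg (lt_irrefl _), if_pos rfl, ih, antipode_g, ginv_eq_xg, xg_mul]
    congr 1
    · ring
    · push_cast; ring

/-- The scalar in `c(d + l, l) = scalar • y^d x^r g^{i-d-l}`. -/
noncomputable def coeffScalar (β : kˣ) (i : ℤ) (d l : ℕ) : k :=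
  qBinomAux γ⁻¹ d l * ∏ s ∈ Finset.range d, ((β : k) - γ ^ ((l : ℤ) + s - i))

variable {γ}

theorem y_pow_mul_xg_mul_antipode_y (d : ℕ) (r i : ℤ) :
    y n w γ ^ d * xg n w γ r i * HopfAlgebra.antipode k (y n w γ) =
      -γ ^ (-i) • (y n w γ ^ (d + 1) * xg n w γ r (i - 1)) := by
  rw [antipode_y, mul_neg, ← mul_assoc, mul_assoc (y n w γ ^ d),
    xg_mul_y n w (hγ.out.ne_zero (NeZero.ne n)), mul_smul_comm, smul_mul_assoc, mul_assoc,
    mul_assoc (y n w γ), ginv_eq_xg, xg_mul, ← mul_assoc, ← pow_succ, add_zero, neg_smul]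
  rfl

theorem y_mul_y_pow_mul_xg_mul_ginv (d : ℕ) (r i : ℤ) :
    y n w γ * (y n w γ ^ d * xg n w γ r i) * ginv n w γ =
      y n w γ ^ (d + 1) * xg n w γ r (i - 1) := by
  rw [← mul_assoc, ← pow_succ', mul_assoc, ginv_eq_xg, xg_mul, add_zero]
  rfl

theorem y_pow_mul_xg_mul_ginv (d : ℕ) (r i : ℤ) :
    (y n w γ ^ d * xg n w γ r i) * ginv n w γ = y n w γ ^ d * xg n w γ r (i - 1) := by
  rw [mul_assoc, ginv_eq_xg, xg_mul, add_zero]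
  rfl

/-- Moving group elements past `y` turns the recursion into one for scalars. After the common
product is removed, the coefficients of `β` and of `γ^{l-i}` give the two `q`-Pascal rules at `q =
γ⁻¹`. Every later vanishing or nonvanishing statement about `c` is read off from this formula. -/
theorem coactionCoeff_eq (β : kˣ) (r i : ℤ) (d l : ℕ) :
    coactionCoeff n w γ β r i (d + l) l =
      coeffScalar γ β i d l • (y n w γ ^ d * xg n w γ r (i - (d + l : ℕ))) := by
  have hγ0 : γ ≠ 0 := hγ.out.ne_zero (NeZero.ne n)
  -- The coefficient at `(d+1, l+1)` comes from those at `(d, l+1)` and `(d+1, l)`, so the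
  -- hypothesis on `l` must hold for all `d` and an inner induction on `d` is needed.
  induction l generalizing d with
  | zero =>
    induction d with
    | zero => simp [coeffScalar, qBinomAux_zero_right, coactionCoeff]
    | succ d ih =>
      simp only [Nat.add_zero] at ih ⊢
      rw [coactionCoeff_succ_zero, ih, smul_mul_assoc, y_pow_mul_xg_mul_antipode_y,
        mul_smul_comm, smul_mul_assoc, y_mul_y_pow_mul_xg_mul_ginv, smul_smul, smul_smul, ← add_smul]
      congr 1
      · simp only [coeffScalar, qBinomAux_zero_right, one_mul, Finset.prod_range_succ]
        have : -(i - (d : ℤ)) = ((0 : ℕ) : ℤ) + d - i := by push_cast; ring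
        rw [this]
        ring
      · congr 2
        push_cast
        ring
  | succ l ihl =>
    induction d with
    | zero => simp [coeffScalar, qBinomAux_zero_left, coactionCoeff_self]
    | succ d ihd =>
      have e : d + 1 + (l + 1) = d + (l + 1) + 1 := by omega
      have e' : d + (l + 1) = (d + 1) + l := by omega
      rw [e, coactionCoeff_succ_succ, ihd]
      rw [show coactionCoeff n w γ β r i (d + (l + 1)) l = coactionCoeff n w γ β r i (d + 1 + l) l
        from congrArg (fun t => coactionCoeff n w γ β r i t l) e', ihl, smul_mul_assoc,
        y_pow_mul_xg_mul_antipode_y, mul_smul_comm, smul_mul_assoc, y_mul_y_pow_mul_xg_mul_ginv,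
        smul_mul_assoc, y_pow_mul_xg_mul_ginv, smul_smul, smul_smul,
        show i - ((d + 1 + l : ℕ) : ℤ) - 1 = i - ((d + (l + 1) + 1 : ℕ) : ℤ) by push_cast; ring,
        show i - ((d + (l + 1) : ℕ) : ℤ) - 1 = i - ((d + (l + 1) + 1 : ℕ) : ℤ) by push_cast; ring,
        ← add_smul, ← add_smul]
      congr 1
      -- The product for `(d+1, l)` shares all but its first factor with the product for `(d, l+1)`.
      have hP : ∏ s ∈ Finset.range (d + 1), ((β : k) - γ ^ ((l : ℤ) + s - i)) =
          ((β : k) - γ ^ ((l : ℤ) - i)) *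
            ∏ s ∈ Finset.range d, ((β : k) - γ ^ (((l + 1 : ℕ) : ℤ) + s - i)) := by
        rw [Finset.prod_range_succ', mul_comm]
        congr 1
        · refine Finset.prod_congr rfl fun s _ => ?_
          congr 2
          push_cast
          ring
      simp only [coeffScalar, hP]
      rw [Finset.prod_range_succ]
      set P := ∏ s ∈ Finset.range d, ((β : k) - γ ^ (((l + 1 : ℕ) : ℤ) + s - i))
      have h1 := qBinomAux_succ_succ γ⁻¹ d l
      have h2 := qBinomAux_succ_succ_left γ⁻¹ d l
      have z1 : γ ^ (-(i - ((d + (l + 1) : ℕ) : ℤ))) = γ ^ (d + 1) * γ ^ ((l : ℤ) - i) := by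
        rw [← zpow_natCast, ← zpow_add₀ hγ0]
        congr 1
        push_cast
        ring
      have z2 : γ ^ (((l + 1 : ℕ) : ℤ) + d - i) = γ ^ (d + 1) * γ ^ ((l : ℤ) - i) := by
        rw [← zpow_natCast, ← zpow_add₀ hγ0]
        congr 1
        push_cast
        ring
      have z3 : γ ^ (-((l + 1 : ℕ) : ℤ)) = γ⁻¹ ^ (l + 1) := by
        rw [zpow_neg, zpow_natCast, inv_pow]
      have z4 : γ ^ (d + 1) * γ⁻¹ ^ (d + 1) = 1 := by
        rw [← mul_pow, mul_inv_cancel₀ hγ0, one_pow]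
      rw [z1, z2, z3]
      set G := γ ^ ((l : ℤ) - i)
      set Q := qBinomAux γ⁻¹ (d + 1) (l + 1)
      linear_combination (-(β : k) * P) * h2 + (P * γ ^ (d + 1) * G) * h1 +
        (P * G * qBinomAux γ⁻¹ (d + 1) l) * z4

/-- Over a full period the powers `γ^{s-i}` run once through all `n`-th roots of unity, whatever `i`
is. -/
theorem prod_range_sub_zpow (b : k) (i : ℤ) :
    ∏ s ∈ Finset.range n, (b - γ ^ ((s : ℤ) - i)) = b ^ n - 1 := by
  classical
  have hn := NeZero.pos n
  have hγ0 : γ ≠ 0 := hγ.out.ne_zero (NeZero.ne n)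
  have h := hγ.out.pow_sub_pow_eq_prod_sub_mul b 1 hn
  rw [one_pow] at h
  rw [h]
  refine Finset.prod_bij (fun s _ => γ ^ ((s : ℤ) - i)) ?_ ?_ ?_ ?_
  · intro s _
    rw [Polynomial.mem_nthRootsFinset hn, ← zpow_natCast, ← zpow_mul, mul_comm, zpow_mul,
      zpow_natCast, hγ.out.pow_eq_one, one_zpow]
  · intro s hs t ht hst
    rw [zpow_sub₀ hγ0, zpow_sub₀ hγ0, div_left_inj' (zpow_ne_zero _ hγ0), zpow_natCast,
      zpow_natCast] at hst
    exact hγ.out.pow_inj (Finset.mem_range.mp hs) (Finset.mem_range.mp ht) hst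
  · intro z hz
    rw [Polynomial.mem_nthRootsFinset hn] at hz
    have h1 : (z * γ ^ i) ^ n = 1 := by
      rw [mul_pow, hz, one_mul, ← zpow_natCast, ← zpow_mul, mul_comm, zpow_mul,
        zpow_natCast, hγ.out.pow_eq_one, one_zpow]
    obtain ⟨s, hs, h2⟩ := hγ.out.eq_pow_of_pow_eq_one h1
    refine ⟨s, Finset.mem_range.mpr hs, ?_⟩
    rw [zpow_sub₀ hγ0, zpow_natCast, h2, mul_div_cancel_right₀ _ (zpow_ne_zero _ hγ0)]
  · intro s _
    simp

/-! ### The top index `m` and the vanishing of coefficients -/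

section top

variable (γ)

theorem liuTop_lt (β : kˣ) (i : ℤ) : liuTop n γ β i < n := by
  rcases liuTop_cases n γ β i with h | h <;> omega

variable {γ}

/-- Two exponents `j` representing `β` differ by a multiple of `n`, which `φ` does not see; the
exponent chosen in the definition is therefore immaterial. -/
theorem liuTop_eq_of_eq_zpow (β : kˣ) (i j : ℤ) (h : (β : k) = γ ^ j) :
    liuTop n γ β i = n - liuPhi n (-i - j) := by
  have hγ0 : γ ≠ 0 := hγ.out.ne_zero (NeZero.ne n)
  have hex : ∃ j : ℤ, (β : k) = γ ^ j := ⟨j, h⟩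
  have h1 : (n : ℤ) ∣ hex.choose - j := by
    rw [← hγ.out.zpow_eq_one_iff_dvd, zpow_sub₀ hγ0, ← hex.choose_spec, ← h,
      div_self β.ne_zero]
  rw [liuTop, dif_pos hex]
  congr 1
  refine (liuPhi_unique n _ _).mpr ?_
  obtain ⟨h2, h3, h4⟩ := (liuPhi_unique n (-i - hex.choose) _).mp rfl
  refine ⟨h2, h3, Int.ModEq.trans ?_ h4⟩
  rw [Int.modEq_iff_dvd]
  have : -i - hex.choose - (-i - j) = -(hex.choose - j) := by ring
  rw [this]
  exact (dvd_neg).mpr h1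

theorem liuTop_eq_of_pow_ne_one (β : kˣ) (i : ℤ) (h : (β : k) ^ n ≠ 1) :
    liuTop n γ β i + 1 = n :=
  (liuTop_cases n γ β i).resolve_right fun h' => h h'.2

/-- If `βⁿ = 1` then the top index `m` is characterized by `β = γ^{m-i}`. -/
theorem eq_zpow_liuTop_sub (β : kˣ) (i : ℤ) (h : (β : k) ^ n = 1) :
    (β : k) = γ ^ ((liuTop n γ β i : ℤ) - i) := by
  have hγ0 : γ ≠ 0 := hγ.out.ne_zero (NeZero.ne n)
  obtain ⟨j, _, hj⟩ := hγ.out.eq_pow_of_pow_eq_one h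
  have hj' : (β : k) = γ ^ (j : ℤ) := by rw [zpow_natCast, hj]
  rw [liuTop_eq_of_eq_zpow n β i j hj']
  obtain ⟨h2, h3, h4⟩ := (liuPhi_unique n (-i - j) _).mp rfl
  rw [Nat.cast_sub h3, hj']
  have h5 := Int.modEq_iff_dvd.mp h4
  have h6 : γ ^ ((n : ℤ) - liuPhi n (-i - j) - i - j) = 1 := by
    rw [hγ.out.zpow_eq_one_iff_dvd]
    have : (n : ℤ) - liuPhi n (-i - j) - i - j = n - (liuPhi n (-i - j) - (-i - j)) := by ring
    rw [this]
    exact dvd_sub_self_left.mpr h5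
  rw [zpow_sub₀ hγ0, div_eq_one_iff_eq (zpow_ne_zero _ hγ0)] at h6
  exact h6.symm

/-- A zero factor would give `β = γ^{s-i}` with `s < d ≤ m`, whereas `β = γ^{m-i}` and the powers
`γ^s`, `s < n`, are distinct. -/
theorem coeffScalar_ne_zero (β : kˣ) (i : ℤ) (d : ℕ) (hd : d ≤ liuTop n γ β i) :
    coeffScalar γ β i d 0 ≠ 0 := by
  have hγ0 : γ ≠ 0 := hγ.out.ne_zero (NeZero.ne n)
  have hlt := liuTop_lt n γ β i
  rw [coeffScalar, qBinomAux_zero_right, one_mul, Finset.prod_ne_zero_iff]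
  intro s hs h
  rw [Finset.mem_range] at hs
  rw [sub_eq_zero] at h
  have h1 : (β : k) ^ n = 1 := by
    rw [h, ← zpow_natCast, ← zpow_mul, mul_comm, zpow_mul, zpow_natCast, hγ.out.pow_eq_one,
      one_zpow]
  have h2 := (eq_zpow_liuTop_sub n (γ := γ) β i h1).symm.trans h
  rw [Nat.cast_zero, zero_add, zpow_sub₀ hγ0, zpow_sub₀ hγ0,
    div_left_inj' (zpow_ne_zero _ hγ0), zpow_natCast, zpow_natCast] at h2
  have := hγ.out.pow_inj hlt (by omega) h2
  omega

/-- If `βⁿ = 1`, the coefficients `c(a, l)` with `l ≤ m < a` vanish. -/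
theorem coactionCoeff_eq_zero_of_liuTop (β : kˣ) (r i : ℤ) (h : (β : k) ^ n = 1) {a l : ℕ}
    (hl : l ≤ liuTop n γ β i) (ha : liuTop n γ β i < a) :
    coactionCoeff n w γ β r i a l = 0 := by
  obtain ⟨d, rfl⟩ := Nat.exists_eq_add_of_le' (hl.trans ha.le)
  rw [coactionCoeff_eq, coeffScalar, Finset.prod_eq_zero (i := liuTop n γ β i - l), mul_zero,
    zero_smul]
  · rw [Finset.mem_range]; omega
  · rw [Nat.cast_sub hl, sub_eq_zero]
    conv_lhs => rw [eq_zpow_liuTop_sub n (γ := γ) β i h]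
    congr 1
    ring

/-- The coefficients `c(m + 1, l)` vanish for `0 < l ≤ m`. -/
theorem coactionCoeff_liuTop_succ (β : kˣ) (r i : ℤ) {l : ℕ} (hl0 : 0 < l)
    (hl : l ≤ liuTop n γ β i) :
    coactionCoeff n w γ β r i (liuTop n γ β i + 1) l = 0 := by
  -- There are two different reasons. If `βⁿ = 1` the product has a zero factor; otherwise `m + 1 =
  -- n`, and the inner Gaussian binomials `[n choose l]` vanish at the primitive root `γ⁻¹`.
  by_cases h : (β : k) ^ n = 1
  · exact coactionCoeff_eq_zero_of_liuTop n w β r i h hl (Nat.lt_succ_self _)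
  · have hn := liuTop_eq_of_pow_ne_one n (γ := γ) β i h
    obtain ⟨d, hd⟩ := Nat.exists_eq_add_of_le' (hl.trans (Nat.le_succ _))
    obtain ⟨l, rfl⟩ := Nat.exists_eq_succ_of_ne_zero hl0.ne'
    rw [show coactionCoeff n w γ β r i (liuTop n γ β i + 1) (l + 1) =
      coactionCoeff n w γ β r i (d + (l + 1)) (l + 1) from
        congrArg (fun t => coactionCoeff n w γ β r i t (l + 1)) hd, coactionCoeff_eq,
      coeffScalar, qBinomAux_eq_zero hγ.out.inv l d (by omega) (by omega), zero_mul, zero_smul]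

/-- When `βⁿ ≠ 1` this is the closed form at `d = n`: the product is `βⁿ - 1`, and `yⁿ = 1 - x^w`
with `x^w = gⁿ` turns the monomial into a difference of two group elements. The second one cancels
against `c(m+1, m+1) ⊗ y · v_m`. -/
theorem coactionCoeff_liuTop_succ_zero (β : kˣ) (r i : ℤ) :
    coactionCoeff n w γ β r i (liuTop n γ β i + 1) 0 =
      (1 - (β : k) ^ n) • (xg n w γ r i - xg n w γ r (i - (liuTop n γ β i + 1 : ℕ))) := by
  by_cases h : (β : k) ^ n = 1
  · rw [coactionCoeff_eq_zero_of_liuTop n w β r i h (Nat.zero_le _) (Nat.lt_succ_self _), h,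
      sub_self, zero_smul]
  · have hn := liuTop_eq_of_pow_ne_one n (γ := γ) β i h
    have h1 := coactionCoeff_eq n w (γ := γ) β r i n 0
    have h2 : coeffScalar γ β i n 0 = (β : k) ^ n - 1 := by
      rw [coeffScalar, qBinomAux_zero_right, one_mul, ← prod_range_sub_zpow (γ := γ) n (β : k) i]
      simp
    rw [h2, y_pow_n, sub_mul, one_mul, xg_w_zero, xg_mul] at h1
    rw [show coactionCoeff n w γ β r i (liuTop n γ β i + 1) 0 =
      coactionCoeff n w γ β r i (n + 0) 0 from
        congrArg (fun t => coactionCoeff n w γ β r i t 0) hn, h1, hn,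
      zero_add, show (n : ℤ) + (i - ((n + 0 : ℕ) : ℤ)) = i by push_cast; ring, Nat.add_zero,
      ← neg_sub (xg n w γ r i), ← neg_sub (1 : k), smul_neg, neg_smul, neg_neg]

end top

section nonvanishing

variable [NeZero w] [IsAlgClosed k] [CharZero k]

theorem coactionCoeff_zero_ne_zero (β : kˣ) (r i : ℤ) (a : ℕ) (ha : a ≤ liuTop n γ β i) :
    coactionCoeff n w γ β r i a 0 ≠ 0 := by
  rw [← Nat.add_zero a, coactionCoeff_eq]
  exact smul_ne_zero (coeffScalar_ne_zero n β i a ha)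
    (y_pow_mul_xg_ne_zero n w a (ha.trans_lt (liuTop_lt n γ β i)) _ _)

end nonvanishing

/-- The coefficient is a multiple of `y^{a-l}` times a group element. The resulting eigenvalues
separate the terms of `δ(v_a)`. -/
theorem g_mul_coactionCoeff_mul_ginv (β : kˣ) (r i : ℤ) {a l : ℕ} (h : l ≤ a) :
    g n w γ * coactionCoeff n w γ β r i a l * ginv n w γ =
      γ ^ ((l : ℤ) - a) • coactionCoeff n w γ β r i a l := by
  obtain ⟨d, rfl⟩ := Nat.exists_eq_add_of_le' h
  rw [coactionCoeff_eq, mul_smul_comm, smul_mul_assoc,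
    g_mul_y_pow_mul_xg_mul_ginv n w (hγ.out.ne_zero (NeZero.ne n)), smul_comm]
  congr 2
  push_cast
  ring

/-- `c_β^{r,i}` depends on `r`, `i` only through `x^r g^i`. -/
theorem coactionCoeff_congr (β : kˣ) {r i r' i' : ℤ} (h : xg n w γ r i = xg n w γ r' i') :
    coactionCoeff n w γ β r i = coactionCoeff n w γ β r' i' := by
  funext a
  induction a with
  | zero =>
    funext l
    cases l with
    | zero => simpa [coactionCoeff] using h
    | succ l => simp [coactionCoeff]
  | succ a ih =>
    funext l
    cases l with
    | zero => rw [coactionCoeff_succ_zero, coactionCoeff_succ_zero, ih]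
    | succ l => rw [coactionCoeff_succ_succ, coactionCoeff_succ_succ, ih]

end LiuAlgebra

/-! ### The twisted action on `H ⊗ V`, morphisms and Schur's lemma -/

namespace ActionCoaction

universe u v v' x

variable {k : Type u} {H : Type x} {V : Type v} {W : Type v'} [Field k] [Ring H] [HopfAlgebra k H]
  [AddCommGroup V] [Module k V] [AddCommGroup W] [Module k W]

/-- The operator `u ⊗ v ↦ h₍₁₎ u S(h₍₃₎) ⊗ h₍₂₎ · v`. -/
noncomputable def twist (act : H →ₐ[k] Module.End k V) : H →ₗ[k] Module.End k (H ⊗[k] V) :=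
  ydTwist k act ∘ₗ LinearMap.lTensor H (Coalgebra.comul : H →ₗ[k] H ⊗[k] H) ∘ₗ Coalgebra.comul

theorem twist_def (act : H →ₐ[k] Module.End k V) (h : H) :
    twist act h = ydTwist k act
      (LinearMap.lTensor H (Coalgebra.comul : H →ₗ[k] H ⊗[k] H) (Coalgebra.comul h)) := rfl

/-- The antipode reverses products, so the right multiplications compose in the correct order.
Consequently the Yetter–Drinfeld condition need only be tested on algebra generators. -/
theorem ydTwist_mul (act : H →ₐ[k] Module.End k V) (s t : H ⊗[k] (H ⊗[k] H)) :
    ydTwist k act (s * t) = ydTwist k act s ∘ₗ ydTwist k act t := by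
  induction s with
  | zero => simp
  | add s s' hs hs' => rw [add_mul, map_add, hs, hs', map_add, LinearMap.add_comp]
  | tmul a s =>
    induction s with
    | zero => simp
    | add s s' hs hs' =>
      rw [TensorProduct.tmul_add, add_mul, map_add, hs, hs', map_add, LinearMap.add_comp]
    | tmul b c =>
      induction t with
      | zero => simp
      | add t t' ht ht' => rw [mul_add, map_add, ht, ht', map_add, LinearMap.comp_add]
      | tmul a' t =>
        induction t with
        | zero => simp
        | add t t' ht ht' =>
          rw [TensorProduct.tmul_add, mul_add, map_add, ht, ht', map_add, LinearMap.comp_add]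
        | tmul b' c' =>
          refine TensorProduct.ext' fun u v => ?_
          rw [Algebra.TensorProduct.tmul_mul_tmul, Algebra.TensorProduct.tmul_mul_tmul,
            LinearMap.comp_apply, ydTwist_tmul, ydTwist_tmul, ydTwist_tmul,
            HopfAlgebra.antipode_mul_antidistrib, map_mul, Module.End.mul_apply]
          simp only [mul_assoc]

theorem lTensor_comul_mul (s t : H ⊗[k] H) :
    LinearMap.lTensor H (Coalgebra.comul : H →ₗ[k] H ⊗[k] H) (s * t) =
      LinearMap.lTensor H (Coalgebra.comul : H →ₗ[k] H ⊗[k] H) s *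
        LinearMap.lTensor H (Coalgebra.comul : H →ₗ[k] H ⊗[k] H) t := by
  induction s with
  | zero => simp
  | add s s' hs hs' => rw [add_mul, map_add, hs, hs', map_add, add_mul]
  | tmul a b =>
    induction t with
    | zero => simp
    | add t t' ht ht' => rw [mul_add, map_add, ht, ht', map_add, mul_add]
    | tmul c d => simp

theorem twist_mul (act : H →ₐ[k] Module.End k V) (a b : H) :
    twist act (a * b) = twist act a ∘ₗ twist act b := by
  rw [twist_def, Bialgebra.comul_mul, lTensor_comul_mul, ydTwist_mul, twist_def, twist_def]

theorem twist_algebraMap (act : H →ₐ[k] Module.End k V) (c : k) :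
    twist act (algebraMap k H c) = c • LinearMap.id := by
  rw [Algebra.algebraMap_eq_smul_one, map_smul]
  congr 1
  refine TensorProduct.ext' fun u v => ?_
  simp [twist_def, Algebra.TensorProduct.one_def, ydTwist_tmul]

/-- A linear map which preserves action and coaction. -/
structure IsMorphism (M : ActionCoaction k H V) (N : ActionCoaction k H W) (f : V →ₗ[k] W) :
    Prop where
  map_act : ∀ (h : H) (v : V), f (M.act h v) = N.act h (f v)
  map_coact : ∀ v : V, N.coact (f v) = LinearMap.lTensor H f (M.coact v)

variable {M : ActionCoaction k H V} {N : ActionCoaction k H W} {f : V →ₗ[k] W}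

/-- For the coaction, `H` is flat over `k`, so the kernel of `id ⊗ f` is `H ⊗ ker f`. -/
theorem IsMorphism.isSubobject_ker (hf : IsMorphism M N f) : M.IsSubobject (LinearMap.ker f) := by
  refine ⟨fun h v hv => ?_, fun v hv => ?_⟩
  · rw [LinearMap.mem_ker] at hv ⊢
    rw [hf.map_act, hv, map_zero]
  · change M.coact v ∈ LinearMap.range
      (TensorProduct.AlgebraTensorModule.lTensor k H (LinearMap.ker f).subtype)
    rw [← Module.Flat.ker_lTensor_eq, LinearMap.mem_ker]
    change LinearMap.lTensor H f (M.coact v) = 0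
    rw [← hf.map_coact, LinearMap.mem_ker.mp hv,
      map_zero]

theorem IsMorphism.isSubobject_range (hf : IsMorphism M N f) :
    N.IsSubobject (LinearMap.range f) := by
  refine ⟨?_, ?_⟩
  · rintro h _ ⟨v, rfl⟩
    exact ⟨_, hf.map_act h v⟩
  · rintro _ ⟨v, rfl⟩
    rw [hf.map_coact]
    refine ⟨LinearMap.lTensor H f.rangeRestrict (M.coact v), ?_⟩
    rw [← LinearMap.comp_apply, ← LinearMap.lTensor_comp]
    rfl

theorem IsMorphism.injective_of_simple (hf : IsMorphism M N f) (hM : M.IsSimpleYetterDrinfeld)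
    (h0 : f ≠ 0) : Function.Injective f := by
  rcases hM.eq_bot_or_eq_top _ hf.isSubobject_ker with h | h
  · exact LinearMap.ker_eq_bot.mp h
  · exact absurd (LinearMap.ker_eq_top.mp h) h0

theorem IsMorphism.surjective_of_simple (hf : IsMorphism M N f) (hN : N.IsSimpleYetterDrinfeld)
    (h0 : f ≠ 0) : Function.Surjective f := by
  rcases hN.eq_bot_or_eq_top _ hf.isSubobject_range with h | h
  · exact absurd (LinearMap.range_eq_bot.mp h) h0
  · exact LinearMap.range_eq_top.mp h

theorem IsMorphism.isomorphic (hf : IsMorphism M N f) (hM : M.IsSimpleYetterDrinfeld)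
    (hN : N.IsSimpleYetterDrinfeld) (h0 : f ≠ 0) : M.Isomorphic N :=
  ⟨LinearEquiv.ofBijective f ⟨hf.injective_of_simple hM h0, hf.surjective_of_simple hN h0⟩,
    hf.map_act, hf.map_coact⟩

theorem Isomorphic.symm (h : M.Isomorphic N) : N.Isomorphic M := by
  obtain ⟨e, h1, h2⟩ := h
  refine ⟨e.symm, fun h v => ?_, fun v => ?_⟩
  · rw [e.symm_apply_eq, h1, e.apply_symm_apply]
  · have h3 := h2 (e.symm v)
    rw [e.apply_symm_apply] at h3
    rw [h3, ← LinearMap.comp_apply, ← LinearMap.lTensor_comp]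
    simp

/-- If `δ(v) = h ⊗ v` then `H · v` is a Yetter–Drinfeld submodule. -/
theorem isSubobject_orbit (hM : M.IsYetterDrinfeld) {v : V} {h : H} (hv : M.coact v = h ⊗ₜ v) :
    M.IsSubobject (LinearMap.range (M.act.toLinearMap.flip v)) := by
  refine ⟨?_, ?_⟩
  · rintro a _ ⟨b, rfl⟩
    exact ⟨a * b, by simp⟩
  · rintro _ ⟨a, rfl⟩
    change M.coact (M.act a v) ∈ _
    rw [hM.compat, hv]
    generalize LinearMap.lTensor H (Coalgebra.comul : H →ₗ[k] H ⊗[k] H) (Coalgebra.comul a) = t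
    induction t with
    | zero => simp
    | add t t' ht ht' => rw [map_add, LinearMap.add_apply]; exact add_mem ht ht'
    | tmul a t =>
      induction t with
      | zero => simp
      | add t t' ht ht' =>
        rw [TensorProduct.tmul_add, map_add, LinearMap.add_apply]; exact add_mem ht ht'
      | tmul b c =>
        rw [ydTwist_tmul]
        exact ⟨(a * h * HopfAlgebra.antipode k c) ⊗ₜ ⟨M.act b v, b, rfl⟩, rfl⟩

end ActionCoaction

/-! ### Compatibility and coassociativity through the generators -/

namespace LiuAlgebra

open ActionCoaction

universe u v

variable {k : Type u} [Field k] (n w : ℕ) (γ : k) [NeZero n] [hγ : Fact (IsPrimitiveRoot γ n)]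
  {V : Type v} [AddCommGroup V] [Module k V]

theorem comul_x : Coalgebra.comul (R := k) (x n w γ) = x n w γ ⊗ₜ x n w γ := comulHom_x n w γ

theorem comul_xinv : Coalgebra.comul (R := k) (xinv n w γ) = xinv n w γ ⊗ₜ xinv n w γ :=
  comulHom_xinv n w γ

theorem comul_g : Coalgebra.comul (R := k) (g n w γ) = g n w γ ⊗ₜ g n w γ := comulHom_g n w γ

theorem comul_y :
    Coalgebra.comul (R := k) (y n w γ) = y n w γ ⊗ₜ g n w γ + 1 ⊗ₜ y n w γ := comulHom_y n w γ

variable (act : LiuAlgebra n w γ →ₐ[k] Module.End k V)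

theorem twist_x (u : LiuAlgebra n w γ) (v : V) :
    twist act (x n w γ) (u ⊗ₜ v) = (x n w γ * u * xinv n w γ) ⊗ₜ act (x n w γ) v := by
  simp [twist_def, comul_x, ydTwist_tmul, antipode_x]

theorem twist_xinv (u : LiuAlgebra n w γ) (v : V) :
    twist act (xinv n w γ) (u ⊗ₜ v) = (xinv n w γ * u * x n w γ) ⊗ₜ act (xinv n w γ) v := by
  simp [twist_def, comul_xinv, ydTwist_tmul, antipode_xinv]

theorem twist_g (u : LiuAlgebra n w γ) (v : V) :
    twist act (g n w γ) (u ⊗ₜ v) = (g n w γ * u * ginv n w γ) ⊗ₜ act (g n w γ) v := by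
  simp [twist_def, comul_g, ydTwist_tmul, antipode_g]

theorem twist_y (u : LiuAlgebra n w γ) (v : V) :
    twist act (y n w γ) (u ⊗ₜ v) = (y n w γ * u * ginv n w γ) ⊗ₜ act (g n w γ) v +
      ((u * ginv n w γ) ⊗ₜ act (y n w γ) v +
        (u * HopfAlgebra.antipode k (y n w γ)) ⊗ₜ v) := by
  simp [twist_def, comul_g, comul_y, ydTwist_tmul, antipode_g, TensorProduct.tmul_add]

variable {n w γ}

theorem commute_x (a : LiuAlgebra n w γ) : Commute (x n w γ) a := by
  induction a using induction with
  | hc c => exact (Algebra.commutes c _).symm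
  | hx => exact Commute.refl _
  | hx' => exact (x_mul_xinv n w γ).trans (xinv_mul_x n w γ).symm
  | hg => exact commute_x_g n w γ
  | hy => exact x_mul_y n w γ
  | hadd a b ha hb => exact ha.add_right hb
  | hmul a b ha hb => exact ha.mul_right hb

theorem commute_xinv (a : LiuAlgebra n w γ) : Commute (xinv n w γ) a :=
  Commute.units_inv_left (u := xUnit n w γ) (commute_x a)

theorem twist_x_eq : twist act (x n w γ) = LinearMap.lTensor _ (act (x n w γ)) := by
  refine TensorProduct.ext' fun u v => ?_
  rw [twist_x, (commute_x u).eq, mul_assoc, x_mul_xinv, mul_one, LinearMap.lTensor_tmul]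

theorem twist_xinv_eq : twist act (xinv n w γ) = LinearMap.lTensor _ (act (xinv n w γ)) := by
  refine TensorProduct.ext' fun u v => ?_
  rw [twist_xinv, (commute_xinv u).eq, mul_assoc, xinv_mul_x, mul_one, LinearMap.lTensor_tmul]

/-- The Yetter–Drinfeld condition follows from its instances for the generators. -/
theorem compat_of_generators (D : ActionCoaction k (LiuAlgebra n w γ) V)
    (hx : ∀ v, D.coact (D.act (x n w γ) v) = twist D.act (x n w γ) (D.coact v))
    (hx' : ∀ v, D.coact (D.act (xinv n w γ) v) = twist D.act (xinv n w γ) (D.coact v))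
    (hg : ∀ v, D.coact (D.act (g n w γ) v) = twist D.act (g n w γ) (D.coact v))
    (hy : ∀ v, D.coact (D.act (y n w γ) v) = twist D.act (y n w γ) (D.coact v))
    (h : LiuAlgebra n w γ) (v : V) :
    D.coact (D.act h v) = twist D.act h (D.coact v) := by
  induction h using induction generalizing v with
  | hc c =>
    rw [twist_algebraMap, AlgHom.commutes, Module.algebraMap_end_apply, map_smul]
    rfl
  | hx => exact hx v
  | hx' => exact hx' v
  | hg => exact hg v
  | hy => exact hy v
  | hadd a b ha hb => simp only [map_add, LinearMap.add_apply, ha, hb]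
  | hmul a b ha hb =>
    rw [map_mul, Module.End.mul_apply, ha, hb, twist_mul, LinearMap.comp_apply]

/-- If the coaction is compatible with `g` and `y` and coassociative on `v`, then it is
coassociative on `y · v`. -/
theorem coassoc_act_y (D : ActionCoaction k (LiuAlgebra n w γ) V)
    (hg : ∀ v, D.coact (D.act (g n w γ) v) = twist D.act (g n w γ) (D.coact v))
    (hy : ∀ v, D.coact (D.act (y n w γ) v) = twist D.act (y n w γ) (D.coact v)) {v : V}
    (hv : TensorProduct.assoc k _ _ V (LinearMap.rTensor V
        (Coalgebra.comul : LiuAlgebra n w γ →ₗ[k] _) (D.coact v)) =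
      LinearMap.lTensor _ D.coact (D.coact v)) :
    TensorProduct.assoc k _ _ V (LinearMap.rTensor V
        (Coalgebra.comul : LiuAlgebra n w γ →ₗ[k] _) (D.coact (D.act (y n w γ) v))) =
      LinearMap.lTensor _ D.coact (D.coact (D.act (y n w γ) v)) := by
  -- `L` is the twisted action of `y` one level up, on `H ⊗ (H ⊗ V)`. Both `id ⊗ δ` and `Δ ⊗ id`
  -- intertwine the twisted action of `y` on `H ⊗ V` with `L`, so coassociativity passes from `v` to
  -- `y · v`.
  let L : LiuAlgebra n w γ ⊗[k] (LiuAlgebra n w γ ⊗[k] V) →ₗ[k]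
      LiuAlgebra n w γ ⊗[k] (LiuAlgebra n w γ ⊗[k] V) :=
    TensorProduct.map (LinearMap.mulLeft k (y n w γ) ∘ₗ LinearMap.mulRight k (ginv n w γ))
        (twist D.act (g n w γ)) +
      (TensorProduct.map (LinearMap.mulRight k (ginv n w γ)) (twist D.act (y n w γ)) +
        TensorProduct.map (LinearMap.mulRight k (HopfAlgebra.antipode k (y n w γ)))
          LinearMap.id)
  have h1 : (LinearMap.lTensor _ D.coact) ∘ₗ twist D.act (y n w γ) =
      L ∘ₗ LinearMap.lTensor _ D.coact := by
    refine TensorProduct.ext' fun u v => ?_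
    simp only [LinearMap.comp_apply, twist_y, map_add, LinearMap.lTensor_tmul, hg, hy, L,
      LinearMap.add_apply, TensorProduct.map_tmul, LinearMap.mulLeft_apply,
      LinearMap.mulRight_apply, LinearMap.id_apply, mul_assoc]
  have h2 : (TensorProduct.assoc k _ _ V).toLinearMap ∘ₗ LinearMap.rTensor V
        (Coalgebra.comul : LiuAlgebra n w γ →ₗ[k] _) ∘ₗ twist D.act (y n w γ) =
      L ∘ₗ (TensorProduct.assoc k _ _ V).toLinearMap ∘ₗ LinearMap.rTensor V
        (Coalgebra.comul : LiuAlgebra n w γ →ₗ[k] _) := by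
    have hginv : Coalgebra.comul (R := k) (ginv n w γ) = ginv n w γ ⊗ₜ ginv n w γ := by
      rw [ginv_eq_xg, comul_xg]
    refine TensorProduct.ext' fun u v => ?_
    simp only [LinearMap.comp_apply, twist_y, map_add, LinearMap.rTensor_tmul,
      Bialgebra.comul_mul, comul_y, hginv, antipode_y, mul_neg, map_neg]
    generalize Coalgebra.comul (R := k) u = t
    induction t with
    | zero => simp
    | add t t' ht ht' =>
      simp only [mul_add, add_mul, TensorProduct.add_tmul, map_add, neg_add] at ht ht' ⊢
      rw [← ht, ← ht']
      abel
    | tmul p q =>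
      simp only [add_mul, mul_add, Algebra.TensorProduct.tmul_mul_tmul, TensorProduct.add_tmul,
        map_add, LinearEquiv.coe_coe, TensorProduct.assoc_tmul, L, LinearMap.add_apply,
        TensorProduct.map_tmul, LinearMap.comp_apply, LinearMap.mulLeft_apply,
        LinearMap.mulRight_apply, LinearMap.id_apply, twist_g, twist_y, one_mul, mul_one,
        TensorProduct.neg_tmul, TensorProduct.tmul_neg, TensorProduct.tmul_add, antipode_y,
        mul_neg, map_neg, neg_add, g_mul_ginv, mul_assoc]
      abel
  have h3 := LinearMap.congr_fun h1 (D.coact v)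
  have h4 := LinearMap.congr_fun h2 (D.coact v)
  simp only [LinearMap.comp_apply, LinearEquiv.coe_coe] at h3 h4
  rw [hy, h3, h4, hv]

end LiuAlgebra

/-! ### Slicing tensors by functionals -/

section slices

variable {k H V : Type*} [Field k] [AddCommGroup H] [Module k H] [AddCommGroup V] [Module k V]

theorem lid_rTensor_mem_of_mem_range {W : Submodule k V} {t : H ⊗[k] V}
    (ht : t ∈ LinearMap.range (LinearMap.lTensor H W.subtype)) (φ : H →ₗ[k] k) :
    TensorProduct.lid k V (LinearMap.rTensor V φ t) ∈ W := by
  obtain ⟨s, rfl⟩ := ht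
  induction s with
  | zero => simp
  | add s s' hs hs' => simp only [map_add]; exact W.add_mem hs hs'
  | tmul h v => simpa using W.smul_mem _ v.2

theorem mem_of_tmul_mem_range {W : Submodule k V} {h : H} (hh : h ≠ 0) {v : V}
    (ht : h ⊗ₜ[k] v ∈ LinearMap.range (LinearMap.lTensor H W.subtype)) : v ∈ W := by
  obtain ⟨φ, hφ⟩ : ∃ φ : Module.Dual k H, φ h ≠ 0 := by
    by_contra! hc
    exact hh ((Module.forall_dual_apply_eq_zero_iff k h).mp hc)
  have := lid_rTensor_mem_of_mem_range ht φ
  rw [LinearMap.rTensor_tmul, TensorProduct.lid_tmul] at this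
  exact (W.smul_mem_iff hφ).mp this

theorem tmul_right_injective_of_ne_zero {v : V} (hv : v ≠ 0) {h h' : H}
    (e : h ⊗ₜ[k] v = h' ⊗ₜ[k] v) : h = h' := by
  obtain ⟨φ, hφ⟩ : ∃ φ : Module.Dual k V, φ v ≠ 0 := by
    by_contra! hc
    exact hv ((Module.forall_dual_apply_eq_zero_iff k v).mp hc)
  have := congrArg (fun t => TensorProduct.rid k H (LinearMap.lTensor H φ t)) e
  simp only [LinearMap.lTensor_tmul, TensorProduct.rid_tmul] at this
  exact smul_right_injective H hφ this

end slices

namespace LiuAlgebra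

open ActionCoaction

universe u v

variable {k : Type u} [Field k] (n w : ℕ) {γ : k} [NeZero n] [hγ : Fact (IsPrimitiveRoot γ n)]

/-! ### The coaction along a `y`-string -/

section strings

variable {V : Type v} [AddCommGroup V] [Module k V]

/-- The action of `y` on the coaction of a `y`-string of `g`-eigenvectors. -/
theorem twist_y_sum_coactionCoeff (act : LiuAlgebra n w γ →ₐ[k] Module.End k V) (β : kˣ) (r i : ℤ)
    (v : ℕ → V) (j : ℕ)
    (hg : ∀ l ≤ j, act (g n w γ) (v l) = ((β : k) * γ ^ (-(l : ℤ))) • v l)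
    (hy : ∀ l < j, act (y n w γ) (v l) = v (l + 1)) :
    twist act (y n w γ)
        (∑ l ∈ Finset.range (j + 1), coactionCoeff n w γ β r i j l ⊗ₜ[k] v l) =
      ∑ l ∈ Finset.range (j + 1), coactionCoeff n w γ β r i (j + 1) l ⊗ₜ[k] v l +
        coactionCoeff n w γ β r i (j + 1) (j + 1) ⊗ₜ[k] act (y n w γ) (v j) := by
  have h1 : ∑ l ∈ Finset.range (j + 1), twist act (y n w γ)
        (coactionCoeff n w γ β r i j l ⊗ₜ[k] v l) =
      ∑ l ∈ Finset.range (j + 1), (coactionCoeff n w γ β r i j l *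
          HopfAlgebra.antipode k (y n w γ) + ((β : k) * γ ^ (-(l : ℤ))) •
            (y n w γ * coactionCoeff n w γ β r i j l * ginv n w γ)) ⊗ₜ[k] v l +
      ∑ l ∈ Finset.range (j + 1),
        (coactionCoeff n w γ β r i j l * ginv n w γ) ⊗ₜ[k] act (y n w γ) (v l) := by
    rw [← Finset.sum_add_distrib]
    refine Finset.sum_congr rfl fun l hl => ?_
    rw [twist_y, hg l (by rw [Finset.mem_range] at hl; omega), TensorProduct.tmul_smul,
      TensorProduct.add_tmul, TensorProduct.smul_tmul']
    abel
  -- The terms with `y · v_l` move up one index and fill in the recursion for `c`. The last one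
  -- stays apart because `y · v_j` may leave the string.
  rw [map_sum, h1, Finset.sum_range_succ (fun l => (coactionCoeff n w γ β r i j l * ginv n w γ) ⊗ₜ[k]
    act (y n w γ) (v l)), Finset.sum_range_succ' _ j,
    Finset.sum_range_succ' (fun l => coactionCoeff n w γ β r i (j + 1) l ⊗ₜ[k] v l) j,
    coactionCoeff_succ_zero]
  have h2 : ∑ l ∈ Finset.range j, coactionCoeff n w γ β r i (j + 1) (l + 1) ⊗ₜ[k] v (l + 1) =
      ∑ l ∈ Finset.range j, (coactionCoeff n w γ β r i j (l + 1) *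
          HopfAlgebra.antipode k (y n w γ) + ((β : k) * γ ^ (-((l + 1 : ℕ) : ℤ))) •
            (y n w γ * coactionCoeff n w γ β r i j (l + 1) * ginv n w γ)) ⊗ₜ[k] v (l + 1) +
      ∑ l ∈ Finset.range j,
        (coactionCoeff n w γ β r i j l * ginv n w γ) ⊗ₜ[k] act (y n w γ) (v l) := by
    rw [← Finset.sum_add_distrib]
    refine Finset.sum_congr rfl fun l hl => ?_
    rw [coactionCoeff_succ_succ, hy l (Finset.mem_range.mp hl), TensorProduct.add_tmul]
  rw [h2, coactionCoeff_succ_succ, coactionCoeff_of_lt n w γ β r i (Nat.lt_succ_self j)]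
  simp only [Nat.cast_zero, neg_zero, zpow_zero, mul_one, zero_mul, mul_zero, smul_zero, zero_add]
  abel

variable {n w}

theorem act_g_act_y_pow (D : ActionCoaction k (LiuAlgebra n w γ) V) (b : k) {v : V}
    (hv : D.act (g n w γ) v = b • v) (a : ℕ) :
    D.act (g n w γ) (D.act (y n w γ ^ a) v) = (b * γ ^ (-(a : ℤ))) • D.act (y n w γ ^ a) v := by
  rw [← Module.End.mul_apply, ← map_mul, g_eq_xg,
    xg_mul_y_pow n w (hγ.out.ne_zero (NeZero.ne n)), map_smul, map_mul, LinearMap.smul_apply,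
    Module.End.mul_apply, ← g_eq_xg, hv, map_smul, smul_smul, mul_comm, neg_one_mul]

/-- The coaction on `y^a · v` for a group-like `g`-eigenvector `v`. -/
theorem coact_act_y_pow (D : ActionCoaction k (LiuAlgebra n w γ) V) (hD : D.IsYetterDrinfeld)
    (β : kˣ) (r i : ℤ) {v : V} (hg : D.act (g n w γ) v = (β : k) • v)
    (hv : D.coact v = xg n w γ r i ⊗ₜ v) (a : ℕ) :
    D.coact (D.act (y n w γ ^ a) v) = ∑ l ∈ Finset.range (a + 1),
      coactionCoeff n w γ β r i a l ⊗ₜ[k] D.act (y n w γ ^ l) v := by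
  have succ (a : ℕ) : D.act (y n w γ) (D.act (y n w γ ^ a) v) = D.act (y n w γ ^ (a + 1)) v := by
    rw [pow_succ', map_mul, Module.End.mul_apply]
  induction a with
  | zero => simp [coactionCoeff, hv]
  | succ a ih =>
    rw [← succ, hD.compat, ← twist_def, ih, twist_y_sum_coactionCoeff n w D.act β r i
      (fun l => D.act (y n w γ ^ l) v) a (fun l _ => act_g_act_y_pow D _ hg l)
      (fun l _ => succ l), Finset.sum_range_succ _ (a + 1), succ]

end strings

/-! ### `V(α, β, x^r g^i)` is a simple Yetter–Drinfeld module -/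

section V

variable (α β : kˣ) (r i : ℤ) (hαβ : α ^ w = β ^ n)

/-- The basis vector `v_l`, and `0` if `l > m`. -/
noncomputable def basisVec (k : Type*) [Field k] (m l : ℕ) : Fin (m + 1) → k :=
  if h : l < m + 1 then Pi.single ⟨l, h⟩ 1 else 0

theorem basisVec_val (m : ℕ) (j : Fin (m + 1)) :
    basisVec k m (j : ℕ) = Pi.single j 1 := by
  rw [basisVec, dif_pos j.2]

theorem basisVec_of_lt {m l : ℕ} (h : l < m + 1) :
    basisVec k m l = Pi.single ⟨l, h⟩ 1 := dif_pos h

theorem V_act_x_apply (v) : (V n w γ α β r i hαβ).act (x n w γ) v = (α : k) • v := by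
  rw [V_act_x]
  rfl

theorem V_act_xinv_apply (v) : (V n w γ α β r i hαβ).act (xinv n w γ) v = (α : k)⁻¹ • v := by
  have h : (V n w γ α β r i hαβ).act (x n w γ) ((V n w γ α β r i hαβ).act (xinv n w γ) v) = v := by
    rw [← Module.End.mul_apply, ← map_mul, x_mul_xinv, map_one, Module.End.one_apply]
  rw [V_act_x_apply] at h
  conv_rhs => rw [← h]
  rw [smul_smul, inv_mul_cancel₀ α.ne_zero, one_smul]

theorem V_act_g_basisVec (l : ℕ) :
    (V n w γ α β r i hαβ).act (g n w γ) (basisVec k _ l) =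
      ((β : k) * γ ^ (-(l : ℤ))) • basisVec k _ l := by
  by_cases h : l < liuTop n γ β i + 1
  · rw [basisVec_of_lt h, V_act_g]
  · rw [basisVec, dif_neg h, map_zero, smul_zero]

theorem V_act_y_basisVec {l : ℕ} (hl : l < liuTop n γ β i) :
    (V n w γ α β r i hαβ).act (y n w γ) (basisVec k _ l) = basisVec k _ (l + 1) := by
  rw [basisVec_of_lt (by omega), V_act_y, dif_pos hl, basisVec_of_lt (by omega)]

theorem V_act_y_basisVec_top :
    (V n w γ α β r i hαβ).act (y n w γ) (basisVec k _ (liuTop n γ β i)) =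
      (1 - (β : k) ^ n) • basisVec k _ 0 := by
  rw [basisVec_of_lt (by omega), V_act_y, dif_neg (by simp), basisVec_of_lt (by omega)]
  rfl

theorem V_coact_basisVec {j : ℕ} (hj : j ≤ liuTop n γ β i) :
    (V n w γ α β r i hαβ).coact (basisVec k _ j) =
      ∑ l ∈ Finset.range (j + 1), coactionCoeff n w γ β r i j l ⊗ₜ[k] basisVec k _ l := by
  rw [basisVec_of_lt (by omega), V_coact]
  refine Finset.sum_bij (fun l _ => (l : ℕ)) ?_ ?_ ?_ ?_
  · intro l hl
    rw [Finset.mem_filter, Fin.le_def] at hl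
    rw [Finset.mem_range]
    have := hl.2
    simp only at this
    omega
  · intro l _ l' _ h
    exact Fin.ext h
  · intro l hl
    rw [Finset.mem_range] at hl
    exact ⟨⟨l, by omega⟩, by simp [Fin.le_def]; omega, rfl⟩
  · intro l _
    rw [basisVec_val]

theorem linearMap_ext_basisVec {m : ℕ} {M : Type*} [AddCommGroup M] [Module k M]
    {f f' : (Fin (m + 1) → k) →ₗ[k] M}
    (h : ∀ l ≤ m, f (basisVec k m l) = f' (basisVec k m l)) : f = f' :=
  (Pi.basisFun k (Fin (m + 1))).ext fun j => by
    rw [Pi.basisFun_apply, ← basisVec_val]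
    exact h j (by omega)

theorem V_coact_act_g (v) : (V n w γ α β r i hαβ).coact ((V n w γ α β r i hαβ).act (g n w γ) v) =
    twist (V n w γ α β r i hαβ).act (g n w γ) ((V n w γ α β r i hαβ).coact v) := by
  have hγ0 : γ ≠ 0 := hγ.out.ne_zero (NeZero.ne n)
  refine LinearMap.congr_fun (f := (V n w γ α β r i hαβ).coact ∘ₗ
    (V n w γ α β r i hαβ).act (g n w γ)) (g := twist (V n w γ α β r i hαβ).act (g n w γ) ∘ₗ
      (V n w γ α β r i hαβ).coact) (linearMap_ext_basisVec fun j hj => ?_) v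
  rw [LinearMap.comp_apply, LinearMap.comp_apply, V_act_g_basisVec, map_smul,
    V_coact_basisVec n w α β r i hαβ hj, map_sum, Finset.smul_sum]
  refine Finset.sum_congr rfl fun l hl => ?_
  rw [Finset.mem_range] at hl
  rw [twist_g, g_mul_coactionCoeff_mul_ginv n w β r i (by omega), V_act_g_basisVec,
    TensorProduct.tmul_smul, TensorProduct.smul_tmul', TensorProduct.smul_tmul', smul_smul]
  -- The eigenvalue `γ^{l-j}` of the coefficient and `βγ^{-l}` of `v_l` multiply to `βγ^{-j}`,
  -- independently of `l`.
  congr 2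
  rw [mul_assoc, ← zpow_add₀ hγ0]
  congr 2
  ring

theorem V_coact_act_y (v) : (V n w γ α β r i hαβ).coact ((V n w γ α β r i hαβ).act (y n w γ) v) =
    twist (V n w γ α β r i hαβ).act (y n w γ) ((V n w γ α β r i hαβ).coact v) := by
  refine LinearMap.congr_fun (f := (V n w γ α β r i hαβ).coact ∘ₗ
    (V n w γ α β r i hαβ).act (y n w γ)) (g := twist (V n w γ α β r i hαβ).act (y n w γ) ∘ₗ
      (V n w γ α β r i hαβ).coact) (linearMap_ext_basisVec fun j hj => ?_) v
  rw [LinearMap.comp_apply, LinearMap.comp_apply, V_coact_basisVec n w α β r i hαβ hj,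
    twist_y_sum_coactionCoeff n w _ β r i (fun l => basisVec k _ l) j
      (fun l _ => V_act_g_basisVec n w α β r i hαβ l)
      (fun l hl => V_act_y_basisVec n w α β r i hαβ (hl.trans_le hj))]
  rcases hj.lt_or_eq with hj | rfl
  · rw [V_act_y_basisVec n w α β r i hαβ hj,
      V_coact_basisVec n w α β r i hαβ (Nat.succ_le_of_lt hj), Finset.sum_range_succ _ (j + 1)]
  -- At the top of the string only the terms with `l = 0` and `l = m + 1` survive, and together they
  -- give `(1 - βⁿ) δ(v_0)`.
  · have h1 : ∑ l ∈ Finset.range (liuTop n γ β i + 1),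
        coactionCoeff n w γ β r i (liuTop n γ β i + 1) l ⊗ₜ[k] basisVec k (liuTop n γ β i) l =
        coactionCoeff n w γ β r i (liuTop n γ β i + 1) 0 ⊗ₜ[k] basisVec k (liuTop n γ β i) 0 := by
      refine Finset.sum_eq_single_of_mem 0 (Finset.mem_range.mpr (Nat.succ_pos _))
        fun l hl h0 => ?_
      rw [Finset.mem_range] at hl
      rw [coactionCoeff_liuTop_succ n w (γ := γ) β r i (Nat.pos_of_ne_zero h0) (by omega),
        TensorProduct.zero_tmul]
    rw [h1, V_act_y_basisVec_top, map_smul, V_coact_basisVec n w α β r i hαβ (Nat.zero_le _),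
      coactionCoeff_liuTop_succ_zero, coactionCoeff_self, TensorProduct.tmul_smul,
      TensorProduct.smul_tmul', ← TensorProduct.add_tmul, ← smul_add, sub_add_cancel,
      ← TensorProduct.smul_tmul']
    simp [coactionCoeff]

/-- Coassociativity starts from the group-like vector `v_0` and climbs the string by
`coassoc_act_y`. For the counit, each `c(j, l)` with `l < j` contains a positive power of `y`. -/
theorem V_isYetterDrinfeld : (V n w γ α β r i hαβ).IsYetterDrinfeld where
  coassoc v := by
    refine LinearMap.congr_fun (f := (TensorProduct.assoc k _ _ _).toLinearMap ∘ₗ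
      LinearMap.rTensor _ (Coalgebra.comul : LiuAlgebra n w γ →ₗ[k] _) ∘ₗ
        (V n w γ α β r i hαβ).coact) (g := LinearMap.lTensor _ (V n w γ α β r i hαβ).coact ∘ₗ
          (V n w γ α β r i hαβ).coact) (linearMap_ext_basisVec fun j hj => ?_) v
    simp only [LinearMap.comp_apply, LinearEquiv.coe_coe]
    induction j with
    | zero =>
      rw [V_coact_basisVec n w α β r i hαβ hj]
      simp [coactionCoeff, comul_xg, V_coact_basisVec n w α β r i hαβ hj]
    | succ j ih =>
      rw [← V_act_y_basisVec n w α β r i hαβ (l := j) (by omega)]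
      exact coassoc_act_y _ (V_coact_act_g n w α β r i hαβ) (V_coact_act_y n w α β r i hαβ)
        (ih (by omega))
  counit_coact v := by
    refine LinearMap.congr_fun (f := (TensorProduct.lid k _).toLinearMap ∘ₗ
      LinearMap.rTensor _ (Coalgebra.counit : LiuAlgebra n w γ →ₗ[k] k) ∘ₗ
        (V n w γ α β r i hαβ).coact) (g := LinearMap.id)
        (linearMap_ext_basisVec fun j hj => ?_) v
    simp only [LinearMap.comp_apply, LinearEquiv.coe_coe, LinearMap.id_apply]
    rw [V_coact_basisVec n w α β r i hαβ hj, map_sum, map_sum,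
      Finset.sum_eq_single_of_mem j (Finset.mem_range.mpr (Nat.lt_succ_self j))]
    · rw [coactionCoeff_self, LinearMap.rTensor_tmul, TensorProduct.lid_tmul,
        (isGroupLikeElem_xg n w γ _ _).counit_eq_one, one_smul]
    · intro l hl hlj
      rw [Finset.mem_range] at hl
      obtain ⟨d, rfl⟩ := Nat.exists_eq_add_of_le' (show l ≤ j by omega)
      have hy : Coalgebra.counit (R := k) (y n w γ) = 0 := counitHom_y n w γ
      rw [coactionCoeff_eq, LinearMap.rTensor_tmul, map_smul, Bialgebra.counit_mul,
        Bialgebra.counit_pow, hy, zero_pow (by omega), zero_mul, smul_zero, TensorProduct.zero_tmul,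
        map_zero]
  compat h v := by
    refine compat_of_generators _ (fun v => ?_) (fun v => ?_) (V_coact_act_g n w α β r i hαβ)
      (V_coact_act_y n w α β r i hαβ) h v
    · rw [twist_x_eq, V_act_x_apply, map_smul, V_act_x, LinearMap.lTensor_smul]
      simp [Module.End.one_eq_id]
    · have : (V n w γ α β r i hαβ).act (xinv n w γ) = (α : k)⁻¹ • 1 :=
        LinearMap.ext (V_act_xinv_apply n w α β r i hαβ)
      rw [twist_xinv_eq, V_act_xinv_apply, map_smul, this, LinearMap.lTensor_smul]
      simp [Module.End.one_eq_id]

variable [NeZero w] [IsAlgClosed k] [CharZero k]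

/-- The coaction leads down from `v_j` to `v_0`, since `c(j, 0) ≠ 0`, and `y` leads up from `v_0` to
every `v_l`. -/
theorem V_eq_top_of_basisVec_mem {W : Submodule k (Fin (liuTop n γ β i + 1) → k)}
    (hW : (V n w γ α β r i hαβ).IsSubobject W) {j : ℕ} (hj : j ≤ liuTop n γ β i)
    (hjW : basisVec k _ j ∈ W) : W = ⊤ := by
  have hlt := liuTop_lt n γ β i
  have hγ0 : γ ≠ 0 := hγ.out.ne_zero (NeZero.ne n)
  have h0 : basisVec k (liuTop n γ β i) 0 ∈ W := by
    have h1 := hW.2 _ hjW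
    rw [V_coact_basisVec n w α β r i hαβ hj] at h1
    refine mem_of_tmul_mem_range (coactionCoeff_zero_ne_zero n w (γ := γ) β r i j hj) ?_
    -- Conjugation by `g` on the first leg preserves `H ⊗ W` and has the distinct eigenvalues
    -- `γ^{l-j}` on the terms of `δ(v_j)`, so each term lies in `H ⊗ W` separately.
    refine Module.End.mem_of_sum_eigenvectors_mem (LinearMap.rTensor _
      (LinearMap.mulLeft k (g n w γ) ∘ₗ LinearMap.mulRight k (ginv n w γ))) _ ?_
      (Finset.range (j + 1)) (fun l => γ ^ ((l : ℤ) - j)) ?_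
      (fun l => coactionCoeff n w γ β r i j l ⊗ₜ[k] basisVec k _ l) ?_ h1 0 (by simp)
    · rintro _ ⟨s, rfl⟩
      rw [← LinearMap.comp_apply, LinearMap.rTensor_comp_lTensor,
        ← LinearMap.lTensor_comp_rTensor]
      exact ⟨_, rfl⟩
    · intro a ha b hb hab
      rw [Finset.mem_coe, Finset.mem_range] at ha hb
      simp only at hab
      rw [zpow_sub₀ hγ0, zpow_sub₀ hγ0, div_left_inj' (zpow_ne_zero _ hγ0), zpow_natCast,
        zpow_natCast] at hab
      exact hγ.out.pow_inj (by omega) (by omega) hab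
    · intro l hl
      rw [Finset.mem_range] at hl
      rw [LinearMap.rTensor_tmul, TensorProduct.smul_tmul',
        ← g_mul_coactionCoeff_mul_ginv n w β r i (by omega), mul_assoc]
      rfl
  have h1 (l : ℕ) (hl : l ≤ liuTop n γ β i) : basisVec k (liuTop n γ β i) l ∈ W := by
    induction l with
    | zero => exact h0
    | succ l ih =>
      rw [← V_act_y_basisVec n w α β r i hαβ (by omega)]
      exact hW.1 _ _ (ih (by omega))
  rw [eq_top_iff, ← (Pi.basisFun k (Fin (liuTop n γ β i + 1))).span_eq, Submodule.span_le]
  rintro _ ⟨l, rfl⟩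
  rw [Pi.basisFun_apply, ← basisVec_val]
  exact h1 l (by omega)

/-- A `g`-stable subspace contains the components of its elements, as `g` has the distinct
eigenvalues `β γ^{-j}`. -/
theorem V_single_mem_of_act_g_mem {W : Submodule k (Fin (liuTop n γ β i + 1) → k)}
    (hW : ∀ v ∈ W, (V n w γ α β r i hαβ).act (g n w γ) v ∈ W) {v} (hv : v ∈ W)
    (j : Fin (liuTop n γ β i + 1)) : v j • (Pi.single j 1 : Fin _ → k) ∈ W := by
  have hlt := liuTop_lt n γ β i
  refine Module.End.mem_of_sum_eigenvectors_mem ((V n w γ α β r i hαβ).act (g n w γ)) W hW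
    Finset.univ
    (fun j : Fin (liuTop n γ β i + 1) => (β : k) * γ ^ (-((j : ℕ) : ℤ))) ?_
    (fun j => v j • (Pi.single j 1 : Fin _ → k)) ?_ ?_ j (Finset.mem_univ j)
  · intro a _ b _ hab
    have h3 : γ ^ (a : ℕ) = γ ^ (b : ℕ) := by
      simpa [zpow_neg] using hab
    exact Fin.ext (hγ.out.pow_inj (by omega) (by omega) h3)
  · intro a _
    rw [map_smul, V_act_g, smul_comm]
  · convert hv
    have := (Pi.basisFun k (Fin (liuTop n γ β i + 1))).sum_repr v
    simpa using this

theorem V_isSimple : (V n w γ α β r i hαβ).IsSimpleYetterDrinfeld where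
  isYetterDrinfeld := V_isYetterDrinfeld n w α β r i hαβ
  nontrivial := inferInstance
  eq_bot_or_eq_top W hW := by
    refine or_iff_not_imp_left.mpr fun hne => ?_
    obtain ⟨v, hv, hv0⟩ := W.exists_mem_ne_zero_of_ne_bot hne
    obtain ⟨j, hj⟩ := Function.ne_iff.mp hv0
    have h1 := V_single_mem_of_act_g_mem n w α β r i hαβ (hW.1 _) hv j
    refine V_eq_top_of_basisVec_mem n w α β r i hαβ hW (j := j) (by omega) ?_
    rw [basisVec_val]
    exact (W.smul_mem_iff hj).mp h1

end V

end LiuAlgebra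

namespace LiuAlgebra

open ActionCoaction

universe u v

variable {k : Type u} [Field k] (n w : ℕ) {γ : k} [NeZero n] [hγ : Fact (IsPrimitiveRoot γ n)]

/-! ### Morphisms out of `V(α, β, x^r g^i)` -/

section morphisms

variable {n w} {E M : Type*} [AddCommGroup E] [Module k E] [AddCommGroup M] [Module k M]

theorem map_act_of_generators (D : ActionCoaction k (LiuAlgebra n w γ) E)
    (D' : ActionCoaction k (LiuAlgebra n w γ) M) (f : E →ₗ[k] M)
    (hx : ∀ v, f (D.act (x n w γ) v) = D'.act (x n w γ) (f v))
    (hg : ∀ v, f (D.act (g n w γ) v) = D'.act (g n w γ) (f v))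
    (hy : ∀ v, f (D.act (y n w γ) v) = D'.act (y n w γ) (f v)) (h : LiuAlgebra n w γ) (v : E) :
    f (D.act h v) = D'.act h (f v) := by
  induction h using induction generalizing v with
  | hc c => simp [Module.algebraMap_end_apply]
  | hx => exact hx v
  | hx' =>
    have h1 : D.act (x n w γ) (D.act (xinv n w γ) v) = v := by
      rw [← Module.End.mul_apply, ← map_mul, x_mul_xinv, map_one, Module.End.one_apply]
    conv_rhs => rw [← h1, hx, ← Module.End.mul_apply, ← map_mul, xinv_mul_x, map_one,
      Module.End.one_apply]
  | hg => exact hg v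
  | hy => exact hy v
  | hadd a b ha hb => simp only [map_add, LinearMap.add_apply, ha, hb]
  | hmul a b ha hb => simp only [map_mul, Module.End.mul_apply, ha, hb]

theorem act_mem_of_generators (D : ActionCoaction k (LiuAlgebra n w γ) E) (W : Submodule k E)
    (hx : ∀ v ∈ W, D.act (x n w γ) v ∈ W) (hx' : ∀ v ∈ W, D.act (xinv n w γ) v ∈ W)
    (hg : ∀ v ∈ W, D.act (g n w γ) v ∈ W) (hy : ∀ v ∈ W, D.act (y n w γ) v ∈ W)
    (h : LiuAlgebra n w γ) (v : E) (hv : v ∈ W) : D.act h v ∈ W := by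
  induction h using induction generalizing v with
  | hc c => rw [AlgHom.commutes, Module.algebraMap_end_apply]; exact W.smul_mem _ hv
  | hx => exact hx v hv
  | hx' => exact hx' v hv
  | hg => exact hg v hv
  | hy => exact hy v hv
  | hadd a b ha hb => rw [map_add, LinearMap.add_apply]; exact W.add_mem (ha v hv) (hb v hv)
  | hmul a b ha hb => rw [map_mul, Module.End.mul_apply]; exact ha _ (hb v hv)

/-- A string of vectors satisfying the defining formulas of `V(α, β, x^r g^i)` gives a morphism. -/
theorem exists_isMorphism_V (α β : kˣ) (r i : ℤ) (hαβ : α ^ w = β ^ n)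
    (D : ActionCoaction k (LiuAlgebra n w γ) M) (v : ℕ → M)
    (hx : ∀ l, D.act (x n w γ) (v l) = (α : k) • v l)
    (hg : ∀ l, D.act (g n w γ) (v l) = ((β : k) * γ ^ (-(l : ℤ))) • v l)
    (hy : ∀ l < liuTop n γ β i, D.act (y n w γ) (v l) = v (l + 1))
    (hytop : D.act (y n w γ) (v (liuTop n γ β i)) = (1 - (β : k) ^ n) • v 0)
    (hcoact : ∀ j ≤ liuTop n γ β i, D.coact (v j) =
      ∑ l ∈ Finset.range (j + 1), coactionCoeff n w γ β r i j l ⊗ₜ[k] v l) :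
    ∃ f, IsMorphism (V n w γ α β r i hαβ) D f ∧
      ∀ l ≤ liuTop n γ β i, f (basisVec k _ l) = v l := by
  let f : (Fin (liuTop n γ β i + 1) → k) →ₗ[k] M :=
    (Pi.basisFun k (Fin (liuTop n γ β i + 1))).constr k fun j => v j
  have hf (l : ℕ) (hl : l ≤ liuTop n γ β i) : f (basisVec k _ l) = v l := by
    rw [basisVec_of_lt (by omega), ← Pi.basisFun_apply]
    exact (Pi.basisFun k (Fin (liuTop n γ β i + 1))).constr_basis k _ _
  refine ⟨f, ⟨?_, ?_⟩, hf⟩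
  · refine map_act_of_generators _ _ f (fun u => ?_) (fun u => ?_) (fun u => ?_)
    · refine LinearMap.congr_fun (f := f ∘ₗ (V n w γ α β r i hαβ).act (x n w γ))
        (g := D.act (x n w γ) ∘ₗ f) (linearMap_ext_basisVec fun l hl => ?_) u
      rw [LinearMap.comp_apply, LinearMap.comp_apply, V_act_x_apply, map_smul, hf l hl, hx]
    · refine LinearMap.congr_fun (f := f ∘ₗ (V n w γ α β r i hαβ).act (g n w γ))
        (g := D.act (g n w γ) ∘ₗ f) (linearMap_ext_basisVec fun l hl => ?_) u
      rw [LinearMap.comp_apply, LinearMap.comp_apply, V_act_g_basisVec, map_smul, hf l hl, hg]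
    · refine LinearMap.congr_fun (f := f ∘ₗ (V n w γ α β r i hαβ).act (y n w γ))
        (g := D.act (y n w γ) ∘ₗ f) (linearMap_ext_basisVec fun l hl => ?_) u
      rw [LinearMap.comp_apply, LinearMap.comp_apply, hf l hl]
      rcases hl.lt_or_eq with hl' | rfl
      · rw [V_act_y_basisVec n w α β r i hαβ hl', hf _ hl', hy l hl']
      · rw [V_act_y_basisVec_top, map_smul, hf _ (Nat.zero_le _), hytop]
  · intro u
    refine LinearMap.congr_fun (f := D.coact ∘ₗ f)
      (g := LinearMap.lTensor _ f ∘ₗ (V n w γ α β r i hαβ).coact)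
      (linearMap_ext_basisVec fun l hl => ?_) u
    rw [LinearMap.comp_apply, LinearMap.comp_apply, hf l hl, hcoact l hl,
      V_coact_basisVec n w α β r i hαβ hl, map_sum]
    refine Finset.sum_congr rfl fun j hj => ?_
    rw [Finset.mem_range] at hj
    rw [LinearMap.lTensor_tmul, hf j (by omega)]

end morphisms

/-! ### The isomorphism criterion -/

section criterion

variable [NeZero w] [IsAlgClosed k] [CharZero k]

/-- The element `x^r g^i` determines `i` modulo `n`; if `βⁿ = 1`, then `β = γ^{m-i}` with `m < n`
determines `m`, and otherwise `m = n - 1`. -/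
theorem liuTop_eq_of_xg_eq (β : kˣ) {r i r' i' : ℤ} (h : xg n w γ r i = xg n w γ r' i') :
    liuTop n γ β i = liuTop n γ β i' := by
  have hγ0 : γ ≠ 0 := hγ.out.ne_zero (NeZero.ne n)
  by_cases hβ : (β : k) ^ n = 1
  · have h1 := (eq_zpow_liuTop_sub n (γ := γ) β i hβ).symm.trans
      (eq_zpow_liuTop_sub n (γ := γ) β i' hβ)
    have h2 : γ ^ i' = γ ^ i := by
      have h3 := (hγ.out.zpow_eq_one_iff_dvd _).mpr (Int.modEq_iff_dvd.mp (modEq_of_xg_eq n w h))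
      rwa [zpow_sub₀ hγ0, div_eq_one_iff_eq (zpow_ne_zero _ hγ0)] at h3
    rw [zpow_sub₀ hγ0, zpow_sub₀ hγ0, h2, div_left_inj' (zpow_ne_zero _ hγ0), zpow_natCast,
      zpow_natCast] at h1
    exact hγ.out.pow_inj (liuTop_lt n γ β i) (liuTop_lt n γ β i') h1
  · have h1 := liuTop_eq_of_pow_ne_one n (γ := γ) β i hβ
    have h2 := liuTop_eq_of_pow_ne_one n (γ := γ) β i' hβ
    omega

theorem basisVec_zero_ne_zero (m : ℕ) : basisVec k m 0 ≠ 0 := by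
  rw [basisVec_of_lt (Nat.succ_pos m)]
  simp

/-- The underlying spaces are indexed by `Fin` of expressions that are only provably equal, so the
map `v_l ↦ v_l` is built from the string criterion, and simplicity makes it bijective. -/
theorem V_isomorphic_of_xg_eq (α β : kˣ) (r i r' i' : ℤ) (h : α ^ w = β ^ n)
    (hxg : xg n w γ r i = xg n w γ r' i') :
    (V n w γ α β r i h).Isomorphic (V n w γ α β r' i' h) := by
  have hm := liuTop_eq_of_xg_eq n w β hxg
  obtain ⟨f, hf, hfv⟩ := exists_isMorphism_V α β r i h (V n w γ α β r' i' h) (basisVec k _)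
    (fun l => V_act_x_apply n w α β r' i' h _) (V_act_g_basisVec n w α β r' i' h)
    (fun l hl => V_act_y_basisVec n w α β r' i' h (hm ▸ hl))
    (by rw [hm]; exact V_act_y_basisVec_top n w α β r' i' h)
    (fun j hj => by
      rw [V_coact_basisVec n w α β r' i' h (hm ▸ hj), coactionCoeff_congr n w β hxg])
  refine hf.isomorphic (V_isSimple n w α β r i h) (V_isSimple n w α β r' i' h) ?_
  rintro rfl
  exact basisVec_zero_ne_zero _ (hfv 0 (Nat.zero_le _)).symm

/-- The image of `v_0` is a `g`-eigenvector `u` with `δ(u) = x^r g^i ⊗ u`. Distinct eigenvalues make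
it a multiple of one `v_j` of the target, and `c(j, 0) ≠ 0` excludes `j > 0`; comparing action and
coaction on `v_0` gives the three equalities. -/
theorem eq_of_V_isomorphic {α β α' β' : kˣ} {r i r' i' : ℤ} {h : α ^ w = β ^ n}
    {h' : α' ^ w = β' ^ n} (H : (V n w γ α β r i h).Isomorphic (V n w γ α' β' r' i' h')) :
    α = α' ∧ β = β' ∧ xg n w γ r i = xg n w γ r' i' := by
  obtain ⟨e, he1, he2⟩ := H
  set u := e (basisVec k _ 0)
  have hu0 : u ≠ 0 := fun hu => basisVec_zero_ne_zero _ (e.map_eq_zero_iff.mp hu)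
  have hux : (α : k) • u = (α' : k) • u := by
    rw [← V_act_x_apply n w α' β' r' i' h', ← he1, V_act_x_apply, map_smul]
  have hug : (V n w γ α' β' r' i' h').act (g n w γ) u = (β : k) • u := by
    rw [← he1, V_act_g_basisVec, map_smul]
    simp [u]
  have huc : (V n w γ α' β' r' i' h').coact u = xg n w γ r i ⊗ₜ u := by
    rw [he2, V_coact_basisVec n w α β r i h (Nat.zero_le _)]
    simp [coactionCoeff, u]
  obtain ⟨j, hj⟩ := Function.ne_iff.mp hu0
  have hmem := V_single_mem_of_act_g_mem n w (γ := γ) α' β' r' i' h' (W := k ∙ u) (fun v hv => by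
    obtain ⟨c, rfl⟩ := Submodule.mem_span_singleton.mp hv
    rw [map_smul, hug, smul_smul]
    exact Submodule.smul_mem _ _ (Submodule.mem_span_singleton_self u))
    (Submodule.mem_span_singleton_self u) j
  rw [Submodule.smul_mem_iff _ hj, Submodule.mem_span_singleton] at hmem
  obtain ⟨c, hc⟩ := hmem
  rw [← basisVec_val] at hc
  have hjle : (j : ℕ) ≤ liuTop n γ β' i' := by omega
  have hjg := V_act_g_basisVec n w (γ := γ) α' β' r' i' h' j
  have hjc := V_coact_basisVec n w (γ := γ) α' β' r' i' h' hjle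
  rw [← hc, map_smul, huc, ← TensorProduct.tmul_smul, hc] at hjc
  rw [← hc, map_smul, hug, smul_comm, hc] at hjg
  have hne : basisVec k (liuTop n γ β' i') j ≠ 0 := by rw [basisVec_val]; simp
  -- The `v_0`-component of `δ(v_j)` is `c(j, 0) ≠ 0`, but that of `x^r g^i ⊗ v_j` is `0` when `j >
  -- 0`.
  have hj0 : (j : ℕ) = 0 := by
    by_contra hj0
    have h1 := congrArg (fun t => TensorProduct.rid k _ (LinearMap.lTensor _
      (LinearMap.proj (R := k) (φ := fun _ => k) (0 : Fin (liuTop n γ β' i' + 1))) t)) hjc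
    have h2 (l : ℕ) (hl : l ≠ 0) : basisVec k (liuTop n γ β' i') l 0 = 0 := by
      by_cases hl' : l < liuTop n γ β' i' + 1
      · rw [basisVec_of_lt hl', Pi.single_apply, if_neg]
        intro h3
        exact hl (congrArg Fin.val h3).symm
      · rw [basisVec, dif_neg hl']
        rfl
    simp only [LinearMap.lTensor_tmul, TensorProduct.rid_tmul, map_sum, LinearMap.proj_apply,
      h2 _ hj0, zero_smul] at h1
    rw [Finset.sum_eq_single_of_mem 0 (by simp) (fun l _ hl => by rw [h2 l hl, zero_smul]),
      basisVec_of_lt (Nat.succ_pos _)] at h1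
    simp only [Fin.zero_eta, Pi.single_eq_same, one_smul] at h1
    exact coactionCoeff_zero_ne_zero n w (γ := γ) β' r' i' j hjle h1.symm
  rw [hj0] at hne hjg hjc
  refine ⟨Units.ext (smul_left_injective k hu0 hux), Units.ext ?_, ?_⟩
  · simpa using smul_left_injective k hne hjg
  · rw [zero_add, Finset.sum_range_one, coactionCoeff] at hjc
    exact tmul_right_injective_of_ne_zero hne hjc

end criterion

end LiuAlgebra

/-! ### Eigenvectors and Schur's lemma for algebraic operators -/

open Polynomial in
/-- If a nonzero polynomial in `f` kills the nonzero vector `v`, then some polynomial in `f` maps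
`v` to an eigenvector. -/
theorem Module.End.exists_aeval_eigenvector {k V : Type*} [Field k] [IsAlgClosed k]
    [AddCommGroup V] [Module k V] (f : Module.End k V) {v : V} (hv : v ≠ 0) (p : k[X])
    (hp : p ≠ 0) (h : aeval f p v = 0) :
    ∃ (q : k[X]) (c : k), aeval f q v ≠ 0 ∧ f (aeval f q v) = c • aeval f q v := by
  induction hd : p.natDegree generalizing p with
  | zero =>
    rw [Polynomial.natDegree_eq_zero] at hd
    obtain ⟨c, rfl⟩ := hd
    rw [aeval_C, Module.algebraMap_end_apply] at h
    rcases smul_eq_zero.mp h with rfl | h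
    · exact absurd C_0 hp
    · exact absurd h hv
  | succ d ih =>
    obtain ⟨c, hc⟩ := IsAlgClosed.exists_root p (by
      rw [Polynomial.degree_eq_natDegree hp, hd]; exact_mod_cast Nat.succ_ne_zero d)
    obtain ⟨q, rfl⟩ := dvd_iff_isRoot.mpr hc
    have hq : q ≠ 0 := right_ne_zero_of_mul hp
    -- Linear factors are removed until the quotient no longer kills `v`; the last factor removed
    -- shows that `q(f) v` is an eigenvector.
    by_cases hqv : aeval f q v = 0
    · refine ih q hq hqv ?_
      rw [natDegree_mul (X_sub_C_ne_zero c) hq, natDegree_X_sub_C] at hd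
      omega
    · refine ⟨q, c, hqv, ?_⟩
      rw [map_mul, Module.End.mul_apply] at h
      simpa [sub_eq_zero] using h

namespace ActionCoaction

variable {k H V : Type*} [Field k] [Ring H] [HopfAlgebra k H] [AddCommGroup V] [Module k V]
  {M : ActionCoaction k H V}

theorem IsMorphism.add {f f' : Module.End k V} (hf : IsMorphism M M f) (hf' : IsMorphism M M f') :
    IsMorphism M M (f + f') where
  map_act h v := by simp [hf.map_act, hf'.map_act]
  map_coact v := by simp [hf.map_coact, hf'.map_coact, LinearMap.lTensor_add]

theorem IsMorphism.sub_smul_one {f : Module.End k V} (hf : IsMorphism M M f) (c : k) :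
    IsMorphism M M (f - c • 1) where
  map_act h v := by simp [hf.map_act]
  map_coact v := by
    simp [hf.map_coact, LinearMap.lTensor_sub, LinearMap.lTensor_smul, Module.End.one_eq_id]

open Polynomial in
/-- Schur's lemma for algebraic endomorphisms. -/
theorem IsMorphism.exists_eq_smul_one [IsAlgClosed k] (hM : M.IsSimpleYetterDrinfeld)
    {f : Module.End k V} (hf : IsMorphism M M f) (p : k[X]) (hp : p ≠ 0) (h : aeval f p = 0) :
    ∃ c : k, f = c • 1 := by
  have := hM.nontrivial
  obtain ⟨v, hv⟩ := exists_ne (0 : V)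
  obtain ⟨q, c, hq, hc⟩ := f.exists_aeval_eigenvector hv p hp (by rw [h]; rfl)
  refine ⟨c, sub_eq_zero.mp ?_⟩
  by_contra h0
  -- A nonzero `f - c` would be injective, yet it kills an eigenvector.
  refine hq ((hf.sub_smul_one c).injective_of_simple hM h0 ?_)
  simp [hc]

end ActionCoaction

namespace LiuAlgebra

open ActionCoaction

variable {k : Type*} [Field k] {n w : ℕ} {γ : k} [NeZero n] [hγ : Fact (IsPrimitiveRoot γ n)]
  {M : Type*} [AddCommGroup M] [Module k M] {D : ActionCoaction k (LiuAlgebra n w γ) M}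

theorem lid_rTensor_assoc_tmul {H : Type*} [AddCommGroup H] [Module k H] (φ : H →ₗ[k] k)
    (t : H ⊗[k] H) (m : M) :
    TensorProduct.lid k _ (LinearMap.rTensor _ φ (TensorProduct.assoc k H H M (t ⊗ₜ m))) =
      TensorProduct.lid k _ (LinearMap.rTensor _ φ t) ⊗ₜ m := by
  induction t with
  | zero => simp
  | add t t' ht ht' => simp only [TensorProduct.add_tmul, map_add, ht, ht']
  | tmul a b => simp [TensorProduct.smul_tmul']

theorem lid_rTensor_lTensor {H V W : Type*} [AddCommGroup H] [Module k H] [AddCommGroup V]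
    [Module k V] [AddCommGroup W] [Module k W] (φ : H →ₗ[k] k) (f : V →ₗ[k] W) (t : H ⊗[k] V) :
    TensorProduct.lid k _ (LinearMap.rTensor _ φ (LinearMap.lTensor _ f t)) =
      f (TensorProduct.lid k _ (LinearMap.rTensor _ φ t)) := by
  induction t with
  | zero => simp
  | add t t' ht ht' => simp only [map_add, ht, ht']
  | tmul a b => simp

/-! ### Group-like vectors in arbitrary Yetter–Drinfeld modules -/

section pointed

variable [NeZero w] [IsAlgClosed k] [CharZero k]

/-- Every nonzero Yetter–Drinfeld module (indeed, every nonzero comodule) over `B(n, w, γ)`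
contains a nonzero vector `v` with `δ(v) = x^r g^i ⊗ v`. -/
theorem exists_coact_eq_xg_tmul (hD : D.IsYetterDrinfeld) [Nontrivial M] :
    ∃ (v : M) (r i : ℤ), v ≠ 0 ∧ D.coact v = xg n w γ r i ⊗ₜ v := by
  classical
  obtain ⟨v, hv⟩ := exists_ne (0 : M)
  let b := pbwBasis n w (γ := γ)
  set s := TensorProduct.equivFinsuppOfBasisLeft b (D.coact v) with hs
  have ht : D.coact v = s.sum fun p m => b p ⊗ₜ[k] m := by
    rw [← TensorProduct.equivFinsuppOfBasisLeft_symm_apply, hs, LinearEquiv.symm_apply_apply]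
  have hs0 : s ≠ 0 := by
    intro h0
    rw [h0, Finsupp.sum_zero_index] at ht
    have := hD.counit_coact v
    rw [ht, map_zero, map_zero] at this
    exact hv this.symm
  -- Take a basis element `y^a h` of `δ(v)` with `a` maximal, and let `s p` be its coefficient in
  -- `M`. Reading off `y^a h` from the first leg of the coassociativity identity leaves `g^a h ⊗ s
  -- p` on one side and `δ(s p)` on the other.
  obtain ⟨p, hp, hmax⟩ := s.support.exists_max_image Prod.fst (Finsupp.support_nonempty_iff.mpr hs0)
  have hsp : s p = TensorProduct.lid k _ (LinearMap.rTensor _ (b.coord p) (D.coact v)) := by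
    rw [hs, TensorProduct.equivFinsuppOfBasisLeft_apply]
  have h1 := congrArg (fun t => TensorProduct.lid k _ (LinearMap.rTensor _ (b.coord p) t))
    (hD.coassoc v)
  simp only [lid_rTensor_lTensor, ← hsp] at h1
  rw [ht, Finsupp.sum, map_sum, map_sum, map_sum, map_sum] at h1
  rw [Finset.sum_eq_single_of_mem p hp] at h1
  · rw [LinearMap.rTensor_tmul, lid_rTensor_assoc_tmul,
      show TensorProduct.lid k _ (LinearMap.rTensor _ (b.coord p)
        (Coalgebra.comul (R := k) (b p))) = _ from
        coord_rTensor_comul n w p.1 p.1 le_rfl p.2 p.2, if_pos rfl] at h1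
    obtain ⟨r, i, hri⟩ := xgElem_surjective n w γ p.2
    refine ⟨s p, 0 + r, (p.1 : ℕ) + i, Finsupp.mem_support_iff.mp hp, ?_⟩
    rw [← h1, hri, g_pow_eq_xg, xgElem, xg_mul]
  · intro q hq hqp
    rw [LinearMap.rTensor_tmul, lid_rTensor_assoc_tmul,
      show TensorProduct.lid k _ (LinearMap.rTensor _ (b.coord p)
        (Coalgebra.comul (R := k) (b q))) = _ from
        coord_rTensor_comul n w p.1 q.1 (hmax q hq) p.2 q.2, if_neg hqp, TensorProduct.zero_tmul]

end pointed

theorem exists_act_eq (hD : D.IsSimpleYetterDrinfeld) {v : M} (hv : v ≠ 0)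
    {h : LiuAlgebra n w γ} (hc : D.coact v = h ⊗ₜ v) (m : M) : ∃ a, D.act a v = m := by
  rcases hD.eq_bot_or_eq_top _ (isSubobject_orbit hD.isYetterDrinfeld hc) with h0 | h0
  · have : v ∈ LinearMap.range (D.act.toLinearMap.flip v) := ⟨1, by simp⟩
    rw [h0, Submodule.mem_bot] at this
    exact absurd this hv
  · exact LinearMap.range_eq_top.mp h0 m

/-- As `x` is central and group-like, its conjugation on the first leg is trivial. -/
theorem isMorphism_act_x (hD : D.IsYetterDrinfeld) : IsMorphism D D (D.act (x n w γ)) where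
  map_act h v := by
    rw [← Module.End.mul_apply, ← Module.End.mul_apply, ← map_mul, ← map_mul, (commute_x h).eq]
  map_coact v := by rw [hD.compat, ← twist_def, twist_x_eq]

theorem isMorphism_act_xinv (hD : D.IsYetterDrinfeld) : IsMorphism D D (D.act (xinv n w γ)) where
  map_act h v := by
    rw [← Module.End.mul_apply, ← Module.End.mul_apply, ← map_mul, ← map_mul, (commute_xinv h).eq]
  map_coact v := by rw [hD.compat, ← twist_def, twist_xinv_eq]

/-! ### The central element `x` acts by a scalar -/

section central

open Polynomial

/-- A `k[X]`-span is stable under an operator commuting with `X` which maps generators into it. -/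
theorem of_apply_mem_span {T φ : Module.End k M} (hφ : Commute φ T) {S : Set M}
    (hS : ∀ s ∈ S, Module.AEval'.of T (φ s) ∈ Submodule.span k[X] (Module.AEval'.of T '' S))
    (m : M) (hm : Module.AEval'.of T m ∈ Submodule.span k[X] (Module.AEval'.of T '' S)) :
    Module.AEval'.of T (φ m) ∈ Submodule.span k[X] (Module.AEval'.of T '' S) := by
  suffices ∀ t ∈ Submodule.span k[X] (Module.AEval'.of T '' S),
      Module.AEval'.of T (φ ((Module.AEval'.of T).symm t)) ∈
        Submodule.span k[X] (Module.AEval'.of T '' S) by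
    simpa using this _ hm
  intro t ht
  induction ht using Submodule.span_induction with
  | mem t ht =>
    obtain ⟨s, hs, rfl⟩ := ht
    simpa using hS s hs
  | zero => simp
  | add s t _ _ hs ht => simpa only [map_add] using Submodule.add_mem _ hs ht
  | smul p t _ ht =>
    have hc : Commute φ (aeval T p) := by
      induction p using Polynomial.induction_on' with
      | add p q hp hq => rw [map_add]; exact hp.add_right hq
      | monomial d c =>
        rw [aeval_monomial]
        exact (Algebra.commute_algebraMap_right c φ).mul_right (hφ.pow_right d)
    have : Module.AEval'.of T (φ ((Module.AEval'.of T).symm (p • t))) =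
        p • Module.AEval'.of T (φ ((Module.AEval'.of T).symm t)) := by
      rw [Module.AEval.of_symm_smul, Module.End.smul_def, ← Module.End.mul_apply, hc.eq,
        ← Module.AEval.of_aeval_smul]
      rfl
    rw [this]
    exact Submodule.smul_mem _ p ht

/-- The relation `x² = (x + x⁻¹) x - 1` for the operators on a module. -/
theorem act_x_act_x (m : M) : D.act (x n w γ) (D.act (x n w γ) m) =
    (D.act (x n w γ) + D.act (xinv n w γ)) (D.act (x n w γ) m) - m := by
  have : D.act (xinv n w γ) (D.act (x n w γ) m) = m := by
    rw [← Module.End.mul_apply, ← map_mul, xinv_mul_x, map_one, Module.End.one_apply]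
  rw [LinearMap.add_apply, this, add_sub_cancel_right]

/-- A cyclic `B(n, w, γ)`-module is finitely generated over `k[x + x⁻¹]`. -/
theorem aeval_finite_of_cyclic {v : M} (hv : ∀ m, ∃ a, D.act a v = m) :
    Module.Finite k[X] (Module.AEval' (D.act (x n w γ) + D.act (xinv n w γ))) := by
  have hγ0 : γ ≠ 0 := hγ.out.ne_zero (NeZero.ne n)
  set T := D.act (x n w γ) + D.act (xinv n w γ) with hT
  -- Two powers of `x` suffice, since `x` satisfies a monic quadratic equation over `k[x + x⁻¹]`.
  -- Exponents of `g` and `y` stay below `n` because `gⁿ` and `yⁿ` are polynomials in `x`.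
  let z (p : Fin 2 × Fin n × Fin n) : M :=
    D.act (x n w γ ^ (p.1 : ℕ) * g n w γ ^ (p.2.1 : ℕ) * y n w γ ^ (p.2.2 : ℕ)) v
  let N : Submodule k[X] (Module.AEval' T) := Submodule.span k[X] (Module.AEval'.of T '' Set.range z)
  let P : Submodule k M := (N.restrictScalars k).comap (Module.AEval'.of T).toLinearMap
  have memP (m : M) : m ∈ P ↔ Module.AEval'.of T m ∈ N := Iff.rfl
  have hTP (m) (hm : m ∈ P) : T m ∈ P := by
    rw [memP, ← Module.AEval'.X_smul_of]
    exact N.smul_mem _ hm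
  have hcomm (h : LiuAlgebra n w γ) : Commute (D.act h) T := by
    have h1 : Commute (D.act h) (D.act (x n w γ)) := (commute_x h).symm.map D.act
    have h2 : Commute (D.act h) (D.act (xinv n w γ)) := (commute_xinv h).symm.map D.act
    exact h1.add_right h2
  have hzP (p) : z p ∈ P := (memP _).mpr (Submodule.subset_span ⟨_, ⟨p, rfl⟩, rfl⟩)
  -- Every `h` commutes with the central operator `T`, so stability need only be tested on the
  -- generators `z p`.
  have closed (h : LiuAlgebra n w γ) (hz : ∀ p, D.act h (z p) ∈ P) (m) (hm : m ∈ P) :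
      D.act h m ∈ P :=
    of_apply_mem_span (hcomm h) (by rintro _ ⟨p, rfl⟩; exact hz p) m hm
  have hx := closed (x n w γ) (by
    rintro ⟨e, i, a⟩
    have hz (i a : Fin n) : D.act (x n w γ) (z (0, i, a)) = z (1, i, a) := by
      simp [z, mul_assoc]
    fin_cases e
    · exact (hz i a).symm ▸ hzP _
    · change D.act (x n w γ) (z (1, i, a)) ∈ P
      rw [← hz, act_x_act_x, hz]
      exact P.sub_mem (hTP _ (hzP _)) (hzP _))
  have hx' (m) (hm : m ∈ P) : D.act (xinv n w γ) m ∈ P := by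
    have : D.act (xinv n w γ) m = T m - D.act (x n w γ) m := by
      rw [hT, LinearMap.add_apply, add_sub_cancel_left]
    rw [this]
    exact P.sub_mem (hTP m hm) (hx m hm)
  have hxw (N : ℕ) (m) (hm : m ∈ P) : D.act (x n w γ ^ N) m ∈ P := by
    induction N with
    | zero => simpa using hm
    | succ N ih => rw [pow_succ', map_mul, Module.End.mul_apply]; exact hx _ ih
  have hg := closed (g n w γ) (by
    rintro ⟨e, i, a⟩
    have h1 : g n w γ * (x n w γ ^ (e : ℕ) * g n w γ ^ (i : ℕ) * y n w γ ^ (a : ℕ)) =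
        x n w γ ^ (e : ℕ) * g n w γ ^ (i + 1 : ℕ) * y n w γ ^ (a : ℕ) := by
      rw [← mul_assoc, ← mul_assoc, ((commute_x (g n w γ)).pow_left _).symm.eq, mul_assoc _ (g n w γ),
        ← pow_succ']
    rw [← Module.End.mul_apply, ← map_mul, h1]
    rcases (Nat.succ_le_of_lt i.2).lt_or_eq with h2 | h2
    · exact hzP (e, ⟨i + 1, h2⟩, a)
    · have h3 : g n w γ ^ (i + 1 : ℕ) = x n w γ ^ w := by
        rw [← g_pow]
        exact congrArg (g n w γ ^ ·) h2
      rw [h3, ← pow_add, add_comm, pow_add, mul_assoc, map_mul, Module.End.mul_apply]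
      refine hxw _ _ ?_
      simpa [z] using hzP (e, ⟨0, NeZero.pos n⟩, a))
  have hy := closed (y n w γ) (by
    rintro ⟨e, i, a⟩
    have h1 : y n w γ * (x n w γ ^ (e : ℕ) * g n w γ ^ (i : ℕ) * y n w γ ^ (a : ℕ)) =
        γ ^ (i : ℕ) • (x n w γ ^ (e : ℕ) * g n w γ ^ (i : ℕ) * y n w γ ^ (a + 1 : ℕ)) := by
      rw [← mul_assoc, ← mul_assoc, ((commute_x (y n w γ)).pow_left _).symm.eq, mul_assoc _ (y n w γ),
        qcomm_mul_pow γ _ _ (y_mul_g n w γ), mul_smul_comm, smul_mul_assoc, pow_succ']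
      simp only [mul_assoc]
    rw [← Module.End.mul_apply, ← map_mul, h1, map_smul, LinearMap.smul_apply]
    refine P.smul_mem _ ?_
    rcases (Nat.succ_le_of_lt a.2).lt_or_eq with h2 | h2
    · exact hzP (e, i, ⟨a + 1, h2⟩)
    · have h3 : y n w γ ^ (a + 1 : ℕ) = 1 - x n w γ ^ w := by
        rw [← y_pow]
        exact congrArg (y n w γ ^ ·) h2
      have h4 : D.act (x n w γ ^ (e : ℕ) * g n w γ ^ (i : ℕ)) v ∈ P := by
        simpa [z] using hzP (e, i, ⟨0, NeZero.pos n⟩)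
      rw [h3, mul_sub, mul_one, ((commute_x _).pow_left w).symm.eq, map_sub, LinearMap.sub_apply,
        map_mul _ (x n w γ ^ w), Module.End.mul_apply]
      exact P.sub_mem h4 (hxw _ _ h4))
  have hvP : v ∈ P := by
    simpa [z] using hzP (0, ⟨0, NeZero.pos n⟩, ⟨0, NeZero.pos n⟩)
  have hN : N = ⊤ := by
    refine eq_top_iff.mpr fun t _ => ?_
    obtain ⟨a, ha⟩ := hv ((Module.AEval'.of T).symm t)
    have := act_mem_of_generators D P hx hx' hg hy a v hvP
    rw [ha, memP] at this
    simpa using this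
  exact ⟨⟨((Set.finite_range z).image (Module.AEval'.of T)).toFinset, by
    rw [Set.Finite.coe_toFinset]; exact hN⟩⟩

/-- An operator with `k[X]`-finitely generated module structure which is zero or surjective is
algebraic. -/
theorem exists_aeval_eq_zero_of_finite (T : Module.End k M)
    [Module.Finite k[X] (Module.AEval' T)] (hT : T = 0 ∨ Function.Surjective T) :
    ∃ p : k[X], p ≠ 0 ∧ aeval T p = 0 := by
  rcases hT with rfl | hT
  · exact ⟨X, X_ne_zero, by simp⟩
  -- Surjectivity says that `X` times the module is the whole module. Nakayama's lemma then gives an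
  -- annihilating `p` with `p ≡ 1` modulo `X`, which is therefore nonzero.
  · obtain ⟨p, hp, hp'⟩ := Submodule.exists_sub_one_mem_and_smul_eq_zero_of_fg_of_le_smul
      (Ideal.span {(X : k[X])}) (⊤ : Submodule k[X] (Module.AEval' T)) Module.Finite.fg_top (by
        intro t _
        obtain ⟨m, hm⟩ := hT ((Module.AEval'.of T).symm t)
        have : t = (X : k[X]) • Module.AEval'.of T m := by
          rw [Module.AEval'.X_smul_of, hm, LinearEquiv.apply_symm_apply]
        rw [this]
        exact Submodule.smul_mem_smul (Ideal.mem_span_singleton_self X) trivial)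
    refine ⟨p, ?_, LinearMap.ext fun m => ?_⟩
    · rintro rfl
      rw [Ideal.mem_span_singleton, zero_sub, dvd_neg] at hp
      exact not_isUnit_X (isUnit_of_dvd_one hp)
    · have := hp' (Module.AEval'.of T m) trivial
      rw [← Module.AEval.of_aeval_smul] at this
      exact (Module.AEval'.of T).map_eq_zero_iff.mp this

variable [IsAlgClosed k] [NeZero w] [CharZero k]

/-- The central element `x` acts on a simple Yetter–Drinfeld module by a scalar. -/
theorem exists_act_x_eq_smul (hD : D.IsSimpleYetterDrinfeld) :
    ∃ α : kˣ, ∀ m, D.act (x n w γ) m = (α : k) • m := by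
  have := hD.nontrivial
  obtain ⟨v, r, i, hv, hc⟩ := exists_coact_eq_xg_tmul hD.isYetterDrinfeld
  have hfin := aeval_finite_of_cyclic (exists_act_eq hD hv hc)
  have hT := (isMorphism_act_x hD.isYetterDrinfeld).add (isMorphism_act_xinv hD.isYetterDrinfeld)
  obtain ⟨p, hp, hp'⟩ := exists_aeval_eq_zero_of_finite (D.act (x n w γ) + D.act (xinv n w γ))
    (or_iff_not_imp_left.mpr (hT.surjective_of_simple hD))
  obtain ⟨τ, hτ⟩ := hT.exists_eq_smul_one hD p hp hp'
  -- Once `x + x⁻¹` is the scalar `τ`, the operator `x` is a root of this polynomial, and Schur's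
  -- lemma applies a second time.
  have hq : (X ^ 2 - C τ * X + 1 : k[X]) ≠ 0 := by
    intro h
    have := congrArg (eval 0) h
    simp at this
  obtain ⟨α, hα⟩ := (isMorphism_act_x hD.isYetterDrinfeld).exists_eq_smul_one hD
    (X ^ 2 - C τ * X + 1) hq (LinearMap.ext fun m => by
      have h1 := act_x_act_x (D := D) m
      rw [hτ] at h1
      simp [pow_two, h1])
  have hα0 : α ≠ 0 := by
    rintro rfl
    have h1 : D.act (xinv n w γ) (D.act (x n w γ) v) = v := by
      rw [← Module.End.mul_apply, ← map_mul, xinv_mul_x, map_one, Module.End.one_apply]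
    rw [hα] at h1
    simp at h1
    exact hv h1.symm
  exact ⟨Units.mk0 α hα0, fun m => by rw [hα]; rfl⟩

/-! ### Group-like eigenvectors and the classification -/

theorem act_x_pow {α : k} (hα : ∀ m, D.act (x n w γ) m = α • m) (N : ℕ) (m : M) :
    D.act (x n w γ ^ N) m = α ^ N • m := by
  induction N with
  | zero => simp
  | succ N ih => rw [pow_succ', map_mul, Module.End.mul_apply, ih, hα, smul_smul, pow_succ']

/-- A simple Yetter–Drinfeld module contains a group-like eigenvector of `x` and `g`. -/
theorem exists_highest_vector (hD : D.IsSimpleYetterDrinfeld) :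
    ∃ (α β : kˣ) (r i : ℤ) (v : M), α ^ w = β ^ n ∧ v ≠ 0 ∧
      (∀ m, D.act (x n w γ) m = (α : k) • m) ∧ D.act (g n w γ) v = (β : k) • v ∧
      D.coact v = xg n w γ r i ⊗ₜ v := by
  have := hD.nontrivial
  obtain ⟨α, hα⟩ := exists_act_x_eq_smul hD
  obtain ⟨u, r, i, hu, hc⟩ := exists_coact_eq_xg_tmul hD.isYetterDrinfeld
  have hgn (m : M) : D.act (g n w γ ^ n) m = (α : k) ^ w • m := by
    rw [g_pow, act_x_pow hα]
  -- Since `g` commutes with `x^r g^i`, the vectors coacted on by this element form a `g`-stable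
  -- space, and an eigenvector can be sought inside it.
  have hg (q : k[X]) : D.coact (aeval (D.act (g n w γ)) q u) =
      xg n w γ r i ⊗ₜ aeval (D.act (g n w γ)) q u := by
    have hg1 (m : M) (hm : D.coact m = xg n w γ r i ⊗ₜ m) :
        D.coact (D.act (g n w γ) m) = xg n w γ r i ⊗ₜ D.act (g n w γ) m := by
      rw [hD.isYetterDrinfeld.compat, ← twist_def, hm, twist_g, g_eq_xg, ginv_eq_xg, xg_mul, xg_mul]
      congr 2 <;> ring
    induction q using Polynomial.induction_on' with
    | add p q hp hq => simp only [map_add, LinearMap.add_apply, hp, hq, TensorProduct.tmul_add]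
    | monomial d c =>
      rw [aeval_monomial, Module.End.mul_apply, Module.algebraMap_end_apply, map_smul,
        TensorProduct.tmul_smul]
      congr 1
      induction d with
      | zero => simpa using hc
      | succ d ih => rw [pow_succ', Module.End.mul_apply]; exact hg1 _ ih
  obtain ⟨q, b, hq, hb⟩ := Module.End.exists_aeval_eigenvector (D.act (g n w γ)) hu
    (X ^ n - C ((α : k) ^ w)) (X_pow_sub_C_ne_zero (NeZero.pos n) _) (by
      have := hgn u
      rw [map_pow] at this
      rw [map_sub, map_pow, aeval_X, aeval_C, LinearMap.sub_apply, this,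
        Module.algebraMap_end_apply, sub_self])
  set v := aeval (D.act (g n w γ)) q u
  have hbn (N : ℕ) : D.act (g n w γ ^ N) v = b ^ N • v := by
    induction N with
    | zero => simp
    | succ N ih =>
      rw [pow_succ', map_mul, Module.End.mul_apply, ih, map_smul, hb, smul_smul, pow_succ]
  have hαb : (α : k) ^ w = b ^ n := smul_left_injective k hq ((hgn v).symm.trans (hbn n))
  have hb0 : b ≠ 0 := by
    rintro rfl
    rw [zero_pow (NeZero.ne n)] at hαb
    exact pow_ne_zero w α.ne_zero hαb
  exact ⟨α, Units.mk0 b hb0, r, i, v, Units.ext (by simpa using hαb), hq, hα, hb, hg q⟩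

/-- Every simple Yetter–Drinfeld module is isomorphic to some `V(α, β, x^r g^i)`. -/
theorem exists_isomorphic_V (hD : D.IsSimpleYetterDrinfeld) :
    ∃ (α β : kˣ) (r i : ℤ) (h : α ^ w = β ^ n), D.Isomorphic (V n w γ α β r i h) := by
  have := hD.nontrivial
  obtain ⟨α, β, r, i, v, hαβ, hv, hx, hg, hc⟩ := exists_highest_vector hD
  have hαβ' : (α : k) ^ w = (β : k) ^ n := by exact_mod_cast congrArg Units.val hαβ
  have hgl := act_g_act_y_pow D (β : k) hg
  have hcl := coact_act_y_pow D hD.isYetterDrinfeld β r i hg hc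
  have hyl (a : ℕ) : D.act (y n w γ) (D.act (y n w γ ^ a) v) = D.act (y n w γ ^ (a + 1)) v := by
    rw [pow_succ', map_mul, Module.End.mul_apply]
  have hyn (m : M) : D.act (y n w γ ^ n) m = (1 - (β : k) ^ n) • m := by
    rw [y_pow, map_sub, LinearMap.sub_apply, act_x_pow hx, hαβ', map_one, sub_smul, one_smul]
    rfl
  -- This closing relation of the string is immediate from `yⁿ = 1 - x^w` when `βⁿ ≠ 1`. When `βⁿ =
  -- 1` and `m + 1 < n` it does not follow from the relations of `H` alone and uses simplicity.
  have htop : D.act (y n w γ ^ (liuTop n γ β i + 1)) v = (1 - (β : k) ^ n) • v := by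
    by_cases hβ : (β : k) ^ n = 1
    · rw [hβ, sub_self, zero_smul]
      -- The tail of the string beyond `m` is a subcomodule because `c(a, l) = 0` for `l ≤ m < a`.
      let W : Submodule k M := Submodule.span k
        ((fun l : ℕ => D.act (y n w γ ^ l) v) '' Set.Ioi (liuTop n γ β i))
      have hmem (l : ℕ) (hl : liuTop n γ β i < l) : D.act (y n w γ ^ l) v ∈ W :=
        Submodule.subset_span ⟨l, hl, rfl⟩
      have hle (W' : Submodule k M)
          (h : ∀ l, liuTop n γ β i < l → D.act (y n w γ ^ l) v ∈ W') : W ≤ W' := by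
        refine Submodule.span_le.mpr ?_
        rintro _ ⟨l, hl, rfl⟩
        exact h l hl
      have hx' (m : M) : D.act (xinv n w γ) m = (α : k)⁻¹ • m := by
        have h1 : D.act (xinv n w γ) (D.act (x n w γ) m) = m := by
          rw [← Module.End.mul_apply, ← map_mul, xinv_mul_x, map_one, Module.End.one_apply]
        rw [hx, map_smul] at h1
        conv_rhs => rw [← h1]
        rw [smul_smul, inv_mul_cancel₀ α.ne_zero, one_smul]
      have hW : D.IsSubobject W := by
        refine ⟨act_mem_of_generators D W (fun m hm => ?_) (fun m hm => ?_) ?_ ?_, ?_⟩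
        · rw [hx]; exact W.smul_mem _ hm
        · rw [hx']; exact W.smul_mem _ hm
        · refine hle (W.comap (D.act (g n w γ))) fun l hl => ?_
          rw [Submodule.mem_comap, hgl]
          exact W.smul_mem _ (hmem l hl)
        · refine hle (W.comap (D.act (y n w γ))) fun l hl => ?_
          rw [Submodule.mem_comap, hyl]
          exact hmem _ (hl.trans (Nat.lt_succ_self l))
        · refine hle ((LinearMap.range (LinearMap.lTensor _ W.subtype)).comap D.coact)
            fun l hl => ?_
          rw [Submodule.mem_comap, hcl]
          refine Submodule.sum_mem _ fun j _ => ?_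
          by_cases hj : j ≤ liuTop n γ β i
          · rw [coactionCoeff_eq_zero_of_liuTop n w β r i hβ hj hl, TensorProduct.zero_tmul]
            exact zero_mem _
          · exact ⟨coactionCoeff n w γ β r i l j ⊗ₜ ⟨_, hmem j (not_le.mp hj)⟩, rfl⟩
      rcases hD.eq_bot_or_eq_top W hW with h0 | h0
      · have := hmem _ (Nat.lt_succ_self _)
        rwa [h0, Submodule.mem_bot] at this
      -- If the tail were everything, `y` would be surjective, although `yⁿ` acts as `1 - βⁿ = 0` on
      -- `M ≠ 0`.
      · have h1 : Function.Surjective (D.act (y n w γ)) := by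
          rw [← LinearMap.range_eq_top, eq_top_iff, ← h0]
          refine hle _ fun l hl => ?_
          obtain ⟨l, rfl⟩ := Nat.exists_eq_succ_of_ne_zero (Nat.ne_zero_of_lt hl)
          exact ⟨_, hyl l⟩
        have h2 : Function.Surjective (D.act (y n w γ ^ n)) := by
          rw [map_pow, Module.End.coe_pow]
          exact h1.iterate n
        obtain ⟨m, hm⟩ := h2 v
        rw [hyn, hβ, sub_self, zero_smul] at hm
        exact absurd hm.symm hv
    · rw [show y n w γ ^ (liuTop n γ β i + 1) = y n w γ ^ n from
        congrArg (y n w γ ^ ·) (liuTop_eq_of_pow_ne_one n β i hβ), hyn]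
  obtain ⟨f, hf, hfv⟩ := exists_isMorphism_V α β r i hαβ D (fun l => D.act (y n w γ ^ l) v)
    (fun l => hx _) hgl (fun l _ => hyl l) (by rw [hyl, htop]; simp) (fun j _ => hcl j)
  refine ⟨α, β, r, i, hαβ, (hf.isomorphic (V_isSimple n w α β r i hαβ) hD ?_).symm⟩
  rintro rfl
  refine hv ?_
  simpa using (hfv 0 (Nat.zero_le _)).symm

end central

end LiuAlgebra

/-! ### The classification theorem -/

theorem theorem4p4 {k : Type*} [Field k] [IsAlgClosed k] [CharZero k]
    (n w : ℕ) [NeZero n] [NeZero w] (γ : k) [Fact (IsPrimitiveRoot γ n)] :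
    -- every `V(α, β, x^r g^i)` is a simple Yetter–Drinfeld module, of the indicated dimension
    (∀ (α β : kˣ) (r i : ℤ) (h : α ^ w = β ^ n),
      (LiuAlgebra.V n w γ α β r i h).IsSimpleYetterDrinfeld ∧
      (∀ j : ℤ, (β : k) = γ ^ j →
        Module.finrank k (Fin (liuTop n γ β i + 1) → k) = n + 1 - liuPhi n (-i - j)) ∧
      ((β : k) ^ n ≠ 1 → Module.finrank k (Fin (liuTop n γ β i + 1) → k) = n)) ∧
    -- every simple Yetter–Drinfeld module is isomorphic to one of them
    (∀ (M : Type*) [AddCommGroup M] [Module k M] (D : ActionCoaction k (LiuAlgebra n w γ) M),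
      D.IsSimpleYetterDrinfeld →
        ∃ (α β : kˣ) (r i : ℤ) (h : α ^ w = β ^ n),
          D.Isomorphic (LiuAlgebra.V n w γ α β r i h)) ∧
    -- the isomorphism criterion
    (∀ (α β α' β' : kˣ) (r i r' i' : ℤ) (h : α ^ w = β ^ n) (h' : α' ^ w = β' ^ n),
      (LiuAlgebra.V n w γ α β r i h).Isomorphic (LiuAlgebra.V n w γ α' β' r' i' h') ↔
        α = α' ∧ β = β' ∧ LiuAlgebra.xg n w γ r i = LiuAlgebra.xg n w γ r' i') := by
  refine ⟨fun α β r i h => ⟨LiuAlgebra.V_isSimple n w α β r i h, fun j hj => ?_, fun hβ => ?_⟩,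
    fun M _ _ D hD => LiuAlgebra.exists_isomorphic_V hD,
    fun α β α' β' r i r' i' h h' => ⟨LiuAlgebra.eq_of_V_isomorphic n w, ?_⟩⟩
  -- The bound `φ ≤ n` reconciles the truncated subtractions in `(n - φ) + 1` and `n + 1 - φ`.
  · have h1 := ((liuPhi_unique n (-i - j) _).mp rfl).2.1
    rw [Module.finrank_fin_fun, LiuAlgebra.liuTop_eq_of_eq_zpow n β i j hj]
    omega
  · rw [Module.finrank_fin_fun, LiuAlgebra.liuTop_eq_of_pow_ne_one n β i hβ]
  · rintro ⟨rfl, rfl, hxg⟩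
    exact LiuAlgebra.V_isomorphic_of_xg_eq n w α β r i r' i' h hxg
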